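/- **Setting.** Fix a constant $k$ and polynomials bounding the number of terms, the norm, the inverse gap, the bit length $p(n)$ and the circuit size. An instance is $(\hat H,\hat a,\hat b)$, where $\hat H=\sum_{j=1}^m \hat H_j$ is a real symmetric matrix on $n$ qubits, each $\hat H_j$ acts on at most $k$ qubits, $m\le \mathrm{poly}(n)$, $\|\hat H\|\le \nu(n)$ for a polynomial $\nu$, $\hat b-\hat a\ge 1/\mathrm{poly}(n)$, and the entries of the $\hat H_j$ and $\hat a,\hat b$ are fractions $N_1/N_2$ of integers with $|N_i|\le 2^{p(n)}$. Write $\lambda(\cdot)$ for the minimum eigenvalue. *Yes instance:* $\lambda(\hat H)\le \hat a$, and some real normalized ground state $\psi$ of $\hat H$ is succinct: a Boolean circuit $C$ of size $\mathrm{poly}(n)$ outputs $C(x)=c\,\langle x|\psi\rangle$ exactly for all $x\in\{0,1\}^n$, with $0<c\le 2^{\mathrm{poly}(n)}$ independent of $x$ and every $C(x)$ a fraction of integers of absolute value at most $2^{p(n)}$. *No instance:* $\lambda(\hat H)\ge \hat b$. **Algorithm.** A witness is $(\hat\lambda,C,x_{in})$: a rational number, a circuit with rational outputs $\phi(x)=C(x)$,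 and $x_{in}\in\{0,1\}^n$. Reject if $\hat\lambda>\hat a$. Put $S=\{x:\phi(x)\ne 0\}$, let $H_S,\phi_S$ be the restrictions of $\hat H-\hat\lambda I$ and $\phi$ to $S$, let $S^+$ be the set of pairs $x\neq y$ in $S$ with $\phi(x)\langle x|H_S|y\rangle\phi(y)>0$, and define $$\langle x|F|y\rangle=\begin{cases}0,&(x,y)\in S^+,\\ \langle x|H_S|y\rangle,& x\ne y,\ (x,y)\notin S^+,\\ \langle x|H_S|x\rangle+\sum_{z:(x,z)\in S^+}\langle x|H_S|z\rangle\frac{\phi(z)}{\phi(x)},& x=y,\end{cases}\qquad \langle y|G|x\rangle=-\langle y|F|x\rangle\frac{\phi(y)}{\phi(x)} .$$ Reject if $x_{in}\notin S$. Let $t=T(n)$ for a polynomial $T$ and $M=2^k m n^3 t\cdot 2\nu(n)$. Start with $x=x_{in}$, $\tau=0$ and transition count $0$. While $\tau<t$: reject if $\phi(x)$ is not a fraction of integers of absolute value at most $2^{p(n)}$, or if $\sum_{z\in S}\langle z|G|x\rangle\ne 0$ or $\langle y|G|x\rangle<0$ for some $y\in S$, $y\ne x$, or if the transition count exceeds $M$;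 if $\langle x|G|x\rangle=0$, set $\tau=t$; otherwise sample $u$ uniformly from $[0,1]$, add $\ln(1/u)/|\langle x|G|x\rangle|$ to $\tau$, replace $x$ by $y\neq x$ with probability $\langle y|G|x\rangle/|\langle x|G|x\rangle|$ (by another uniform sample from $[0,1]$), and increase the transition count by one. When the loop ends, accept. **Theorem.** There are polynomials $L$ and $T_0$, depending only on $k$ and the given polynomials, such that for every polynomial $T$ with natural coefficients: 1. The algorithm, carried out by elementary operations, takes for all instances, all witnesses and all outcomes of the sampling a number of steps that is polynomial in $n$ plus the length of the witness. (Operations on bits, strings and fractions are charged by length; exact uniform samples from $[0,1]$ and operations on the real numbers obtained from them cost one step each.) Acceptance is a measurable event. 2. For every Yes instance there is a witness of length at most $L(n)$ that is accepted with probability at least $1/2$. 3. For every No instance, every witness and every $\epsilon$ with $0\le\epsilon\le\min(\tfrac12,\hat b-\hat a)$, the acceptance probability is at most $2^n\,2^{3p(n)}(1-\epsilon/2)^{t}$, where $t=T(n)$. 4. If $T\ge T_0$ pointwise, then for every No instance every witness is rejected with probability at least $1-2^{-n}$. -/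

import Mathlib

open Polynomial MeasureTheory

/-! ## Bit strings, local Hamiltonians -/

/-- Bit strings of length `n`, the labels of the computational basis of `n` qubits. -/
abbrev Cube (n : ℕ) := Fin n → Bool

/-- `q` is of the form `N₁ / N₂` with integers `|N₁|, |N₂| ≤ 2 ^ p`
(equivalently, the reduced fraction is of this form). -/
def RatBits (p : ℕ) (q : ℚ) : Prop := q.num.natAbs ≤ 2 ^ p ∧ q.den ≤ 2 ^ p

instance (p : ℕ) (q : ℚ) : Decidable (RatBits p q) := by
  unfold RatBits; infer_instance

/-- The number of bits of a reduced fraction. -/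
def ratSize (q : ℚ) : ℕ := Nat.size q.num.natAbs + Nat.size q.den

/-- A real operator acting on at most `k` of `n` qubits. The listed qubits need not be distinct, so
that exactly the operators supported on at most `k` qubits are described (also if `n < k`). -/
structure LocalTerm (n k : ℕ) where
  qubits : Fin k → Fin n
  mat : Matrix (Fin k → Bool) (Fin k → Bool) ℚ

/-- The matrix entry `⟨x|h|y⟩`: the identity on all qubits that are not listed. -/
def LocalTerm.entry {n k : ℕ} (h : LocalTerm n k) (x y : Cube n) : ℚ :=
  if ∀ i, (∀ j, h.qubits j ≠ i) → x i = y i then h.mat (x ∘ h.qubits) (y ∘ h.qubits) else 0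

/-- Overwrite the listed qubits of `x` by the binary digits of `c`. -/
def LocalTerm.overwrite {n k : ℕ} (h : LocalTerm n k) (x : Cube n) (c : ℕ) : Cube n :=
  (List.finRange k).foldl (fun y j => Function.update y (h.qubits j) (c.testBit j)) x

/-- The data `(H, a, b)` of the local Hamiltonian problem. -/
structure LHInstance (n k : ℕ) where
  terms : List (LocalTerm n k)
  a : ℚ
  b : ℚ

namespace LHInstance

variable {n k : ℕ}

/-- The Hamiltonian, the sum of the local terms. -/
def ham (I : LHInstance n k) : Matrix (Cube n) (Cube n) ℚ :=
  Matrix.of fun x y => (I.terms.map fun h => h.entry x y).sum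

/-- The Hamiltonian as a real matrix. -/
noncomputable def hamReal (I : LHInstance n k) : Matrix (Cube n) (Cube n) ℝ :=
  I.ham.map fun q => (q : ℝ)

/-- The candidates for the nonzero positions of row (or column) `x`, term by term. -/
def candidates (I : LHInstance n k) (x : Cube n) : List (Cube n) :=
  I.terms.flatMap fun h => (List.range (2 ^ k)).map fun c => h.overwrite x c

/-- A list without repetition of strings `y ≠ x` that contains every `y ≠ x` with
`⟨y|H|x⟩ ≠ 0`. -/
def neighbours (I : LHInstance n k) (x : Cube n) : List (Cube n) :=
  ((I.candidates x).filter fun y => y ≠ x).dedup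

end LHInstance

/-- The minimum eigenvalue of a real symmetric matrix. -/
noncomputable def groundEnergy {ι : Type*} [Fintype ι] [DecidableEq ι] (A : Matrix ι ι ℝ) : ℝ :=
  sInf (spectrum ℝ A)

/-! ## Circuits -/

/-- A Boolean gate. It reads earlier gates by their position; a missing position reads `false`. -/
inductive Gate (n : ℕ) where
  | inp (i : Fin n)
  | const (b : Bool)
  | not (i : ℕ)
  | and (i j : ℕ)
  | or (i j : ℕ)

/-- The value of a gate, on input `x`, after the earlier gates took the values `w`. -/
def Gate.eval {n : ℕ} (x : Cube n) (w : List Bool) : Gate n → Bool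
  | .inp i => x i
  | .const b => b
  | .not i => !(w.getD i false)
  | .and i j => w.getD i false && w.getD j false
  | .or i j => w.getD i false || w.getD j false

/-- The length of the description of a gate. -/
def Gate.size {n : ℕ} : Gate n → ℕ
  | .inp _ => n + 1
  | .const _ => 1
  | .not i => Nat.size i + 1
  | .and i j => Nat.size i + Nat.size j + 1
  | .or i j => Nat.size i + Nat.size j + 1

/-- The natural number with the given binary digits, least significant digit first. -/
def natOfBits (l : List Bool) : ℕ := l.foldr (fun b m => b.toNat + 2 * m) 0

/-- A Boolean circuit with `n` input bits whose output bits are a sign, the binary digits of a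
numerator and the binary digits of a denominator. -/
structure AmpCircuit (n : ℕ) where
  gates : List (Gate n)
  sign : ℕ
  num : List ℕ
  den : List ℕ

namespace AmpCircuit

variable {n : ℕ}

/-- The values of all gates. -/
def wires (C : AmpCircuit n) (x : Cube n) : List Bool :=
  C.gates.foldl (fun w g => w ++ [g.eval x w]) []

/-- The number that the circuit outputs on input `x` (`0` if the denominator is `0`). -/
def amp (C : AmpCircuit n) (x : Cube n) : ℚ :=
  let w := C.wires x
  let q : ℚ := (natOfBits (C.num.map fun i => w.getD i false) : ℚ) /
    (natOfBits (C.den.map fun i => w.getD i false) : ℚ)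
  if w.getD C.sign false then -q else q

/-- The length of the description of the circuit. -/
def size (C : AmpCircuit n) : ℕ :=
  (C.gates.map Gate.size).sum + (Nat.size C.sign + 1) +
    (C.num.map fun i => Nat.size i + 1).sum + (C.den.map fun i => Nat.size i + 1).sum

end AmpCircuit

/-! ## The promise problem -/

/-- The constants and polynomials of the local Hamiltonian problem with succinct ground state. -/
structure Bounds where
  /-- locality -/
  k : ℕ
  /-- bound for the number of terms -/
  terms : ℕ[X]
  /-- bound for the spectral norm of the Hamiltonian -/
  norm : ℕ[X]
  /-- `b - a ≥ 1 / gap n` -/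
  gap : ℕ[X]
  /-- number of bits of every value (entries, thresholds, outputs of an honest circuit) -/
  bits : ℕ[X]
  /-- bound for the size of the circuit of a succinct state, and for the number of bits of its
  scaling factor -/
  circ : ℕ[X]

/-- A normalized real state `ψ` is succinct: a circuit of polynomial size computes its amplitudes
exactly, up to a common factor `0 < c ≤ 2 ^ poly`, each output being represented by `p n` bits. -/
def IsSuccinct (B : Bounds) {n : ℕ} (ψ : Cube n → ℝ) : Prop :=
  ∃ C : AmpCircuit n, C.size ≤ B.circ.eval n ∧ (∀ x, RatBits (B.bits.eval n) (C.amp x)) ∧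
    ∃ c : ℝ, 0 < c ∧ c ≤ 2 ^ B.circ.eval n ∧ ∀ x, (C.amp x : ℝ) = c * ψ x

namespace LHInstance

/-- The standing format of the instances. -/
structure WellFormed (B : Bounds) {n : ℕ} (I : LHInstance n B.k) : Prop where
  symm : I.ham.IsSymm
  terms_le : I.terms.length ≤ B.terms.eval n
  norm_le : ‖Matrix.toEuclideanCLM (𝕜 := ℝ) I.hamReal‖ ≤ B.norm.eval n
  gap_ge : 1 ≤ (I.b - I.a) * B.gap.eval n
  bits_mat : ∀ h ∈ I.terms, ∀ r s, RatBits (B.bits.eval n) (h.mat r s)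
  bits_a : RatBits (B.bits.eval n) I.a
  bits_b : RatBits (B.bits.eval n) I.b

/-- Yes instance: small ground energy, and some ground state is succinct. -/
def IsYes (B : Bounds) {n : ℕ} (I : LHInstance n B.k) : Prop :=
  groundEnergy I.hamReal ≤ I.a ∧
    ∃ ψ : Cube n → ℝ, ∑ x, ψ x ^ 2 = 1 ∧
      I.hamReal.mulVec ψ = groundEnergy I.hamReal • ψ ∧ IsSuccinct B ψ

/-- No instance: large ground energy. -/
def IsNo {n k : ℕ} (I : LHInstance n k) : Prop := (I.b : ℝ) ≤ groundEnergy I.hamReal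

end LHInstance

/-- The witness: the alleged ground energy, the alleged ground state, the starting point. -/
structure Witness (n : ℕ) where
  lam : ℚ
  circuit : AmpCircuit n
  xin : Cube n

/-- The length of a witness. -/
def Witness.size {n : ℕ} (w : Witness n) : ℕ := ratSize w.lam + w.circuit.size + n

/-! ## The fixed node Hamiltonian and the generator -/

section FixedNode

variable {ι : Type*} [Fintype ι] [DecidableEq ι]

/-- The set `S⁺` of pairs `x ≠ y` with `φ x * ⟨x|H|y⟩ * φ y > 0`. The pairs `x ≠ y` that are not
in it form `S⁻`. -/
def InSPlus (H : Matrix ι ι ℚ) (φ : ι → ℚ) (x y : ι) : Prop := x ≠ y ∧ 0 < φ x * H x y * φ y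

instance (H : Matrix ι ι ℚ) (φ : ι → ℚ) (x y : ι) : Decidable (InSPlus H φ x y) := by
  unfold InSPlus; infer_instance

/-- The fixed node Hamiltonian `F^{H,φ}`. -/
def fixedNode (H : Matrix ι ι ℚ) (φ : ι → ℚ) : Matrix ι ι ℚ :=
  Matrix.of fun x y =>
    if x = y then H x x + ∑ z, if InSPlus H φ x z then H x z * (φ z / φ x) else 0
    else if InSPlus H φ x y then 0
    else H x y

/-- The generator `G^{H,φ}`, with `⟨y|G|x⟩ = - ⟨y|F|x⟩ * φ y / φ x`. -/
def generator (H : Matrix ι ι ℚ) (φ : ι → ℚ) : Matrix ι ι ℚ :=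
  Matrix.of fun y x => -(fixedNode H φ y x * (φ y / φ x))

end FixedNode

/-! ## The checking algorithm -/

/-- Two independent uniform samples from `[0,1]`: one for a waiting time, one for a jump. -/
abbrev Sample := unitInterval × unitInterval

/-- Sampling from a finite distribution by one uniform sample `v` from `[0,1]`: the `i`-th item is
returned if `v` lies in `[q₀ + ⋯ + q_{i-1}, q₀ + ⋯ + q_i)`. (If the weights sum up to `1`, the
default value is returned only if `v = 1`.) -/
noncomputable def pick {α : Type*} (d : α) : List (α × ℚ) → ℝ → α
  | [], _ => d
  | (y, q) :: l, v => if v < (q : ℝ) then y else pick d l (v - (q : ℝ))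

section Protocol

variable {n k : ℕ}

/-- The support `S` of the state that the circuit describes. -/
abbrev Supp (C : AmpCircuit n) := {x : Cube n // C.amp x ≠ 0}

/-- `H - λ̂ I` for the alleged ground energy `λ̂`. -/
def shiftedHam (I : LHInstance n k) (lam : ℚ) : Matrix (Cube n) (Cube n) ℚ :=
  I.ham - lam • (1 : Matrix (Cube n) (Cube n) ℚ)

/-- The matrix `G^{H_S,φ_S}`, where `H_S` is the restriction of `H - λ̂ I` to the support of `φ`. -/
def genS (I : LHInstance n k) (w : Witness n) :
    Matrix (Supp w.circuit) (Supp w.circuit) ℚ :=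
  generator ((shiftedHam I w.lam).submatrix Subtype.val Subtype.val)
    (fun x => w.circuit.amp x.1)

/-- The possible jumps from `x`, with their probabilities `⟨y|G|x⟩ / |⟨x|G|x⟩|`. -/
def jumps (I : LHInstance n k) (w : Witness n) (x : Supp w.circuit) :
    List (Supp w.circuit × ℚ) :=
  ((I.neighbours x.1).filterMap fun y =>
      if h : w.circuit.amp y ≠ 0 then some (⟨y, h⟩ : Supp w.circuit) else none).map
    fun y => (y, genS I w y x / |genS I w x x|)

/-- The while loop: `x` is the current state, `τ` the current time, `t` the final time, `p` the
number of bits that amplitudes may have. The argument `r` is `M + 1 - m`, where `m` counts the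
transitions so far, so that `m > M` reads `r = 0`; `ω` holds the samples not yet used.
The value `true` means Accept. -/
noncomputable def checkLoop (I : LHInstance n k) (w : Witness n) (p t : ℕ) :
    (r : ℕ) → (Fin r → Sample) → Supp w.circuit → ℝ → Bool
  | 0, _, _, τ => decide ((t : ℝ) ≤ τ)
  | r + 1, ω, x, τ =>
    if (t : ℝ) ≤ τ then true
    else if ¬ RatBits p (w.circuit.amp x.1) then false
    else if ∑ z, genS I w z x ≠ 0 ∨ ∃ y, y ≠ x ∧ genS I w y x < 0 then false
    else if genS I w x x = 0 then true
    else
      checkLoop I w p t r (Fin.tail ω) (pick x (jumps I w x) ((ω 0).2 : ℝ))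
        (τ + Real.log (1 / ((ω 0).1 : ℝ)) / ((|genS I w x x| : ℚ) : ℝ))

/-- The bound `M = 2^k m n³ t ‖H‖` for the number of transitions, with the bound
`2 * norm n` for the norm of `H - λ̂ I`. -/
def maxJumps (B : Bounds) (T : ℕ[X]) (I : LHInstance n B.k) : ℕ :=
  2 ^ B.k * I.terms.length * n ^ 3 * T.eval n * (2 * B.norm.eval n)

/-- The protocol with final time `t = T n`: reject if `λ̂ > a` or if `x_in` is not in the support,
then run the loop. -/
noncomputable def protocol (B : Bounds) (T : ℕ[X]) (I : LHInstance n B.k) (w : Witness n)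
    (ω : Fin (maxJumps B T I + 1) → Sample) : Bool :=
  if I.a < w.lam then false
  else if h : w.circuit.amp w.xin ≠ 0 then
    checkLoop I w (B.bits.eval n) (T.eval n) (maxJumps B T I + 1) ω ⟨w.xin, h⟩ 0
  else false

/-- The probability of acceptance, over independent uniform samples from `[0,1]`. -/
noncomputable def acceptProb (B : Bounds) (T : ℕ[X]) (I : LHInstance n B.k) (w : Witness n) : ℝ :=
  (volume : Measure (Fin (maxJumps B T I + 1) → Sample)).real {ω | protocol B T I w ω = true}

/-- The probability of rejection. -/
noncomputable def rejectProb (B : Bounds) (T : ℕ[X]) (I : LHInstance n B.k) (w : Witness n) : ℝ :=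
  (volume : Measure (Fin (maxJumps B T I + 1) → Sample)).real {ω | protocol B T I w ω = false}

end Protocol

/-! ## Step counts

The same algorithm, carried out by elementary operations that are charged for. Bits, strings and
rational numbers are charged by their lengths (bit operations, with quadratic arithmetic of
fractions). The samples from `[0,1]`, and the arithmetic of the real numbers made from them
(`+`, `-`, `/`, `log`, comparison), cost one step each. -/

/-- A computation together with the number of steps it takes. -/
structure Timed (α : Type) where
  val : α
  cost : ℕ

instance : Monad Timed where
  pure a := ⟨a, 0⟩
  bind c f := ⟨(f c.val).val, c.cost + (f c.val).cost⟩

namespace Timed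

/-- Spend `c` steps. -/
def tick (c : ℕ) : Timed Unit := ⟨(), c⟩

/-- Steps for one arithmetic operation or comparison (with reduction to lowest terms). -/
def opCost (a b : ℚ) : ℕ := (ratSize a + ratSize b + 1) ^ 2

def add (a b : ℚ) : Timed ℚ := ⟨a + b, opCost a b⟩
def sub (a b : ℚ) : Timed ℚ := ⟨a - b, opCost a b⟩
def mul (a b : ℚ) : Timed ℚ := ⟨a * b, opCost a b⟩
def div (a b : ℚ) : Timed ℚ := ⟨a / b, opCost a b⟩
def neg (a : ℚ) : Timed ℚ := ⟨-a, opCost a 0⟩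
def abs (a : ℚ) : Timed ℚ := ⟨|a|, opCost a 0⟩
def lt (a b : ℚ) : Timed Bool := ⟨decide (a < b), opCost a b⟩
def eq (a b : ℚ) : Timed Bool := ⟨decide (a = b), opCost a b⟩

/-- Check the number of bits of a fraction. -/
def ratBits (p : ℕ) (a : ℚ) : Timed Bool := ⟨decide (RatBits p a), ratSize a + p + 1⟩

section Circuits

variable {n : ℕ}

/-- Read a wire. -/
def wire (w : List Bool) (i : ℕ) : Timed Bool := ⟨w.getD i false, w.length + Nat.size i + 1⟩

/-- Evaluate the gates one after the other, `w` being the values so far. -/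
def wires (x : Cube n) : List (Gate n) → List Bool → Timed (List Bool)
  | [], w => pure w
  | g :: gs, w => do
    tick (g.size + 2 * w.length + n + 1)
    wires x gs (w ++ [g.eval x w])

/-- Read the digits of a number. -/
def number (w : List Bool) : List ℕ → Timed ℕ
  | [] => pure 0
  | i :: is => do
    let b ← wire w i
    let m ← number w is
    tick (is.length + 1)
    pure (b.toNat + 2 * m)

/-- Evaluate the circuit. -/
def amp (C : AmpCircuit n) (x : Cube n) : Timed ℚ := do
  let w ← wires x C.gates []
  let a ← number w C.num
  let b ← number w C.den
  let q ← div a b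
  let s ← wire w C.sign
  if s then neg q else pure q

end Circuits

section Matrix

variable {n k : ℕ}

/-- Look up the entry of a local term. -/
def entry (h : LocalTerm n k) (x y : Cube n) : Timed ℚ :=
  ⟨h.entry x y, (n + 1) * (k + 1) + 4 ^ k + ratSize (h.entry x y)⟩

/-- The entry `⟨x|H|y⟩` of the sum of the local terms. -/
def ham (x y : Cube n) : List (LocalTerm n k) → Timed ℚ
  | [] => pure 0
  | h :: l => do
    let a ← entry h x y
    let s ← ham x y l
    add a s

/-- Generate the strings obtained from `x` by overwriting the qubits of one local term. -/
def overwrites (h : LocalTerm n k) (x : Cube n) : List ℕ → Timed (List (Cube n))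
  | [] => pure []
  | c :: cs => do
    tick ((k + 1) * (n + 1))
    let l ← overwrites h x cs
    pure (h.overwrite x c :: l)

/-- Generate the candidates for the nonzero positions, term by term. -/
def candidates (x : Cube n) : List (LocalTerm n k) → Timed (List (Cube n))
  | [] => pure []
  | h :: l => do
    let u ← overwrites h x (List.range (2 ^ k))
    let v ← candidates x l
    tick (u.length * (n + 1))
    pure (u ++ v)

/-- Delete `x` and repetitions, by comparing all pairs. -/
def clean (x : Cube n) : List (Cube n) → Timed (List (Cube n))
  | [] => pure []
  | y :: l => do
    let u ← clean x l
    tick ((n + 1) * (u.length + 2))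
    if y = x ∨ y ∈ u then pure u else pure (y :: u)

/-- Column `x` of `G^{H_S,φ_S}` off the diagonal, as a list of pairs `(y, ⟨y|G|x⟩)`, and the sum of
`⟨x|H|z⟩ * φ z / φ x` over the `z` with `(x,z)` in `S⁺`. The argument `cx` is `φ x`. -/
def column (I : LHInstance n k) (C : AmpCircuit n) (x : Cube n) (cx : ℚ) :
    List (Cube n) → Timed (ℚ × List (Cube n × ℚ))
  | [] => pure (0, [])
  | y :: l => do
    let rest ← column I C x cx l
    let cy ← amp C y
    let out ← eq cy 0
    if out then pure rest
    else do
      let h ← ham x y I.terms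
      let a ← mul cx h
      let a ← mul a cy
      let plus ← lt 0 a
      let q ← div cy cx
      let q ← mul h q
      if plus then do
        let s ← add rest.1 q
        tick (n + 1)
        pure (s, (y, 0) :: rest.2)
      else do
        let g ← neg q
        tick (n + 1)
        pure (rest.1, (y, g) :: rest.2)

/-- The sum of the listed entries. -/
def sum : List (Cube n × ℚ) → Timed ℚ
  | [] => pure 0
  | e :: l => do
    let s ← sum l
    add e.2 s

/-- Is one of the listed entries negative? -/
def anyNeg : List (Cube n × ℚ) → Timed Bool
  | [] => pure false
  | e :: l => do
    let b ← lt e.2 0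
    let c ← anyNeg l
    tick 1
    pure (b || c)

/-- Divide the listed entries by `d`. -/
def divAll (d : ℚ) : List (Cube n × ℚ) → Timed (List (Cube n × ℚ))
  | [] => pure []
  | e :: l => do
    let q ← div e.2 d
    let u ← divAll d l
    tick (n + 1)
    pure ((e.1, q) :: u)

/-- Sample from a finite distribution by one uniform sample `v`. -/
noncomputable def pick (d : Cube n) : List (Cube n × ℚ) → ℝ → Timed (Cube n)
  | [], _ => do
    tick (n + 1)
    pure d
  | e :: l, v => do
    tick (ratSize e.2 + n + 3)
    if v < (e.2 : ℝ) then pure e.1 else pick d l (v - (e.2 : ℝ))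

/-- The while loop. -/
noncomputable def checkLoop (I : LHInstance n k) (w : Witness n) (p t : ℕ) :
    (r : ℕ) → (Fin r → Sample) → Cube n → ℝ → Timed Bool
  | 0, _, _, τ => do
    tick 2
    pure (decide ((t : ℝ) ≤ τ))
  | r + 1, ω, x, τ => do
    tick 2
    if (t : ℝ) ≤ τ then pure true
    else do
      let cx ← amp w.circuit x
      let ok ← ratBits p cx
      if !ok then pure false
      else do
        let cand ← candidates x I.terms
        let nb ← clean x cand
        let col ← column I w.circuit x cx nb
        let hx ← ham x x I.terms
        let hx ← sub hx w.lam
        let f ← add hx col.1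
        let g ← neg f
        let off ← sum col.2
        let s ← add g off
        let zero ← eq s 0
        let bad ← anyNeg col.2
        if !zero || bad then pure false
        else do
          let stay ← eq g 0
          if stay then pure true
          else do
            let d ← abs g
            let dist ← divAll d col.2
            let y ← pick x dist ((ω 0).2 : ℝ)
            tick (ratSize d + 6)
            checkLoop I w p t r (Fin.tail ω) y
              (τ + Real.log (1 / ((ω 0).1 : ℝ)) / (d : ℝ))

/-- The protocol. The parameters `t` and `M` are charged as if they were written in unary. -/
noncomputable def protocol (B : Bounds) (T : ℕ[X]) (I : LHInstance n B.k) (w : Witness n)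
    (ω : Fin (maxJumps B T I + 1) → Sample) : Timed Bool := do
  tick (w.size + T.eval n + maxJumps B T I + 1)
  let big ← lt I.a w.lam
  if big then pure false
  else do
    let c ← amp w.circuit w.xin
    let out ← eq c 0
    if out then pure false
    else checkLoop I w (B.bits.eval n) (T.eval n) (maxJumps B T I + 1) ω w.xin 0

end Matrix

end Timed

/-!
The loop samples, jump by jump, a continuous-time Markov process whose generator is `G`, killed at
the first point that fails a check. Its acceptance probability from `x` with `r` samples and the
remaining time `s` therefore obeys a renewal recursion, obtained by integrating over the first
sample (`loopProb_succ`, `integral_pick`, `integral_waiting_time`). That recursion defines the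
function `survival`, so that `loopProb_eq_survival` replaces probability by the backward equation
`hasDerivAt_survival`, an ordinary differential equation in `s`.

Soundness. The fixed node Hamiltonian `F` dominates `H_S` as a quadratic form, because the
difference is a sum of squares (`quadForm_le_fixedNode`); for a No instance it is at least
`b - λ̂ ≥ ε`. With `v x = φ x * survival x` the backward equation yields `⟨v, v'⟩ ≤ -⟨v, F v⟩`,
whence `‖v‖² ≤ exp (-2 ε s) ‖φ‖²` (`survival_decay`). Only points with `p n`-bit
amplitudes count, so `‖φ‖²` is at most `2 ^ n * 2 ^ (2 p)` and `|φ x|` at least `2 ^ (-p)`.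

Completeness. If `φ` is an eigenvector, then every column of `G` sums up to zero and no check
fails; the only danger is the bound for the number of jumps. The measure `φ²` is reversible, hence
the mean number of jumps started from it is at most `t ∑ φ² |G x x|` (`survival_markov`), and the
mean rate is at most the number of neighbours of a string times the norm of `H`
(`sum_sq_mul_rate_le`). Markov's inequality under `φ²` yields a good starting point. The ground
energy is rational, being a short sum of products of matrix entries with ratios of amplitudes, and
this bounds the length of the witness (`height_lam_le`).

Running time. The timed algorithm is compared with the protocol line by line (`protocol_val`); the
neighbours that it lists exhaust the nonzero entries of a column (`LHInstance.mem_neighbours`).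
Costs are bounded through `height`, the bit length of a fraction, which grows additively under
arithmetic operations.
-/

/-! ### Survival probabilities of a jump process with killing -/

section Survival

variable {ι : Type*} [Fintype ι] [DecidableEq ι]

open Classical in
/-- The probability that the jump process with generator `G` (acting on columns, so that `G y x` is
the rate of the jump from `x` to `y`), started in `x`, makes fewer than `r` jumps during a time `s`
and visits only points of `D`. The recursion conditions on the last moment `s - v` of the stay in
`x`; it is meant for generators whose columns in `D` sum up to `0`, so that `-G x x` is the
total rate. For `s = 0` and `r ≥ 1` the value is the limit `1` from the right (on `D`). -/
noncomputable def survival (G : Matrix ι ι ℝ) (D : Set ι) : ℕ → ι → ℝ → ℝ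
  | 0, _, _ => 0
  | r + 1, x, s =>
    if x ∈ D then
      Real.exp (G x x * s) * (1 + ∫ v in (0 : ℝ)..s,
        Real.exp (-(G x x * v)) * ∑ y ∈ Finset.univ.erase x, G y x * survival G D r y v)
    else 0

variable (G : Matrix ι ι ℝ) (D : Set ι)

theorem survival_zero (x : ι) (s : ℝ) : survival G D 0 x s = 0 := rfl

theorem survival_of_notMem {x : ι} (hx : x ∉ D) (r : ℕ) (s : ℝ) : survival G D r x s = 0 := by
  cases r with
  | zero => rfl
  | succ r => simp [survival, hx]

theorem survival_succ {x : ι} (hx : x ∈ D) (r : ℕ) (s : ℝ) :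
    survival G D (r + 1) x s = Real.exp (G x x * s) * (1 + ∫ v in (0 : ℝ)..s,
      Real.exp (-(G x x * v)) * ∑ y ∈ Finset.univ.erase x, G y x * survival G D r y v) := by
  simp [survival, hx]

theorem survival_succ_zero {x : ι} (hx : x ∈ D) (r : ℕ) : survival G D (r + 1) x 0 = 1 := by
  simp [survival_succ G D hx]

theorem continuous_survival (r : ℕ) (x : ι) : Continuous (survival G D r x) := by
  induction r generalizing x with
  | zero => exact continuous_const
  | succ r ih =>
    by_cases hx : x ∈ D
    · have h : survival G D (r + 1) x = fun s => Real.exp (G x x * s) * (1 + ∫ v in (0 : ℝ)..s,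
          Real.exp (-(G x x * v)) * ∑ y ∈ Finset.univ.erase x, G y x * survival G D r y v) :=
        funext fun s => survival_succ G D hx r s
      rw [h]
      have hc : Continuous fun v => Real.exp (-(G x x * v)) *
          ∑ y ∈ Finset.univ.erase x, G y x * survival G D r y v := by fun_prop
      have := intervalIntegral.continuous_primitive (μ := volume)
        (fun a b => hc.intervalIntegrable a b) 0
      fun_prop
    · have h : survival G D (r + 1) x = fun _ => 0 :=
        funext fun s => survival_of_notMem G D hx (r + 1) s
      rw [h]
      exact continuous_const

/-- The backward equation. -/
theorem hasDerivAt_survival {x : ι} (hx : x ∈ D) (r : ℕ) (s : ℝ) :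
    HasDerivAt (survival G D (r + 1) x)
      (G x x * survival G D (r + 1) x s +
        ∑ y ∈ Finset.univ.erase x, G y x * survival G D r y s) s := by
  have h : survival G D (r + 1) x = fun s => Real.exp (G x x * s) * (1 + ∫ v in (0 : ℝ)..s,
      Real.exp (-(G x x * v)) * ∑ y ∈ Finset.univ.erase x, G y x * survival G D r y v) :=
    funext fun s => survival_succ G D hx r s
  have hs : ∀ y, Continuous (survival G D r y) := continuous_survival G D r
  have hc : Continuous fun v => Real.exp (-(G x x * v)) *
      ∑ y ∈ Finset.univ.erase x, G y x * survival G D r y v := by fun_prop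
  have h1 := (intervalIntegral.integral_hasDerivAt_right (hc.intervalIntegrable 0 s)
    hc.stronglyMeasurable.stronglyMeasurableAtFilter hc.continuousAt).const_add 1
  have h2 : HasDerivAt (fun s => Real.exp (G x x * s)) (Real.exp (G x x * s) * (G x x * 1)) s :=
    ((hasDerivAt_id s).const_mul (G x x)).exp
  rw [h]
  refine (h2.fun_mul h1).congr_deriv ?_
  have h3 : Real.exp (G x x * s) * Real.exp (-(G x x * s)) = 1 := by rw [← Real.exp_add]; simp
  linear_combination (∑ y ∈ Finset.univ.erase x, G y x * survival G D r y s) * h3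

variable {G D}

/-- The columns of the points of `D` are columns of a generator of a Markov process. -/
def IsGeneratorOn (G : Matrix ι ι ℝ) (D : Set ι) : Prop :=
  ∀ x ∈ D, (∀ y, y ≠ x → 0 ≤ G y x) ∧ ∑ y, G y x = 0

theorem IsGeneratorOn.sum_erase (hG : IsGeneratorOn G D) {x : ι} (hx : x ∈ D) :
    ∑ y ∈ Finset.univ.erase x, G y x = -G x x := by
  have := Finset.add_sum_erase Finset.univ (fun y => G y x) (Finset.mem_univ x)
  rw [(hG x hx).2] at this
  linarith

theorem IsGeneratorOn.rate_nonneg (hG : IsGeneratorOn G D) {x : ι} (hx : x ∈ D) :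
    0 ≤ -G x x := by
  rw [← hG.sum_erase hx]
  exact Finset.sum_nonneg fun y hy => (hG x hx).1 y (Finset.ne_of_mem_erase hy)

theorem survival_mono_succ_and_nonneg (hG : IsGeneratorOn G D) (r : ℕ) (x : ι) {s : ℝ}
    (hs : 0 ≤ s) :
    0 ≤ survival G D r x s ∧ survival G D r x s ≤ survival G D (r + 1) x s := by
  have hcont := continuous_survival G D
  have hint : ∀ r x s, IntervalIntegrable (fun v => Real.exp (-(G x x * v)) *
      ∑ y ∈ Finset.univ.erase x, G y x * survival G D r y v) volume 0 s := by
    intro r x s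
    apply Continuous.intervalIntegrable
    have := hcont r
    fun_prop
  induction r generalizing x s with
  | zero =>
    refine ⟨le_rfl, ?_⟩
    by_cases hx : x ∈ D
    · rw [survival_succ G D hx]
      simp only [survival_zero, mul_zero, Finset.sum_const_zero, intervalIntegral.integral_zero,
        add_zero, mul_one]
      positivity
    · simp [survival_of_notMem G D hx]
  | succ r ih =>
    by_cases hx : x ∈ D
    · rw [survival_succ G D hx, survival_succ G D hx]
      constructor
      · have : 0 ≤ ∫ v in (0 : ℝ)..s, Real.exp (-(G x x * v)) *
            ∑ y ∈ Finset.univ.erase x, G y x * survival G D r y v := by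
          refine intervalIntegral.integral_nonneg hs fun v hv => ?_
          refine mul_nonneg (Real.exp_pos _).le (Finset.sum_nonneg fun y hy => ?_)
          exact mul_nonneg ((hG x hx).1 y (Finset.ne_of_mem_erase hy)) (ih y hv.1).1
        positivity
      · refine mul_le_mul_of_nonneg_left (add_le_add_right ?_ 1) (Real.exp_pos _).le
        refine intervalIntegral.integral_mono_on hs (hint _ _ _) (hint _ _ _) fun v hv => ?_
        refine mul_le_mul_of_nonneg_left (Finset.sum_le_sum fun y hy => ?_) (Real.exp_pos _).le
        exact mul_le_mul_of_nonneg_left (ih y hv.1).2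
          ((hG x hx).1 y (Finset.ne_of_mem_erase hy))
    · simp [survival_of_notMem G D hx]

theorem survival_nonneg (hG : IsGeneratorOn G D) (r : ℕ) (x : ι) {s : ℝ} (hs : 0 ≤ s) :
    0 ≤ survival G D r x s :=
  (survival_mono_succ_and_nonneg hG r x hs).1

theorem survival_monotone (hG : IsGeneratorOn G D) (x : ι) {s : ℝ} (hs : 0 ≤ s) :
    Monotone fun r => survival G D r x s :=
  monotone_nat_of_le_succ fun r => (survival_mono_succ_and_nonneg hG r x hs).2

theorem survival_le_one (hG : IsGeneratorOn G D) (r : ℕ) (x : ι) {s : ℝ} (hs : 0 ≤ s) :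
    survival G D r x s ≤ 1 := by
  induction r generalizing x s with
  | zero => simp [survival_zero]
  | succ r ih =>
    by_cases hx : x ∈ D
    · have hcont := continuous_survival G D r
      have h1 : ∫ v in (0 : ℝ)..s, Real.exp (-(G x x * v)) *
            ∑ y ∈ Finset.univ.erase x, G y x * survival G D r y v ≤
          ∫ v in (0 : ℝ)..s, Real.exp (-(G x x * v)) * (-(G x x * 1)) := by
        refine intervalIntegral.integral_mono_on hs ?_ ?_ fun v hv => ?_
        · apply Continuous.intervalIntegrable; fun_prop
        · apply Continuous.intervalIntegrable; fun_prop
        · refine mul_le_mul_of_nonneg_left ?_ (Real.exp_pos _).le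
          rw [mul_one, ← hG.sum_erase hx]
          refine Finset.sum_le_sum fun y hy => ?_
          exact mul_le_of_le_one_right ((hG x hx).1 y (Finset.ne_of_mem_erase hy)) (ih y hv.1)
      have h2 : ∫ v in (0 : ℝ)..s, Real.exp (-(G x x * v)) * (-(G x x * 1)) =
          Real.exp (-(G x x * s)) - Real.exp (-(G x x * 0)) := by
        refine intervalIntegral.integral_eq_sub_of_hasDerivAt
          (fun v _ => (((hasDerivAt_id v).const_mul (G x x)).neg).exp) ?_
        apply Continuous.intervalIntegrable; fun_prop
      rw [survival_succ G D hx]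
      rw [h2, mul_zero, neg_zero, Real.exp_zero] at h1
      calc _ ≤ Real.exp (G x x * s) * Real.exp (-(G x x * s)) :=
            mul_le_mul_of_nonneg_left (by linarith) (Real.exp_pos _).le
        _ = 1 := by rw [← Real.exp_add]; simp
    · simp [survival_of_notMem G D hx]

/-- If `G` is, up to the similarity `v x = φ x * u x`, the negative of a symmetric matrix `F ≥ ε`,
then the survival probabilities decay at the rate `ε`: by the backward equation and the
monotonicity in `r`, the derivative of `‖v‖²` is at most `-2 ⟨v, F v⟩`. -/
theorem survival_decay (hG : IsGeneratorOn G D) (F : Matrix ι ι ℝ) (φ : ι → ℝ) (ε : ℝ)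
    (hφ : ∀ x, φ x ≠ 0) (hFG : ∀ x y, G y x = -(F y x * (φ y / φ x))) (hF : F.IsSymm)
    (hε : ∀ v : ι → ℝ, ε * ∑ x, v x ^ 2 ≤ ∑ x, v x * ∑ y, F x y * v y)
    (r : ℕ) (x : ι) {s : ℝ} (hs : 0 ≤ s) :
    (φ x * survival G D r x s) ^ 2 ≤
      Real.exp (-(2 * ε * s)) * ∑ y, D.indicator (fun y => φ y ^ 2) y := by
  classical
  have hnn : 0 ≤ Real.exp (-(2 * ε * s)) * ∑ y, D.indicator (fun y => φ y ^ 2) y :=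
    mul_nonneg (Real.exp_pos _).le (Finset.sum_nonneg fun y _ =>
      Set.indicator_nonneg (fun _ _ => sq_nonneg _) _)
  cases r with
  | zero => simpa [survival_zero] using hnn
  | succ r =>
  let u : ι → ℝ → ℝ := survival G D (r + 1)
  let u' : ι → ℝ → ℝ := fun x s => if x ∈ D then G x x * u x s +
    ∑ y ∈ Finset.univ.erase x, G y x * survival G D r y s else 0
  have hu : ∀ x s, HasDerivAt (u x) (u' x s) s := by
    intro x s
    by_cases hx : x ∈ D
    · simpa [u', hx] using hasDerivAt_survival G D hx r s
    · have h : u x = fun _ => 0 := funext fun s => survival_of_notMem G D hx (r + 1) s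
      simpa [u', hx, h] using hasDerivAt_const s (0 : ℝ)
  let N : ℝ → ℝ := fun s => ∑ x, (φ x * u x s) ^ 2
  have hN : ∀ s, HasDerivAt N (∑ x, 2 * (φ x * u x s) * (φ x * u' x s)) s := by
    intro s
    refine HasDerivAt.fun_sum fun x _ => ?_
    exact (((hu x s).const_mul (φ x)).fun_pow 2).congr_deriv (by simp)
  have hN' : ∀ s, 0 ≤ s → ∑ x, 2 * (φ x * u x s) * (φ x * u' x s) ≤ -(2 * ε) * N s := by
    intro s hs
    have key : ∀ x, φ x * u x s * (φ x * u' x s) ≤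
        -(φ x * u x s * ∑ y, F x y * (φ y * u y s)) := by
      intro x
      by_cases hx : x ∈ D
      · have h1 : φ x * u x s * (φ x * u' x s) = φ x ^ 2 * u x s * (G x x * u x s) +
            ∑ y ∈ Finset.univ.erase x, φ x ^ 2 * u x s * (G y x * survival G D r y s) := by
          simp only [u', hx, if_true, ← Finset.mul_sum]
          ring
        have h2 : -(φ x * u x s * ∑ y, F x y * (φ y * u y s)) =
            φ x ^ 2 * u x s * (G x x * u x s) +
              ∑ y ∈ Finset.univ.erase x, φ x ^ 2 * u x s * (G y x * u y s) := by
          have h3 : ∀ y, φ x ^ 2 * u x s * (G y x * u y s) =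
              -(φ x * u x s * (F x y * (φ y * u y s))) := by
            intro y
            rw [hFG, hF.apply x y]
            have := hφ x
            field_simp
          rw [Finset.add_sum_erase Finset.univ (fun y => φ x ^ 2 * u x s * (G y x * u y s))
            (Finset.mem_univ x)]
          simp only [h3, Finset.sum_neg_distrib, Finset.mul_sum]
        rw [h1, h2]
        refine add_le_add_right (Finset.sum_le_sum fun y hy => ?_) _
        refine mul_le_mul_of_nonneg_left ?_
          (mul_nonneg (sq_nonneg _) (survival_nonneg hG _ _ hs))
        exact mul_le_mul_of_nonneg_left (survival_monotone hG y hs (Nat.le_succ r))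
          ((hG x hx).1 y (Finset.ne_of_mem_erase hy))
      · simp [u, survival_of_notMem G D hx]
    have h4 := hε fun x => φ x * u x s
    calc ∑ x, 2 * (φ x * u x s) * (φ x * u' x s)
        = 2 * ∑ x, φ x * u x s * (φ x * u' x s) := by
          rw [Finset.mul_sum]; exact Finset.sum_congr rfl fun x _ => by ring
      _ ≤ 2 * ∑ x, -(φ x * u x s * ∑ y, F x y * (φ y * u y s)) := by
          gcongr with x; exact key x
      _ ≤ -(2 * ε) * N s := by
          rw [Finset.sum_neg_distrib]; simp only [N]; linarith
  -- the function `exp (2 * ε * s) * ‖v s‖ ^ 2` is antitone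
  let E : ℝ → ℝ := fun s => Real.exp (2 * ε * s) * N s
  have hE : ∀ s, HasDerivAt E (Real.exp (2 * ε * s) * (2 * ε * 1) * N s +
      Real.exp (2 * ε * s) * ∑ x, 2 * (φ x * u x s) * (φ x * u' x s)) s := fun s =>
    (((hasDerivAt_id s).const_mul (2 * ε)).exp).mul (hN s)
  have hanti : AntitoneOn E (Set.Ici 0) := by
    refine antitoneOn_of_deriv_nonpos (convex_Ici 0)
      (fun s _ => (hE s).continuousAt.continuousWithinAt)
      (fun s _ => (hE s).differentiableAt.differentiableWithinAt) fun s hs => ?_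
    rw [interior_Ici] at hs
    rw [(hE s).deriv]
    have := mul_le_mul_of_nonneg_left (hN' s (Set.mem_Ioi.1 hs).le) (Real.exp_pos (2 * ε * s)).le
    linarith
  have hE0 : E 0 = ∑ y, D.indicator (fun y => φ y ^ 2) y := by
    simp only [E, N, mul_zero, Real.exp_zero, one_mul]
    refine Finset.sum_congr rfl fun y _ => ?_
    by_cases hy : y ∈ D
    · simp [u, survival_succ_zero G D hy, hy]
    · simp [u, survival_of_notMem G D hy, hy]
  have h5 : E s ≤ E 0 := hanti (Set.mem_Ici.2 le_rfl) (Set.mem_Ici.2 hs) hs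
  have h6 : N s = Real.exp (-(2 * ε * s)) * E s := by
    simp only [E, ← mul_assoc, ← Real.exp_add]; simp
  calc (φ x * u x s) ^ 2 ≤ N s := Finset.single_le_sum
        (f := fun x => (φ x * u x s) ^ 2) (fun _ _ => sq_nonneg _) (Finset.mem_univ x)
    _ ≤ _ := by
        rw [h6, ← hE0]; exact mul_le_mul_of_nonneg_left h5 (Real.exp_pos _).le

/-- If `π` satisfies detailed balance, then the mean number of jumps during a time `t`, started
from `π`, is at most `t * ∑ π x * |G x x|`; Markov's inequality bounds the probability of `r`
jumps or more. The mean is handled as the sum over `i` of the probabilities of more than `i` jumps,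
whose derivative telescopes by the backward equation. -/
theorem survival_markov (hG : IsGeneratorOn G Set.univ) (π : ι → ℝ) (hπ : ∀ x, 0 ≤ π x)
    (hbal : ∀ x y, π x * G y x = π y * G x y) (r : ℕ) {t : ℝ} (ht : 0 ≤ t) :
    r * ∑ x, π x * (1 - survival G Set.univ r x t) ≤ t * ∑ x, π x * (-G x x) := by
  let u : ℕ → ι → ℝ → ℝ := survival G Set.univ
  -- the truncated mean number of jumps
  let J : ℝ → ℝ := fun s => ∑ i ∈ Finset.range r, ∑ x, π x * (1 - u (i + 1) x s)
  have hJ : ∀ s, HasDerivAt J (∑ x, π x * (-G x x) * u r x s) s := by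
    intro s
    have h1 : HasDerivAt J (∑ i ∈ Finset.range r, ∑ x, π x * (-(G x x * u (i + 1) x s +
        ∑ y ∈ Finset.univ.erase x, G y x * u i y s))) s :=
      HasDerivAt.fun_sum fun i _ => HasDerivAt.fun_sum fun x _ =>
        ((hasDerivAt_survival G Set.univ (Set.mem_univ x) i s).const_sub 1).const_mul (π x)
    refine h1.congr_deriv ?_
    have h2 : ∀ i, ∑ x, π x * (-(G x x * u (i + 1) x s +
        ∑ y ∈ Finset.univ.erase x, G y x * u i y s)) =
        ∑ x, π x * (-G x x) * u (i + 1) x s - ∑ x, π x * (-G x x) * u i x s := by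
      intro i
      have h3 : ∑ x, π x * ∑ y, G y x * u i y s = 0 := by
        calc ∑ x, π x * ∑ y, G y x * u i y s = ∑ x, ∑ y, π y * u i y s * G x y := by
              refine Finset.sum_congr rfl fun x _ => ?_
              rw [Finset.mul_sum]
              refine Finset.sum_congr rfl fun y _ => ?_
              rw [← mul_assoc, hbal]; ring
          _ = 0 := by
              rw [Finset.sum_comm]
              refine Finset.sum_eq_zero fun y _ => ?_
              rw [← Finset.mul_sum, (hG y (Set.mem_univ y)).2, mul_zero]
      have h4 : ∀ x, ∑ y ∈ Finset.univ.erase x, G y x * u i y s =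
          ∑ y, G y x * u i y s - G x x * u i x s := fun x => by
        rw [← Finset.add_sum_erase Finset.univ (fun y => G y x * u i y s) (Finset.mem_univ x)]
        ring
      rw [← Finset.sum_sub_distrib, ← sub_eq_zero, ← neg_eq_zero, ← h3,
        ← Finset.sum_sub_distrib, ← Finset.sum_neg_distrib]
      refine Finset.sum_congr rfl fun x _ => ?_
      rw [h4]; ring
    simp only [h2]
    rw [Finset.sum_range_sub (fun i => ∑ x, π x * (-G x x) * u i x s)]
    simp [u, survival_zero]
  have hc : ∀ s, 0 ≤ s → ∑ x, π x * (-G x x) * u r x s ≤ ∑ x, π x * (-G x x) := fun s hs =>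
    Finset.sum_le_sum fun x _ => mul_le_of_le_one_right
      (mul_nonneg (hπ x) (hG.rate_nonneg (Set.mem_univ x))) (survival_le_one hG r x hs)
  have hanti : AntitoneOn (fun s => J s - s * ∑ x, π x * (-G x x)) (Set.Ici 0) := by
    have hd : ∀ s, HasDerivAt (fun s => J s - s * ∑ x, π x * (-G x x))
        (∑ x, π x * (-G x x) * u r x s - 1 * ∑ x, π x * (-G x x)) s := fun s =>
      (hJ s).sub ((hasDerivAt_id s).mul_const _)
    refine antitoneOn_of_deriv_nonpos (convex_Ici 0)
      (fun s _ => (hd s).continuousAt.continuousWithinAt)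
      (fun s _ => (hd s).differentiableAt.differentiableWithinAt) fun s hs => ?_
    rw [interior_Ici] at hs
    rw [(hd s).deriv]
    linarith [hc s (Set.mem_Ioi.1 hs).le]
  have h0 : J 0 = 0 := Finset.sum_eq_zero fun i _ => Finset.sum_eq_zero fun x _ => by
    simp [u, survival_succ_zero G Set.univ (Set.mem_univ x)]
  have h5 := hanti (Set.mem_Ici.2 le_rfl) (Set.mem_Ici.2 ht) ht
  simp only [h0, zero_mul, sub_zero, sub_nonpos] at h5
  refine le_trans ?_ h5
  calc (r : ℝ) * ∑ x, π x * (1 - u r x t)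
      = ∑ _i ∈ Finset.range r, ∑ x, π x * (1 - u r x t) := by simp
    _ ≤ J t := Finset.sum_le_sum fun i hi => Finset.sum_le_sum fun x _ =>
        mul_le_mul_of_nonneg_left (sub_le_sub_left
          (survival_monotone hG x ht (Nat.succ_le_of_lt (Finset.mem_range.1 hi))) 1) (hπ x)

end Survival

/-! ### Neighbours in the interaction graph of a local Hamiltonian -/

section Neighbours

variable {n k : ℕ}

namespace LocalTerm

theorem foldl_update_of_notMem (h : LocalTerm n k) (c : ℕ) (i : Fin n) :
    ∀ (l : List (Fin k)) (x : Cube n), (∀ j ∈ l, h.qubits j ≠ i) →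
      l.foldl (fun y j => Function.update y (h.qubits j) (c.testBit j)) x i = x i
  | [], _, _ => rfl
  | j :: l, x, hl => by
    rw [List.foldl_cons, foldl_update_of_notMem h c i l _ fun j' hj' => hl j' (.tail _ hj')]
    exact Function.update_of_ne (hl j (.head _)).symm _ _

theorem foldl_update_of_mem (h : LocalTerm n k) (c : ℕ) (y : Cube n)
    (hc : ∀ j : Fin k, c.testBit j = y (h.qubits j)) (i : Fin n) :
    ∀ (l : List (Fin k)) (x : Cube n), (x i = y i ∨ ∃ j ∈ l, h.qubits j = i) →
      l.foldl (fun y j => Function.update y (h.qubits j) (c.testBit j)) x i = y i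
  | [], x, hx => by simpa using hx
  | j :: l, x, hx => by
    rw [List.foldl_cons]
    apply foldl_update_of_mem h c y hc i l
    by_cases hj : h.qubits j = i
    · left
      rw [← hj, Function.update_self, hc]
    · rw [Function.update_of_ne (Ne.symm hj)]
      rcases hx with hx | ⟨j', hj', rfl⟩
      · exact .inl hx
      · rcases List.mem_cons.1 hj' with rfl | hj'
        · exact absurd rfl hj
        · exact .inr ⟨j', hj', rfl⟩

/-- A string that agrees with `x` away from the qubits of `h` arises from `x` by overwriting. -/
theorem exists_overwrite_eq (h : LocalTerm n k) {x y : Cube n}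
    (hxy : ∀ i, (∀ j, h.qubits j ≠ i) → x i = y i) : ∃ c < 2 ^ k, h.overwrite x c = y := by
  refine ⟨Nat.ofBits fun j => y (h.qubits j), Nat.ofBits_lt_two_pow _, funext fun i => ?_⟩
  refine foldl_update_of_mem h _ y (fun j => ?_) i _ x ?_
  · rw [Nat.testBit_ofBits_lt _ _ j.2]
  · by_cases hi : ∀ j, h.qubits j ≠ i
    · exact .inl (hxy i hi)
    · push Not at hi
      obtain ⟨j, hj⟩ := hi
      exact .inr ⟨j, List.mem_finRange j, hj⟩

end LocalTerm

namespace LHInstance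

theorem mem_neighbours (I : LHInstance n k) {x y : Cube n} (hyx : y ≠ x) (h : I.ham y x ≠ 0) :
    y ∈ I.neighbours x := by
  have h1 : ∃ T ∈ I.terms, T.entry y x ≠ 0 := by
    by_contra! h2
    refine h (List.sum_eq_zero fun q hq => ?_)
    obtain ⟨T, hT, rfl⟩ := List.mem_map.1 hq
    exact h2 T hT
  obtain ⟨T, hT, hTe⟩ := h1
  have h3 : ∀ i, (∀ j, T.qubits j ≠ i) → x i = y i := by
    by_contra h4
    refine hTe (if_neg fun h5 => h4 fun i hi => (h5 i hi).symm)
  obtain ⟨c, hc, hcy⟩ := T.exists_overwrite_eq h3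
  simp only [neighbours, candidates, List.mem_dedup, List.mem_filter, List.mem_flatMap,
    List.mem_map, List.mem_range, decide_eq_true_eq]
  exact ⟨⟨T, hT, c, hc, hcy⟩, hyx⟩

theorem ne_of_mem_neighbours {I : LHInstance n k} {x y : Cube n} (h : y ∈ I.neighbours x) :
    y ≠ x := by
  simpa using (List.mem_filter.1 (List.mem_dedup.1 h)).2

theorem nodup_neighbours (I : LHInstance n k) (x : Cube n) : (I.neighbours x).Nodup :=
  List.nodup_dedup _

theorem length_candidates (I : LHInstance n k) (x : Cube n) :
    (I.candidates x).length = I.terms.length * 2 ^ k := by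
  simp [candidates, List.length_flatMap]

theorem length_neighbours_le (I : LHInstance n k) (x : Cube n) :
    (I.neighbours x).length ≤ I.terms.length * 2 ^ k := by
  rw [← I.length_candidates x]
  exact ((List.dedup_sublist _).trans List.filter_sublist).length_le

end LHInstance

/-- The neighbours of `x` in the support of the circuit. -/
def suppNeighbours (I : LHInstance n k) (C : AmpCircuit n) (x : Cube n) : List (Supp C) :=
  (I.neighbours x).filterMap fun y =>
    if h : C.amp y ≠ 0 then some (⟨y, h⟩ : Supp C) else none

theorem map_val_suppNeighbours (I : LHInstance n k) (C : AmpCircuit n) (x : Cube n) :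
    (suppNeighbours I C x).map Subtype.val =
      (I.neighbours x).filter fun y => decide (C.amp y ≠ 0) := by
  unfold suppNeighbours
  induction I.neighbours x with
  | nil => rfl
  | cons y l ih =>
    by_cases h : C.amp y = 0
    · simpa [h] using ih
    · simpa [h] using ih

theorem nodup_suppNeighbours (I : LHInstance n k) (C : AmpCircuit n) (x : Cube n) :
    (suppNeighbours I C x).Nodup := by
  refine List.Nodup.of_map Subtype.val ?_
  rw [map_val_suppNeighbours]
  exact (I.nodup_neighbours x).filter _

theorem mem_suppNeighbours {I : LHInstance n k} {C : AmpCircuit n} {x : Cube n} {y : Supp C} :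
    y ∈ suppNeighbours I C x ↔ y.1 ∈ I.neighbours x := by
  constructor
  · intro h
    have := List.mem_map_of_mem (f := Subtype.val) h
    rw [map_val_suppNeighbours] at this
    exact (List.mem_filter.1 this).1
  · intro h
    exact List.mem_filterMap.2 ⟨y.1, h, by simp [y.2]⟩

/-- A sum over the whole support reduces to a sum over the neighbours, for a function that vanishes
elsewhere. -/
theorem sum_suppNeighbours {R : Type*} [AddCommMonoid R] (I : LHInstance n k) (C : AmpCircuit n)
    (x : Supp C) (f : Supp C → R) (hf : ∀ y, y ≠ x → y.1 ∉ I.neighbours x.1 → f y = 0) :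
    ((suppNeighbours I C x.1).map f).sum = ∑ y ∈ Finset.univ.erase x, f y := by
  rw [← List.sum_toFinset f (nodup_suppNeighbours I C x.1)]
  refine Finset.sum_subset (fun y hy => ?_) fun y hy hy' => ?_
  · rw [List.mem_toFinset, mem_suppNeighbours] at hy
    exact Finset.mem_erase.2 ⟨fun h => LHInstance.ne_of_mem_neighbours hy (congrArg _ h),
      Finset.mem_univ y⟩
  · rw [List.mem_toFinset, mem_suppNeighbours] at hy'
    exact hf y (Finset.ne_of_mem_erase hy) hy'

theorem shiftedHam_apply_ne (I : LHInstance n k) (lam : ℚ) {x y : Cube n} (h : x ≠ y) :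
    shiftedHam I lam x y = I.ham x y := by
  simp [shiftedHam, h]

theorem shiftedHam_apply_self (I : LHInstance n k) (lam : ℚ) (x : Cube n) :
    shiftedHam I lam x x = I.ham x x - lam := by
  simp [shiftedHam]

theorem genS_eq_zero (I : LHInstance n k) (w : Witness n) (x y : Supp w.circuit) (hyx : y ≠ x)
    (hy : y.1 ∉ I.neighbours x.1) : genS I w y x = 0 := by
  have h1 : y.1 ≠ x.1 := fun h => hyx (Subtype.ext h)
  have h2 : I.ham y.1 x.1 = 0 := by
    by_contra h
    exact hy (I.mem_neighbours h1 h)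
  simp [genS, generator, fixedNode, hyx, shiftedHam_apply_ne I w.lam h1, h2]

end Neighbours

/-! ### Sampling from finite and exponential distributions -/

section Sampling

theorem integral_unitInterval (f : ℝ → ℝ) :
    ∫ u : unitInterval, f u = ∫ u in (0 : ℝ)..1, f u := by
  rw [intervalIntegral.integral_of_le zero_le_one, ← integral_Icc_eq_integral_Ioc]
  exact integral_subtype_comap measurableSet_Icc f

theorem measurable_pick {α : Type*} [MeasurableSpace α] (d : α) (l : List (α × ℚ)) :
    Measurable (pick d l) := by
  induction l with
  | nil => exact measurable_const
  | cons e l ih =>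
    exact Measurable.ite measurableSet_Iio measurable_const (ih.comp (measurable_id.sub_const _))

/-- The distribution of the outcome of `pick`. -/
theorem integral_pick {α : Type*} [Finite α] [MeasurableSpace α] [DiscreteMeasurableSpace α]
    (d : α) (f : α → ℝ) (l : List (α × ℚ)) (hl : ∀ e ∈ l, 0 ≤ e.2) (c : ℝ)
    (hc : ((l.map Prod.snd).sum : ℚ) ≤ c) :
    ∫ v in (0 : ℝ)..c, f (pick d l v) =
      (l.map fun e => (e.2 : ℝ) * f e.1).sum + (c - ((l.map Prod.snd).sum : ℚ)) * f d := by
  induction l generalizing c with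
  | nil => simp [pick]
  | cons e l ih =>
    have hq : (0 : ℝ) ≤ e.2 := by exact_mod_cast hl e (.head _)
    have hs : 0 ≤ (l.map Prod.snd).sum := List.sum_nonneg fun q hq => by
      obtain ⟨e', he', rfl⟩ := List.mem_map.1 hq
      exact hl e' (.tail _ he')
    have hs' : (0 : ℝ) ≤ ((l.map Prod.snd).sum : ℚ) := by exact_mod_cast hs
    simp only [List.map_cons, List.sum_cons, Rat.cast_add] at hc ⊢
    have hint : ∀ a b, IntervalIntegrable (fun v => f (pick d (e :: l) v)) volume a b := by
      intro a b
      obtain ⟨C, hC⟩ := (Set.finite_range fun a => ‖f a‖).bddAbove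
      have hm : Measurable fun v => f (pick d (e :: l) v) :=
        (Measurable.of_discrete (f := f)).comp (measurable_pick d (e :: l))
      exact (intervalIntegrable_const (c := C)).mono_fun' hm.aestronglyMeasurable
        (ae_of_all _ fun v => hC (Set.mem_range_self _))
    rw [← intervalIntegral.integral_add_adjacent_intervals (hint 0 (e.2 : ℝ)) (hint (e.2 : ℝ) c)]
    have h1 : ∫ v in (0 : ℝ)..e.2, f (pick d (e :: l) v) = ∫ _v in (0 : ℝ)..e.2, f e.1 := by
      refine intervalIntegral.integral_congr_Ioo_of_le hq fun v hv => ?_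
      simp [pick, hv.2]
    have h2 : ∫ v in (e.2 : ℝ)..c, f (pick d (e :: l) v) =
        ∫ v in (e.2 : ℝ)..c, f (pick d l (v - e.2)) := by
      refine intervalIntegral.integral_congr_Ioo_of_le (by linarith) fun v hv => ?_
      simp only [pick]
      rw [if_neg (not_lt.2 hv.1.le)]
    rw [h1, h2, intervalIntegral.integral_comp_sub_right (fun v => f (pick d l v)), sub_self,
      ih (fun e' he' => hl e' (.tail _ he')) (c - e.2) (by linarith)]
    simp
    ring

/-- The waiting time `log (1 / u) / a`, for uniformly distributed `u`, is exponentially distributed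
with rate `a`: this is the substitution `u = exp (-a * (s - v))`. -/
theorem integral_waiting_time {a s C : ℝ} (ha : 0 < a) {g : ℝ → ℝ}
    (hg : Measurable g) (hC : ∀ v, ‖g v‖ ≤ C) (hg1 : ∀ v ≤ 0, g v = 1) :
    ∫ u in (0 : ℝ)..1, g (s - Real.log (1 / u) / a) =
      Real.exp (-(a * s)) + ∫ v in (0 : ℝ)..s, g v * (Real.exp (-(a * (s - v))) * a) := by
  have hint : ∀ b c, IntervalIntegrable (fun u => g (s - Real.log (1 / u) / a)) volume b c := by
    intro b c
    have : Measurable fun u => g (s - Real.log (1 / u) / a) := by fun_prop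
    exact (intervalIntegrable_const (c := C)).mono_fun' this.aestronglyMeasurable
      (ae_of_all _ fun v => hC _)
  rw [← intervalIntegral.integral_add_adjacent_intervals (hint 0 (Real.exp (-(a * s)))) (hint _ 1)]
  have hpos := Real.exp_pos (-(a * s))
  congr 1
  · have h1 : ∫ u in (0 : ℝ)..Real.exp (-(a * s)), g (s - Real.log (1 / u) / a) =
        ∫ _u in (0 : ℝ)..Real.exp (-(a * s)), (1 : ℝ) := by
      refine intervalIntegral.integral_congr_Ioo_of_le hpos.le fun u hu => ?_
      apply hg1
      have h2 : Real.log u ≤ -(a * s) := by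
        rw [← Real.log_exp (-(a * s))]
        exact Real.log_le_log hu.1 hu.2.le
      rw [sub_nonpos, le_div_iff₀ ha, one_div, Real.log_inv]
      linarith
    rw [h1]
    simp
  · have hd : ∀ v, HasDerivAt (fun v => Real.exp (-(a * (s - v))))
        (Real.exp (-(a * (s - v))) * a) v := fun v =>
      ((((hasDerivAt_id v).const_sub s).const_mul a).neg).exp.congr_deriv (by simp)
    have h3 := intervalIntegral.integral_comp_mul_deriv_of_deriv_nonneg (a := 0) (b := s)
      (f := fun v => Real.exp (-(a * (s - v)))) (f' := fun v => Real.exp (-(a * (s - v))) * a)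
      (g := fun u => g (s - Real.log (1 / u) / a)) (by fun_prop) (fun v _ => hd v)
      (fun v _ => by positivity)
    simp only [Function.comp_def, sub_zero, sub_self, mul_zero, neg_zero, Real.exp_zero] at h3
    rw [← h3]
    refine intervalIntegral.integral_congr fun v _ => ?_
    simp only [one_div, Real.log_inv, Real.log_exp, neg_neg]
    rw [mul_div_cancel_left₀ _ ha.ne', sub_sub_cancel]

end Sampling

/-! ### The acceptance probability of the loop -/

section Loop

variable {n k : ℕ} (I : LHInstance n k) (w : Witness n) (p t : ℕ)

/-- The points of the support that pass the checks of the loop. -/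
def goodSet : Set (Supp w.circuit) :=
  {x | RatBits p (w.circuit.amp x.1) ∧ ∑ z, genS I w z x = 0 ∧
    ∀ y, y ≠ x → 0 ≤ genS I w y x}

/-- The generator as a real matrix. -/
noncomputable def genReal : Matrix (Supp w.circuit) (Supp w.circuit) ℝ :=
  (genS I w).map fun q => (q : ℝ)

theorem genReal_apply (x y : Supp w.circuit) : genReal I w x y = (genS I w x y : ℝ) := rfl

theorem isGeneratorOn_goodSet : IsGeneratorOn (genReal I w) (goodSet I w p) := by
  intro x hx
  simp only [genReal_apply]
  exact ⟨fun y hy => by exact_mod_cast hx.2.2 y hy, by exact_mod_cast hx.2.1⟩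

variable {p} in
theorem abs_genS_self {x : Supp w.circuit} (hx : x ∈ goodSet I w p) :
    ((|genS I w x x| : ℚ) : ℝ) = -genReal I w x x := by
  have h := (isGeneratorOn_goodSet I w p).rate_nonneg hx
  rw [genReal_apply] at h ⊢
  rw [Rat.cast_abs, abs_of_nonpos (by linarith)]

theorem measurable_checkLoop (r : ℕ) (x : Supp w.circuit) :
    Measurable fun z : (Fin r → Sample) × ℝ => checkLoop I w p t r z.1 x z.2 := by
  induction r generalizing x with
  | zero =>
    have : MeasurableSet {z : (Fin 0 → Sample) × ℝ | (t : ℝ) ≤ z.2} :=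
      measurableSet_le measurable_const measurable_snd
    simp only [checkLoop]
    refine measurable_to_bool ?_
    convert this using 1
    ext z
    simp
  | succ r ih =>
    have : MeasurableSet {z : (Fin (r + 1) → Sample) × ℝ | (t : ℝ) ≤ z.2} :=
      measurableSet_le measurable_const measurable_snd
    simp only [checkLoop]
    refine Measurable.ite this measurable_const ?_
    refine Measurable.ite (.const _) measurable_const ?_
    refine Measurable.ite (.const _) measurable_const ?_
    refine Measurable.ite (.const _) measurable_const ?_
    have h1 : Measurable fun z : Supp w.circuit × ((Fin r → Sample) × ℝ) =>
        checkLoop I w p t r z.2.1 z.1 z.2.2 :=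
      measurable_from_prod_countable_right fun y => ih y
    have h2 : Measurable fun z : (Fin (r + 1) → Sample) × ℝ => (z.1 0).1 := by fun_prop
    have h3 : Measurable fun z : (Fin (r + 1) → Sample) × ℝ => (z.1 0).2 := by fun_prop
    have h4 : Measurable fun z : (Fin (r + 1) → Sample) × ℝ => Fin.tail z.1 := by
      unfold Fin.tail; fun_prop
    have h5 := (measurable_pick x (jumps I w x)).comp (measurable_subtype_coe.comp h3)
    refine h1.comp (h5.prodMk (h4.prodMk ?_))
    fun_prop

/-- The probability that the loop accepts from the state `x` at the time `τ` with `r` samples. -/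
noncomputable def loopProb (r : ℕ) (x : Supp w.circuit) (τ : ℝ) : ℝ :=
  (volume : Measure (Fin r → Sample)).real {ω | checkLoop I w p t r ω x τ = true}

theorem measurable_loopProb (r : ℕ) (x : Supp w.circuit) :
    Measurable (loopProb I w p t r x) := by
  have h : MeasurableSet {z : ℝ × (Fin r → Sample) | checkLoop I w p t r z.2 x z.1 = true} :=
    ((measurable_checkLoop I w p t r x).comp measurable_swap) (measurableSet_singleton true)
  exact (measurable_measure_prodMk_left h).ennreal_toReal

theorem loopProb_nonneg (r : ℕ) (x : Supp w.circuit) (τ : ℝ) : 0 ≤ loopProb I w p t r x τ :=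
  measureReal_nonneg

theorem loopProb_le_one (r : ℕ) (x : Supp w.circuit) (τ : ℝ) : loopProb I w p t r x τ ≤ 1 :=
  measureReal_le_one

variable {t} in
theorem loopProb_of_le (r : ℕ) (x : Supp w.circuit) {τ : ℝ} (hτ : (t : ℝ) ≤ τ) :
    loopProb I w p t r x τ = 1 := by
  have : {ω | checkLoop I w p t r ω x τ = true} = Set.univ := by
    ext ω
    cases r <;> simp [checkLoop, hτ]
  simp [loopProb, this]

variable {p} in
theorem sum_jumps {x : Supp w.circuit} (hx : x ∈ goodSet I w p) (f : Supp w.circuit → ℝ) :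
    ((jumps I w x).map fun e => (e.2 : ℝ) * f e.1).sum =
      ∑ y ∈ Finset.univ.erase x, genReal I w y x / (-genReal I w x x) * f y := by
  rw [← sum_suppNeighbours I w.circuit x
    (fun y => genReal I w y x / (-genReal I w x x) * f y) fun y h h' => by
      simp [genReal_apply, genS_eq_zero I w x y h h']]
  simp only [jumps, List.map_map, suppNeighbours]
  congr 1
  refine List.map_congr_left fun y _ => ?_
  simp only [Function.comp, Rat.cast_div, abs_genS_self I w hx, genReal_apply]

variable {p} in
theorem sum_jumps_snd {x : Supp w.circuit} (hx : x ∈ goodSet I w p) (hx0 : genS I w x x ≠ 0) :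
    (((jumps I w x).map Prod.snd).sum : ℚ) = (1 : ℝ) := by
  have h := sum_jumps I w hx fun _ => 1
  have ha0 : -genReal I w x x ≠ 0 := neg_ne_zero.2 (by rw [genReal_apply]; exact_mod_cast hx0)
  simp only [mul_one, ← Finset.sum_div, (isGeneratorOn_goodSet I w p).sum_erase hx] at h
  rw [div_self ha0] at h
  rw [← h, Rat.cast_list_sum, List.map_map]
  rfl

variable {p} in
theorem integral_pick_jumps {x : Supp w.circuit} (hx : x ∈ goodSet I w p)
    (hx0 : genS I w x x ≠ 0) (f : Supp w.circuit → ℝ) :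
    ∫ v : unitInterval, f (pick x (jumps I w x) v) =
      ∑ y ∈ Finset.univ.erase x, genReal I w y x / (-genReal I w x x) * f y := by
  have h1 := sum_jumps_snd I w hx hx0
  rw [integral_unitInterval fun v => f (pick x (jumps I w x) v), integral_pick x f
    (jumps I w x) (fun e he => ?_) 1 h1.le, sum_jumps I w hx f, h1, sub_self, zero_mul, add_zero]
  obtain ⟨y, hy, rfl⟩ := List.mem_map.1 he
  refine div_nonneg (hx.2.2 y fun h => ?_) (abs_nonneg _)
  have h6 : y ∈ suppNeighbours I w.circuit x.1 := hy
  exact LHInstance.ne_of_mem_neighbours (mem_suppNeighbours.1 h6) (congrArg _ h)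

theorem integrable_loopProb_pick (r : ℕ) (x : Supp w.circuit) (τ a : ℝ) :
    Integrable (fun σ : Sample => loopProb I w p t r (pick x (jumps I w x) (σ.2 : ℝ))
      (τ + Real.log (1 / (σ.1 : ℝ)) / a)) := by
  have h1 : Measurable fun z : Supp w.circuit × ℝ => loopProb I w p t r z.1 z.2 :=
    measurable_from_prod_countable_right fun y => measurable_loopProb I w p t r y
  have h2 : Measurable fun z : Sample => pick x (jumps I w x) (z.2 : ℝ) :=
    (measurable_pick x (jumps I w x)).comp (by fun_prop)
  have h3 : Measurable fun z : Sample => τ + Real.log (1 / (z.1 : ℝ)) / a := by fun_prop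
  have h4 := h1.comp (h2.prodMk h3)
  refine Integrable.of_bound h4.aestronglyMeasurable 1 (ae_of_all _ fun σ => ?_)
  rw [Real.norm_of_nonneg (loopProb_nonneg _ _ _ _ _ _ _)]
  exact loopProb_le_one _ _ _ _ _ _ _

variable {p t} in
theorem checkLoop_of_mem {r : ℕ} {x : Supp w.circuit} (hx : x ∈ goodSet I w p) {τ : ℝ}
    (hτ : τ < t) (ω : Fin (r + 1) → Sample) :
    checkLoop I w p t (r + 1) ω x τ = if genS I w x x = 0 then true else
      checkLoop I w p t r (Fin.tail ω) (pick x (jumps I w x) ((ω 0).2 : ℝ))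
        (τ + Real.log (1 / ((ω 0).1 : ℝ)) / (-genReal I w x x)) := by
  have h1 : ¬ (∑ z, genS I w z x ≠ 0 ∨ ∃ y, y ≠ x ∧ genS I w y x < 0) := by
    push Not
    exact hx.2
  simp only [checkLoop]
  rw [if_neg hτ.not_ge, if_neg (not_not.2 hx.1), if_neg h1, abs_genS_self I w hx]

variable {p t} in
theorem checkLoop_of_notMem {r : ℕ} {x : Supp w.circuit} (hx : x ∉ goodSet I w p) {τ : ℝ}
    (hτ : τ < t) (ω : Fin (r + 1) → Sample) : checkLoop I w p t (r + 1) ω x τ = false := by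
  simp only [checkLoop]
  rw [if_neg hτ.not_ge]
  by_cases hb : RatBits p (w.circuit.amp x.1)
  · rw [if_neg (not_not.2 hb), if_pos]
    by_contra h
    push Not at h
    exact hx ⟨hb, h⟩
  · rw [if_pos hb]

variable {p t} in
/-- Integrating over the first sample. -/
theorem loopProb_succ_eq_integral (r : ℕ) {x : Supp w.circuit} (hx : x ∈ goodSet I w p)
    (hx0 : genS I w x x ≠ 0) {τ : ℝ} (hτ : τ < t) :
    loopProb I w p t (r + 1) x τ =
      ∫ σ : Sample, loopProb I w p t r (pick x (jumps I w x) (σ.2 : ℝ))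
        (τ + Real.log (1 / (σ.1 : ℝ)) / (-genReal I w x x)) := by
  set a : ℝ := -genReal I w x x with ha
  let S : Set (Sample × (Fin r → Sample)) := {z | checkLoop I w p t r z.2
    (pick x (jumps I w x) (z.1.2 : ℝ)) (τ + Real.log (1 / (z.1.1 : ℝ)) / a) = true}
  have hS : MeasurableSet S := by
    have h1 : Measurable fun z : Supp w.circuit × ((Fin r → Sample) × ℝ) =>
        checkLoop I w p t r z.2.1 z.1 z.2.2 :=
      measurable_from_prod_countable_right fun y => measurable_checkLoop I w p t r y
    have h2 : Measurable fun z : Sample × (Fin r → Sample) => pick x (jumps I w x) (z.1.2 : ℝ) :=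
      (measurable_pick x (jumps I w x)).comp (by fun_prop)
    have h3 : Measurable fun z : Sample × (Fin r → Sample) =>
        τ + Real.log (1 / (z.1.1 : ℝ)) / a := by fun_prop
    exact (h1.comp (h2.prodMk (measurable_snd.prodMk h3))) (measurableSet_singleton true)
  have h1 : loopProb I w p t (r + 1) x τ =
      (volume : Measure (Sample × (Fin r → Sample))).real S := by
    have hmp := volume_preserving_piFinSuccAbove (fun _ : Fin (r + 1) => Sample) 0
    rw [← hmp.measureReal_preimage hS.nullMeasurableSet, loopProb]
    congr 1
    ext ω
    simp only [Set.mem_ofPred_eq, Set.mem_preimage, checkLoop_of_mem I w hx hτ, if_neg hx0, S]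
    rfl
  rw [h1, Measure.volume_eq_prod, ← integral_indicator_one hS, integral_prod]
  · refine integral_congr_ae (ae_of_all _ fun σ => ?_)
    have h3 : MeasurableSet {ω' | checkLoop I w p t r ω' (pick x (jumps I w x) (σ.2 : ℝ))
        (τ + Real.log (1 / (σ.1 : ℝ)) / a) = true} := measurable_prodMk_left hS
    simp only [loopProb]
    rw [← integral_indicator_one h3]
    rfl
  · exact (integrable_const (1 : ℝ)).indicator hS

variable {p t} in
/-- Conditioning on the first jump. -/
theorem loopProb_succ (r : ℕ) {x : Supp w.circuit} (hx : x ∈ goodSet I w p)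
    (hx0 : genS I w x x ≠ 0) {τ : ℝ} (hτ : τ < t) :
    loopProb I w p t (r + 1) x τ = ∫ u in (0 : ℝ)..1,
      (∑ y ∈ Finset.univ.erase x, genReal I w y x / (-genReal I w x x) *
        loopProb I w p t r y (τ + Real.log (1 / u) / (-genReal I w x x))) := by
  rw [loopProb_succ_eq_integral I w r hx hx0 hτ, Measure.volume_eq_prod, integral_prod _
    (integrable_loopProb_pick I w p t r x τ _), ← integral_unitInterval]
  refine integral_congr_ae (ae_of_all _ fun u => ?_)
  exact integral_pick_jumps I w hx hx0 fun y =>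
    loopProb I w p t r y (τ + Real.log (1 / (u : ℝ)) / (-genReal I w x x))

variable {t} in
/-- The loop simulates the process with generator `genS`, killed outside of the good set. -/
theorem loopProb_eq_survival (r : ℕ) (x : Supp w.circuit) {τ : ℝ} (hτ : τ < t) :
    loopProb I w p t r x τ = survival (genReal I w) (goodSet I w p) r x (t - τ) := by
  induction r generalizing x τ with
  | zero =>
    have h : {ω : Fin 0 → Sample | checkLoop I w p t 0 ω x τ = true} = ∅ := by
      ext ω; simp [checkLoop, hτ]
    rw [loopProb, h, survival_zero, measureReal_empty]
  | succ r ih =>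
    have hG := isGeneratorOn_goodSet I w p
    by_cases hx : x ∈ goodSet I w p
    · have hrate := hG.rate_nonneg hx
      rw [survival_succ _ _ hx]
      by_cases hx0 : genS I w x x = 0
      · have h1 : {ω : Fin (r + 1) → Sample | checkLoop I w p t (r + 1) ω x τ = true} =
            Set.univ := by
          ext ω
          simp [checkLoop_of_mem I w hx hτ, hx0]
        have h2 : genReal I w x x = 0 := by rw [genReal_apply, hx0, Rat.cast_zero]
        have h3 : ∀ y ∈ Finset.univ.erase x, genReal I w y x = 0 := by
          have h4 := hG.sum_erase hx
          rw [h2, neg_zero, Finset.sum_eq_zero_iff_of_nonneg fun y hy =>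
            (hG x hx).1 y (Finset.ne_of_mem_erase hy)] at h4
          exact h4
        have h5 : ∀ v, ∑ y ∈ Finset.univ.erase x, genReal I w y x *
            survival (genReal I w) (goodSet I w p) r y v = 0 := fun v =>
          Finset.sum_eq_zero fun y hy => by rw [h3 y hy, zero_mul]
        simp [loopProb, h1, h2, h5]
      · set a : ℝ := -genReal I w x x with ha
        have ha0 : 0 < a := lt_of_le_of_ne hrate fun h => hx0 (by
          rw [ha, genReal_apply] at h
          exact_mod_cast neg_eq_zero.1 h.symm)
        have hsum : ∑ y ∈ Finset.univ.erase x, genReal I w y x / a = 1 := by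
          rw [← Finset.sum_div, hG.sum_erase hx, ← ha, div_self ha0.ne']
        have hP : ∀ y ∈ Finset.univ.erase x, 0 ≤ genReal I w y x / a := fun y hy =>
          div_nonneg ((hG x hx).1 y (Finset.ne_of_mem_erase hy)) ha0.le
        let g : ℝ → ℝ := fun v => ∑ y ∈ Finset.univ.erase x, genReal I w y x / a *
          loopProb I w p t r y (t - v)
        have hgm : Measurable g := by
          have := measurable_loopProb I w p t r
          fun_prop
        have hgb : ∀ v, ‖g v‖ ≤ 1 := fun v => by
          simp only [g]
          rw [Real.norm_of_nonneg (Finset.sum_nonneg fun y hy =>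
            mul_nonneg (hP y hy) (loopProb_nonneg _ _ _ _ _ _ _)), ← hsum]
          exact Finset.sum_le_sum fun y hy =>
            mul_le_of_le_one_right (hP y hy) (loopProb_le_one _ _ _ _ _ _ _)
        have hg1 : ∀ v ≤ 0, g v = 1 := fun v hv => by
          simp only [g]
          rw [← hsum]
          refine Finset.sum_congr rfl fun y _ => ?_
          rw [loopProb_of_le I w p r y (by linarith), mul_one]
        have h1 := integral_waiting_time (s := t - τ) ha0 hgm hgb hg1
        have h2 : ∀ u : ℝ, (∑ y ∈ Finset.univ.erase x, genReal I w y x / (-genReal I w x x) *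
            loopProb I w p t r y (τ + Real.log (1 / u) / (-genReal I w x x))) =
            g (t - τ - Real.log (1 / u) / a) := by
          intro u
          simp only [g, ← ha]
          refine Finset.sum_congr rfl fun y _ => ?_
          congr 2
          ring
        have haG : genReal I w x x = -a := by rw [ha, neg_neg]
        rw [loopProb_succ I w r hx hx0 hτ]
        simp only [h2]
        rw [h1, haG, mul_add, mul_one, ← neg_mul, ← intervalIntegral.integral_const_mul]
        congr 1
        refine intervalIntegral.integral_congr_Ioo_of_le (μ := volume) (sub_nonneg.2 hτ.le)
          fun v hv => ?_
        simp only [g]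
        have h3 : ∀ y, loopProb I w p t r y (t - v) =
            survival (genReal I w) (goodSet I w p) r y v := by
          intro y
          rw [ih y (by linarith [hv.1]), sub_sub_cancel]
        have h4 : Real.exp (-(a * (t - τ - v))) =
            Real.exp (-a * (t - τ)) * Real.exp (-(-a * v)) := by
          rw [← Real.exp_add]; congr 1; ring
        simp only [h3]
        rw [h4, Finset.sum_mul, Finset.mul_sum, Finset.mul_sum]
        refine Finset.sum_congr rfl fun y _ => ?_
        field_simp
    · rw [survival_of_notMem _ _ hx]
      have h1 : {ω : Fin (r + 1) → Sample | checkLoop I w p t (r + 1) ω x τ = true} = ∅ := by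
        ext ω
        simp [checkLoop_of_notMem I w hx hτ]
      rw [loopProb, h1, measureReal_empty]

end Loop

/-! ### The fixed node Hamiltonian -/

section FixedNodeLemmas

theorem inSPlus_comm {ι : Type*} {H : Matrix ι ι ℚ} {φ : ι → ℚ} (hH : H.IsSymm)
    (x y : ι) : InSPlus H φ x y ↔ InSPlus H φ y x := by
  unfold InSPlus
  rw [hH.apply x y, ne_comm, mul_comm (φ x * H x y), mul_comm (φ x), mul_assoc]

variable {ι : Type*} [Fintype ι] [DecidableEq ι] {H : Matrix ι ι ℚ} {φ : ι → ℚ}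

theorem fixedNode_self (x : ι) : fixedNode H φ x x =
    H x x + ∑ z, if InSPlus H φ x z then H x z * (φ z / φ x) else 0 := by
  simp [fixedNode]

theorem fixedNode_ne {x y : ι} (h : x ≠ y) :
    fixedNode H φ x y = if InSPlus H φ x y then 0 else H x y := by
  simp [fixedNode, h]

theorem fixedNode_isSymm (hH : H.IsSymm) : (fixedNode H φ).IsSymm := by
  refine Matrix.IsSymm.ext fun x y => ?_
  by_cases h : x = y
  · rw [h]
  · rw [fixedNode_ne h, fixedNode_ne (Ne.symm h), hH.apply x y]
    simp only [inSPlus_comm hH x y]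

theorem fixedNode_eq (x y : ι) : fixedNode H φ x y =
    H x y - (if InSPlus H φ x y then H x y else 0) +
      if x = y then ∑ z, if InSPlus H φ x z then H x z * (φ z / φ x) else 0 else 0 := by
  by_cases h : x = y
  · subst h
    have : ¬ InSPlus H φ x x := fun h => h.1 rfl
    simp [fixedNode_self, this]
  · rw [fixedNode_ne h]
    split_ifs <;> simp

/-- The fixed node Hamiltonian acts on `φ` as `H` does. -/
theorem sum_fixedNode_mul (hφ : ∀ x, φ x ≠ 0) (x : ι) :
    ∑ y, fixedNode H φ x y * φ y = ∑ y, H x y * φ y := by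
  simp only [fixedNode_eq, add_mul, sub_mul, Finset.sum_add_distrib, Finset.sum_sub_distrib,
    ite_mul, zero_mul, Finset.sum_ite_eq, Finset.mem_univ, if_true, Finset.sum_mul]
  rw [sub_add, sub_eq_self, sub_eq_zero]
  refine Finset.sum_congr rfl fun y _ => ?_
  split_ifs
  · have := hφ x
    field_simp
  · rfl

/-- The fixed node Hamiltonian dominates `H`: the difference is a sum of squares. -/
theorem quadForm_le_fixedNode (hH : H.IsSymm) (hφ : ∀ x, φ x ≠ 0) (v : ι → ℝ) :
    ∑ x, v x * ∑ y, (H x y : ℝ) * v y ≤ ∑ x, v x * ∑ y, (fixedNode H φ x y : ℝ) * v y := by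
  let K : ι → ι → ℝ := fun x y => if InSPlus H φ x y then (φ x * H x y * φ y : ℚ) else 0
  let a : ι → ℝ := fun x => v x / φ x
  have hφ' : ∀ x, (φ x : ℝ) ≠ 0 := fun x => by exact_mod_cast hφ x
  have hK : ∀ x y, 0 ≤ K x y := by
    intro x y
    simp only [K]
    split_ifs with h
    · exact_mod_cast h.2.le
    · rfl
  have hKs : ∀ x y, K x y = K y x := by
    intro x y
    simp only [K, inSPlus_comm hH x y, hH.apply x y]
    split_ifs
    · congr 1; ring
    · rfl
  have h1 : ∀ x, v x * ∑ y, (fixedNode H φ x y : ℝ) * v y =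
      v x * ∑ y, (H x y : ℝ) * v y + ∑ y, K x y * (a x ^ 2 - a x * a y) := by
    intro x
    have h2 : ∑ y, (fixedNode H φ x y : ℝ) * v y = ∑ y, (H x y : ℝ) * v y +
        ∑ y, ((if InSPlus H φ x y then (H x y * (φ y / φ x) : ℝ) else 0) * v x -
          (if InSPlus H φ x y then (H x y : ℝ) else 0) * v y) := by
      simp only [fixedNode_eq, Rat.cast_add, Rat.cast_sub, Rat.cast_sum,
        apply_ite (Rat.cast (K := ℝ)), Rat.cast_zero, Rat.cast_mul, Rat.cast_div, add_mul,
        sub_mul, Finset.sum_add_distrib,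
        Finset.sum_sub_distrib]
      have h3 : ∀ c : ℝ, ∑ y, (if x = y then c else 0) * v y = c * v x := fun c => by simp
      rw [h3, Finset.sum_mul]
      ring
    rw [h2, mul_add, Finset.mul_sum Finset.univ (fun y =>
      (if InSPlus H φ x y then (H x y * (φ y / φ x) : ℝ) else 0) * v x -
          (if InSPlus H φ x y then (H x y : ℝ) else 0) * v y)]
    congr 1
    refine Finset.sum_congr rfl fun y _ => ?_
    simp only [K, a]
    have := hφ' x
    have := hφ' y
    split_ifs
    · push_cast
      field_simp
    · ring
  have h4 : ∑ x, ∑ y, K x y * (a x ^ 2 - a x * a y) =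
      1 / 2 * ∑ x, ∑ y, K x y * (a x - a y) ^ 2 := by
    have h5 : ∑ x, ∑ y, K x y * (a x ^ 2 - a x * a y) =
        ∑ x, ∑ y, K x y * (a y ^ 2 - a x * a y) := by
      rw [Finset.sum_comm]
      refine Finset.sum_congr rfl fun x _ => Finset.sum_congr rfl fun y _ => ?_
      rw [hKs y x, mul_comm (a y)]
    have h6 : ∑ x, ∑ y, K x y * (a x - a y) ^ 2 = ∑ x, ∑ y, K x y * (a x ^ 2 - a x * a y) +
        ∑ x, ∑ y, K x y * (a y ^ 2 - a x * a y) := by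
      simp only [← Finset.sum_add_distrib]
      refine Finset.sum_congr rfl fun x _ => Finset.sum_congr rfl fun y _ => by ring
    rw [h6, ← h5]; ring
  simp only [h1, Finset.sum_add_distrib, h4]
  have h7 : 0 ≤ ∑ x, ∑ y, K x y * (a x - a y) ^ 2 := Finset.sum_nonneg fun x _ =>
    Finset.sum_nonneg fun y _ => mul_nonneg (hK x y) (sq_nonneg _)
  linarith

theorem generator_apply (x y : ι) :
    generator H φ y x = -(fixedNode H φ y x * (φ y / φ x)) := rfl

theorem sum_generator (hH : H.IsSymm) (hφ : ∀ x, φ x ≠ 0) (x : ι) :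
    ∑ y, generator H φ y x = -(∑ y, H x y * φ y) / φ x := by
  rw [← sum_fixedNode_mul hφ, neg_div, Finset.sum_div, ← Finset.sum_neg_distrib]
  refine Finset.sum_congr rfl fun y _ => ?_
  rw [generator_apply, (fixedNode_isSymm hH).apply x y, mul_div_assoc]

theorem generator_nonneg (hφ : ∀ x, φ x ≠ 0) {x y : ι} (h : y ≠ x) : 0 ≤ generator H φ y x := by
  rw [generator_apply, fixedNode_ne h]
  split_ifs with hS
  · simp
  · have h1 : φ y * H y x * φ x ≤ 0 := by
      by_contra h2
      exact hS ⟨h, not_le.1 h2⟩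
    have h3 := hφ x
    have h4 : -(H y x * (φ y / φ x)) = -(φ y * H y x * φ x) / φ x ^ 2 := by
      field_simp
    rw [h4]
    exact div_nonneg (neg_nonneg.2 h1) (sq_nonneg _)

/-- Detailed balance: `φ²` is reversible for the generator. -/
theorem sq_mul_generator (hφ : ∀ x, φ x ≠ 0) (x y : ι) :
    φ x ^ 2 * generator H φ y x = -(fixedNode H φ y x * φ y * φ x) := by
  have := hφ x
  rw [generator_apply]
  field_simp

theorem sq_mul_generator_le (hφ : ∀ x, φ x ≠ 0) {x y : ι} (h : y ≠ x) :
    φ x ^ 2 * generator H φ y x ≤ |H y x| * ((φ x ^ 2 + φ y ^ 2) / 2) := by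
  have h0 : 0 ≤ |H y x| * ((φ x ^ 2 + φ y ^ 2) / 2) := by positivity
  rw [sq_mul_generator hφ, fixedNode_ne h]
  split_ifs
  · simpa using h0
  · have h1 : |φ y * φ x| ≤ (φ x ^ 2 + φ y ^ 2) / 2 := by
      rw [abs_le]
      constructor <;> nlinarith [sq_nonneg (φ x + φ y), sq_nonneg (φ x - φ y)]
    calc -(H y x * φ y * φ x) ≤ |H y x * φ y * φ x| := neg_le_abs _
      _ = |H y x| * |φ y * φ x| := by rw [mul_assoc, abs_mul]
      _ ≤ _ := mul_le_mul_of_nonneg_left h1 (abs_nonneg _)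

end FixedNodeLemmas

/-! ### Spectral bounds -/

section Spectral

theorem groundEnergy_mul_le {ι : Type*} [Fintype ι] [DecidableEq ι] {A : Matrix ι ι ℝ}
    (hA : A.IsSymm) (v : ι → ℝ) :
    groundEnergy A * ∑ x, v x ^ 2 ≤ ∑ x, v x * ∑ y, A x y * v y := by
  have hA' : A.IsHermitian := by
    rw [Matrix.IsHermitian, Matrix.conjTranspose_eq_transpose_of_trivial]; exact hA
  have hB : (A - groundEnergy A • (1 : Matrix ι ι ℝ)).IsHermitian := by
    refine hA'.sub ?_
    rw [Matrix.IsHermitian, Matrix.conjTranspose_smul, Matrix.conjTranspose_one]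
    rfl
  have hpos : (A - groundEnergy A • (1 : Matrix ι ι ℝ)).PosSemidef := by
    rw [hB.posSemidef_iff_eigenvalues_nonneg]
    intro i
    have h1 : hB.eigenvalues i ∈ spectrum ℝ (A - groundEnergy A • (1 : Matrix ι ι ℝ)) := by
      rw [hB.spectrum_real_eq_range_eigenvalues]; exact Set.mem_range_self i
    generalize hB.eigenvalues i = e at h1 ⊢
    rw [← Algebra.algebraMap_eq_smul_one, ← spectrum.sub_singleton_eq] at h1
    obtain ⟨μ, hμ, c, hc, h2⟩ := Set.mem_sub.1 h1
    rw [Set.mem_singleton_iff] at hc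
    have h3 : BddBelow (spectrum ℝ A) := by
      rw [hA'.spectrum_real_eq_range_eigenvalues]
      exact (Set.finite_range _).bddBelow
    have h4 : groundEnergy A ≤ μ := csInf_le h3 hμ
    simp only [Pi.zero_apply]
    linarith
  have h5 := hpos.dotProduct_mulVec_nonneg v
  have h6 : star v ⬝ᵥ (A - groundEnergy A • (1 : Matrix ι ι ℝ)).mulVec v =
      ∑ x, v x * ∑ y, A x y * v y - groundEnergy A * ∑ x, v x ^ 2 := by
    rw [Matrix.sub_mulVec, Matrix.smul_mulVec, Matrix.one_mulVec]
    simp only [dotProduct, star_trivial, Pi.sub_apply, Pi.smul_apply, smul_eq_mul, mul_sub,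
      Finset.sum_sub_distrib, Finset.mul_sum, Matrix.mulVec]
    congr 1
    exact Finset.sum_congr rfl fun x _ => by ring
  linarith

theorem abs_apply_le_norm {ι : Type*} [Fintype ι] [DecidableEq ι] (A : Matrix ι ι ℝ) (x y : ι) :
    |A x y| ≤ ‖Matrix.toEuclideanCLM (𝕜 := ℝ) A‖ := by
  have h1 := (Matrix.toEuclideanCLM (𝕜 := ℝ) A).le_opNorm (EuclideanSpace.single y 1)
  rw [PiLp.norm_single, norm_one, mul_one] at h1
  refine le_trans ?_ h1
  have h2 := PiLp.norm_apply_le (Matrix.toEuclideanCLM (𝕜 := ℝ) A (EuclideanSpace.single y 1)) x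
  refine le_trans (le_of_eq ?_) h2
  rw [Real.norm_eq_abs]
  congr 1
  simp [EuclideanSpace.single]

end Spectral

/-! ### Bit lengths of fractions -/

section Height

/-- The larger one of the bit lengths of the numerator and the denominator of a reduced fraction.
Unlike `ratSize` it grows by an additive amount under every arithmetic operation, which keeps
iterated sums polynomial. -/
def height (q : ℚ) : ℕ := max (Nat.size q.num.natAbs) (Nat.size q.den)

theorem ratSize_le_two_mul_height (q : ℚ) : ratSize q ≤ 2 * height q := by
  unfold ratSize height; omega

theorem height_le_ratSize (q : ℚ) : height q ≤ ratSize q := by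
  unfold ratSize height; omega

theorem height_le_iff {q : ℚ} {e : ℕ} :
    height q ≤ e ↔ q.num.natAbs < 2 ^ e ∧ q.den < 2 ^ e := by
  simp [height, Nat.size_le]

theorem num_lt_two_pow_height (q : ℚ) : q.num.natAbs < 2 ^ height q := (height_le_iff.1 le_rfl).1

theorem den_lt_two_pow_height (q : ℚ) : q.den < 2 ^ height q := (height_le_iff.1 le_rfl).2

theorem height_zero : height 0 = 1 := by
  simp [height]

theorem height_le_of_eq_div {q : ℚ} {N D : ℤ} {e : ℕ} (hq : q = N / D) (hD : D ≠ 0)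
    (hN : N.natAbs < 2 ^ e) (hD' : D.natAbs < 2 ^ e) : height q ≤ e := by
  rw [height_le_iff]
  rw [← Rat.divInt_eq_div] at hq
  have h1 := Rat.num_dvd N hD
  have h2 := Rat.den_dvd N D
  rw [← hq] at h1 h2
  constructor
  · by_cases hN0 : N = 0
    · have h3 : q = 0 := by rw [hq, hN0, Rat.zero_divInt]
      rw [h3]
      simp
    · exact lt_of_le_of_lt (Nat.le_of_dvd (Int.natAbs_pos.2 hN0) (Int.natAbs_dvd_natAbs.2 h1)) hN
  · refine lt_of_le_of_lt (Nat.le_of_dvd (Int.natAbs_pos.2 hD) ?_) hD'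
    exact Int.natAbs_dvd_natAbs.2 h2

theorem height_natCast_le {m e : ℕ} (hm : m < 2 ^ e) (he : 1 ≤ e) : height (m : ℚ) ≤ e :=
  height_le_iff.2 ⟨by simpa using hm, by simpa using Nat.one_lt_two_pow (by omega)⟩

theorem height_neg (a : ℚ) : height (-a) = height a := by
  simp [height]

theorem height_abs (a : ℚ) : height |a| = height a := by
  rcases abs_choice a with h | h <;> rw [h]
  exact height_neg a

theorem height_add_le (a b : ℚ) : height (a + b) ≤ height a + height b + 1 := by
  have ha := num_lt_two_pow_height a
  have hb := num_lt_two_pow_height b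
  have ha' := den_lt_two_pow_height a
  have hb' := den_lt_two_pow_height b
  refine height_le_of_eq_div (N := a.num * b.den + b.num * a.den) (D := a.den * b.den) ?_ ?_ ?_ ?_
  · have h1 : (a.den : ℚ) ≠ 0 := by exact_mod_cast a.den_nz
    have h2 : (b.den : ℚ) ≠ 0 := by exact_mod_cast b.den_nz
    push_cast
    nth_rewrite 1 [← Rat.num_div_den a, ← Rat.num_div_den b]
    field_simp
  · exact mul_ne_zero (by exact_mod_cast a.den_nz) (by exact_mod_cast b.den_nz)
  · refine lt_of_le_of_lt (Int.natAbs_add_le _ _) ?_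
    rw [Int.natAbs_mul, Int.natAbs_mul, Int.natAbs_natCast, Int.natAbs_natCast, pow_succ, mul_two]
    refine add_lt_add ?_ ?_
    · rw [pow_add]; exact Nat.mul_lt_mul'' ha hb'
    · rw [pow_add, mul_comm (2 ^ height a)]; exact Nat.mul_lt_mul'' hb ha'
  · rw [Int.natAbs_mul, Int.natAbs_natCast, Int.natAbs_natCast, pow_succ, pow_add]
    exact lt_of_lt_of_le (Nat.mul_lt_mul'' ha' hb') (Nat.le_mul_of_pos_right _ two_pos)

theorem height_sub_le (a b : ℚ) : height (a - b) ≤ height a + height b + 1 := by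
  rw [sub_eq_add_neg, ← height_neg b]; exact height_add_le a (-b)

theorem height_mul_le (a b : ℚ) : height (a * b) ≤ height a + height b := by
  refine height_le_of_eq_div (N := a.num * b.num) (D := a.den * b.den) ?_ ?_ ?_ ?_
  · push_cast
    nth_rewrite 1 [← Rat.num_div_den a, ← Rat.num_div_den b]
    rw [div_mul_div_comm]
  · exact mul_ne_zero (by exact_mod_cast a.den_nz) (by exact_mod_cast b.den_nz)
  · rw [Int.natAbs_mul, pow_add]
    exact Nat.mul_lt_mul'' (num_lt_two_pow_height a) (num_lt_two_pow_height b)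
  · rw [Int.natAbs_mul, Int.natAbs_natCast, Int.natAbs_natCast, pow_add]
    exact Nat.mul_lt_mul'' (den_lt_two_pow_height a) (den_lt_two_pow_height b)

theorem height_inv_le (a : ℚ) : height a⁻¹ ≤ height a := by
  by_cases ha : a = 0
  · rw [ha, inv_zero]
  · refine height_le_of_eq_div (N := a.den) (D := a.num) ?_ (Rat.num_ne_zero.2 ha) ?_
      (num_lt_two_pow_height a)
    · nth_rewrite 1 [← Rat.num_div_den a]
      rw [inv_div]
      rfl
    · exact den_lt_two_pow_height a

theorem height_div_le (a b : ℚ) : height (a / b) ≤ height a + height b := by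
  rw [div_eq_mul_inv]
  exact (height_mul_le a b⁻¹).trans (add_le_add_right (height_inv_le b) _)

theorem height_sum_le {e : ℕ} (l : List ℚ) (hl : ∀ q ∈ l, height q ≤ e) :
    height l.sum ≤ l.length * (e + 1) + 1 := by
  induction l with
  | nil => simp [height_zero]
  | cons q l ih =>
    have h1 := hl q (.head _)
    have h2 := ih fun q' hq' => hl q' (.tail _ hq')
    have h3 := height_add_le q l.sum
    rw [List.sum_cons, List.length_cons, Nat.succ_mul]
    omega

theorem RatBits.height_le {p : ℕ} {q : ℚ} (h : RatBits p q) : height q ≤ p + 1 := by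
  have h2 : 2 ^ p < 2 ^ (p + 1) := Nat.pow_lt_pow_right one_lt_two (Nat.lt_succ_self p)
  exact height_le_iff.2 ⟨h.1.trans_lt h2, h.2.trans_lt h2⟩

theorem RatBits.abs_le {p : ℕ} {q : ℚ} (h : RatBits p q) : |q| ≤ 2 ^ p := by
  have h1 : |q| = q.num.natAbs / q.den := by
    nth_rewrite 1 [← Rat.num_div_den q]
    rw [abs_div, Nat.abs_cast, Nat.cast_natAbs, Int.cast_abs]
  have h2 : (1 : ℚ) ≤ q.den := by exact_mod_cast q.den_pos
  rw [h1]
  refine (div_le_self (by positivity) h2).trans ?_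
  exact_mod_cast h.1

theorem RatBits.one_le_mul_abs {p : ℕ} {q : ℚ} (h : RatBits p q) (hq : q ≠ 0) :
    1 ≤ 2 ^ p * |q| := by
  have h1 : |q| = q.num.natAbs / q.den := by
    nth_rewrite 1 [← Rat.num_div_den q]
    rw [abs_div, Nat.abs_cast, Nat.cast_natAbs, Int.cast_abs]
  have h2 : (0 : ℚ) < q.den := by exact_mod_cast q.den_pos
  have h3 : (1 : ℚ) ≤ q.num.natAbs := by
    exact_mod_cast Int.natAbs_pos.2 (Rat.num_ne_zero.2 hq)
  have h4 : (q.den : ℚ) ≤ 2 ^ p := by exact_mod_cast h.2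
  rw [h1, mul_div_assoc', le_div_iff₀ h2, one_mul]
  nlinarith [h3, h4, h2]

theorem natOfBits_lt (l : List Bool) : natOfBits l < 2 ^ l.length := by
  induction l with
  | nil => simp [natOfBits]
  | cons b l ih =>
    have h1 : natOfBits (b :: l) = b.toNat + 2 * natOfBits l := rfl
    have h2 := Bool.toNat_le b
    rw [h1, List.length_cons, pow_succ]
    omega

end Height

section CircuitSize

variable {n : ℕ}

theorem length_le_sum_map {α : Type*} (l : List α) (f : α → ℕ) (hf : ∀ a ∈ l, 1 ≤ f a) :
    l.length ≤ (l.map f).sum := by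
  simpa using List.card_nsmul_le_sum (l.map f) 1 (by simpa using hf)

theorem Gate.one_le_size (g : Gate n) : 1 ≤ g.size := by
  cases g <;> simp [Gate.size]

namespace AmpCircuit

theorem length_gates_le (C : AmpCircuit n) : C.gates.length ≤ C.size := by
  have := length_le_sum_map C.gates Gate.size fun g _ => g.one_le_size
  unfold size; omega

theorem length_num_le (C : AmpCircuit n) : C.num.length ≤ C.size := by
  have := length_le_sum_map C.num (fun i => Nat.size i + 1) fun i _ => by omega
  unfold size; omega

theorem length_den_le (C : AmpCircuit n) : C.den.length ≤ C.size := by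
  have := length_le_sum_map C.den (fun i => Nat.size i + 1) fun i _ => by omega
  unfold size; omega

theorem one_le_size (C : AmpCircuit n) : 1 ≤ C.size := by
  unfold size; omega

theorem height_amp_le (C : AmpCircuit n) (x : Cube n) : height (C.amp x) ≤ C.size := by
  have h0 := C.one_le_size
  have hnum := natOfBits_lt (C.num.map fun i => (C.wires x).getD i false)
  have hden := natOfBits_lt (C.den.map fun i => (C.wires x).getD i false)
  rw [List.length_map] at hnum hden
  have key : height ((natOfBits (C.num.map fun i => (C.wires x).getD i false) : ℚ) /
      (natOfBits (C.den.map fun i => (C.wires x).getD i false) : ℚ)) ≤ C.size := by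
    by_cases h : natOfBits (C.den.map fun i => (C.wires x).getD i false) = 0
    · rw [h, Nat.cast_zero, div_zero, height_zero]; exact h0
    · refine height_le_of_eq_div (N := natOfBits (C.num.map fun i => (C.wires x).getD i false))
        (D := natOfBits (C.den.map fun i => (C.wires x).getD i false)) (by simp)
        (by exact_mod_cast h) ?_ ?_
      · exact hnum.trans_le (Nat.pow_le_pow_right two_pos C.length_num_le)
      · exact hden.trans_le (Nat.pow_le_pow_right two_pos C.length_den_le)
  simp only [amp]
  split_ifs
  · rw [height_neg]; exact key
  · exact key

end AmpCircuit

end CircuitSize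

section HamHeight

variable {n k : ℕ}

theorem LocalTerm.height_entry_le {p : ℕ} {h : LocalTerm n k}
    (hh : ∀ r s, RatBits p (h.mat r s)) (x y : Cube n) : height (h.entry x y) ≤ p + 1 := by
  unfold LocalTerm.entry
  split_ifs
  · exact (hh _ _).height_le
  · rw [height_zero]; omega

theorem height_sum_entry_le {p : ℕ} (l : List (LocalTerm n k))
    (hl : ∀ h ∈ l, ∀ r s, RatBits p (h.mat r s)) (x y : Cube n) :
    height (l.map fun h => h.entry x y).sum ≤ l.length * (p + 2) + 1 := by
  have := height_sum_le (e := p + 1) (l.map fun h => h.entry x y) fun q hq => by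
    obtain ⟨h, hh, rfl⟩ := List.mem_map.1 hq
    exact LocalTerm.height_entry_le (hl h hh) x y
  simpa using this

end HamHeight

/-! ### The timed algorithm computes the protocol -/

namespace Timed

theorem pure_val {α : Type} (a : α) : (pure a : Timed α).val = a := rfl

theorem pure_cost {α : Type} (a : α) : (pure a : Timed α).cost = 0 := rfl

theorem bind_val {α β : Type} (c : Timed α) (f : α → Timed β) :
    (c >>= f).val = (f c.val).val := rfl

theorem bind_cost {α β : Type} (c : Timed α) (f : α → Timed β) :
    (c >>= f).cost = c.cost + (f c.val).cost := rfl

theorem ite_val {α : Type} (p : Prop) [Decidable p] (a b : Timed α) :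
    (if p then a else b).val = if p then a.val else b.val := apply_ite _ _ _ _

theorem ite_cost {α : Type} (p : Prop) [Decidable p] (a b : Timed α) :
    (if p then a else b).cost = if p then a.cost else b.cost := apply_ite _ _ _ _

variable {n k : ℕ}

theorem wires_val (x : Cube n) (gs : List (Gate n)) (w : List Bool) :
    (wires x gs w).val = gs.foldl (fun w g => w ++ [g.eval x w]) w := by
  induction gs generalizing w with
  | nil => rfl
  | cons g gs ih => simp only [wires, bind_val, ih, List.foldl_cons]

theorem number_val (w : List Bool) (l : List ℕ) :
    (number w l).val = natOfBits (l.map fun i => w.getD i false) := by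
  induction l with
  | nil => rfl
  | cons i l ih =>
    simp only [number, bind_val, pure_val, ih]
    rfl

theorem amp_val (C : AmpCircuit n) (x : Cube n) : (amp C x).val = C.amp x := by
  simp only [amp, bind_val, ite_val, pure_val, number_val, wires_val, wire, div, neg]
  rfl

theorem ham_val (x y : Cube n) (l : List (LocalTerm n k)) :
    (ham x y l).val = (l.map fun h => h.entry x y).sum := by
  induction l with
  | nil => rfl
  | cons h l ih => simp only [ham, bind_val, add, entry, ih, List.map_cons, List.sum_cons]

theorem overwrites_val (h : LocalTerm n k) (x : Cube n) (cs : List ℕ) :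
    (overwrites h x cs).val = cs.map fun c => h.overwrite x c := by
  induction cs with
  | nil => rfl
  | cons c cs ih => simp only [overwrites, bind_val, pure_val, ih, List.map_cons]

theorem candidates_val (x : Cube n) (l : List (LocalTerm n k)) :
    (candidates x l).val =
      l.flatMap fun h => (List.range (2 ^ k)).map fun c => h.overwrite x c := by
  induction l with
  | nil => rfl
  | cons h l ih =>
    simp only [candidates, bind_val, pure_val, ih, overwrites_val, List.flatMap_cons]

theorem clean_val (x : Cube n) (l : List (Cube n)) :
    (clean x l).val = (l.filter fun y => y ≠ x).dedup := by
  induction l with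
  | nil => rfl
  | cons y l ih =>
    simp only [clean, bind_val, ite_val, pure_val, ih]
    by_cases h1 : y = x
    · simp [h1]
    · rw [List.filter_cons_of_pos (by simpa using h1)]
      by_cases h2 : y ∈ (l.filter fun y => y ≠ x).dedup
      · rw [if_pos (.inr h2), List.dedup_cons_of_mem' h2]
      · rw [if_neg (by tauto), List.dedup_cons_of_notMem' h2]

theorem sum_val (l : List (Cube n × ℚ)) : (sum l).val = (l.map Prod.snd).sum := by
  induction l with
  | nil => rfl
  | cons e l ih => simp only [sum, bind_val, add, ih, List.map_cons, List.sum_cons]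

theorem anyNeg_val (l : List (Cube n × ℚ)) :
    (anyNeg l).val = l.any fun e => decide (e.2 < 0) := by
  induction l with
  | nil => rfl
  | cons e l ih => simp only [anyNeg, bind_val, pure_val, lt, ih, List.any_cons]

theorem divAll_val (d : ℚ) (l : List (Cube n × ℚ)) :
    (divAll d l).val = l.map fun e => (e.1, e.2 / d) := by
  induction l with
  | nil => rfl
  | cons e l ih => simp only [divAll, bind_val, pure_val, div, ih, List.map_cons]

theorem pick_val {C : AmpCircuit n} (d : Supp C) (l : List (Supp C × ℚ)) (v : ℝ) :
    (pick d.1 (l.map fun e => (e.1.1, e.2)) v).val = (_root_.pick d l v).1 := by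
  induction l generalizing v with
  | nil => rfl
  | cons e l ih =>
    simp only [List.map_cons, pick, bind_val, ite_val, pure_val, ih, _root_.pick]
    split_ifs <;> rfl

theorem column_val (I : LHInstance n k) (C : AmpCircuit n) (x : Cube n) (cx : ℚ)
    (l : List (Cube n)) :
    (column I C x cx l).val =
      (((l.filter fun y => decide (C.amp y ≠ 0)).map fun y =>
          if 0 < cx * I.ham x y * C.amp y then I.ham x y * (C.amp y / cx) else 0).sum,
        (l.filter fun y => decide (C.amp y ≠ 0)).map fun y => (y,
          if 0 < cx * I.ham x y * C.amp y then 0 else -(I.ham x y * (C.amp y / cx)))) := by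
  induction l with
  | nil => rfl
  | cons y l ih =>
    have hham : (ham x y I.terms).val = I.ham x y := ham_val x y I.terms
    simp only [column, bind_val, ite_val, pure_val, amp_val, eq, lt, mul, div, neg, add, hham, ih]
    by_cases hy : C.amp y = 0
    · simp [hy]
    · by_cases hp : 0 < cx * I.ham x y * C.amp y
      · simp [hy, hp, add_comm]
      · simp [hy, hp]

end Timed

section Correctness

variable {n k : ℕ} (I : LHInstance n k) (w : Witness n)

/-- The first component of `Timed.column` completes the diagonal entry of the generator. -/
theorem column_fst_eq (hI : I.ham.IsSymm) (x : Supp w.circuit) :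
    I.ham x.1 x.1 - w.lam + (Timed.column I w.circuit x.1 (w.circuit.amp x.1)
      (I.neighbours x.1)).val.1 = -genS I w x x := by
  have hx := x.2
  rw [Timed.column_val, genS, generator_apply, fixedNode_self, neg_neg, div_self hx, mul_one,
    Matrix.submatrix_apply, shiftedHam_apply_self]
  congr 1
  rw [← map_val_suppNeighbours, List.map_map, ← Finset.add_sum_erase _ _ (Finset.mem_univ x),
    if_neg (fun h => h.1 rfl), zero_add, ← sum_suppNeighbours I w.circuit x]
  · refine congrArg List.sum (List.map_congr_left fun y hy => ?_)
    have hne : x.1 ≠ y.1 := (LHInstance.ne_of_mem_neighbours (mem_suppNeighbours.1 hy)).symm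
    have hne' : x ≠ y := fun h => hne (congrArg _ h)
    simp only [Function.comp, InSPlus, ne_eq, hne', not_false_eq_true, true_and,
      Matrix.submatrix_apply, shiftedHam_apply_ne I w.lam hne]
  · intro y hyx hy
    have hne : x.1 ≠ y.1 := fun h => hyx (Subtype.ext h.symm)
    have h0 : I.ham x.1 y.1 = 0 := by
      by_contra h
      rw [hI.apply] at h
      exact hy (I.mem_neighbours hne.symm h)
    simp [shiftedHam_apply_ne I w.lam hne, h0]

/-- The second component of `Timed.column` lists the entries of the generator off the diagonal. -/
theorem column_snd_eq (hI : I.ham.IsSymm) (x : Supp w.circuit) :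
    (Timed.column I w.circuit x.1 (w.circuit.amp x.1) (I.neighbours x.1)).val.2 =
      (suppNeighbours I w.circuit x.1).map fun y => (y.1, genS I w y x) := by
  rw [Timed.column_val]
  simp only
  rw [← map_val_suppNeighbours, List.map_map]
  refine List.map_congr_left fun y hy => ?_
  have hne : y.1 ≠ x.1 := LHInstance.ne_of_mem_neighbours (mem_suppNeighbours.1 hy)
  have hne' : y ≠ x := fun h => hne (congrArg _ h)
  have hs : I.ham x.1 y.1 = I.ham y.1 x.1 := hI.apply _ _
  simp only [Function.comp, genS, generator_apply, fixedNode_ne hne', InSPlus, ne_eq, hne',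
    not_false_eq_true, true_and, Matrix.submatrix_apply, shiftedHam_apply_ne I w.lam hne, hs]
  have hc : w.circuit.amp x.1 * I.ham y.1 x.1 * w.circuit.amp y.1 =
      w.circuit.amp y.1 * I.ham y.1 x.1 * w.circuit.amp x.1 := by ring
  rw [hc]
  split_ifs <;> simp

theorem checkLoop_val (hI : I.ham.IsSymm) (p t r : ℕ) (ω : Fin r → Sample) (x : Supp w.circuit)
    (τ : ℝ) : (Timed.checkLoop I w p t r ω x.1 τ).val = checkLoop I w p t r ω x τ := by
  induction r generalizing x τ with
  | zero => rfl
  | succ r ih =>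
    set col := Timed.column I w.circuit x.1 (w.circuit.amp x.1) (I.neighbours x.1) with hcol
    have hham : (Timed.ham x.1 x.1 I.terms).val = I.ham x.1 x.1 := Timed.ham_val _ _ _
    have hnb : (Timed.clean x.1 (Timed.candidates x.1 I.terms).val).val = I.neighbours x.1 := by
      rw [Timed.clean_val, Timed.candidates_val]; rfl
    have hg : -(I.ham x.1 x.1 - w.lam + col.val.1) = genS I w x x := by
      rw [hcol, column_fst_eq I w hI, neg_neg]
    have hsnd : col.val.2 = (suppNeighbours I w.circuit x.1).map fun y => (y.1, genS I w y x) :=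
      column_snd_eq I w hI x
    have hsum : genS I w x x + (col.val.2.map Prod.snd).sum = ∑ z, genS I w z x := by
      rw [hsnd, List.map_map, ← Finset.add_sum_erase _ _ (Finset.mem_univ x),
        ← sum_suppNeighbours I w.circuit x _ fun y h h' => genS_eq_zero I w x y h h']
      rfl
    have hneg : (col.val.2.any fun e => decide (e.2 < 0)) = true ↔
        ∃ y, y ≠ x ∧ genS I w y x < 0 := by
      rw [hsnd]
      simp only [List.any_map, List.any_eq_true, Function.comp, decide_eq_true_eq]
      constructor
      · rintro ⟨y, hy, hlt⟩
        exact ⟨y, fun h => LHInstance.ne_of_mem_neighbours (mem_suppNeighbours.1 hy)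
          (congrArg _ h), hlt⟩
      · rintro ⟨y, hy, hlt⟩
        refine ⟨y, mem_suppNeighbours.2 ?_, hlt⟩
        by_contra h
        rw [genS_eq_zero I w x y hy h] at hlt
        exact lt_irrefl _ hlt
    have hdist : (col.val.2.map fun e => (e.1, e.2 / |genS I w x x|)) =
        (jumps I w x).map fun e => (e.1.1, e.2) := by
      rw [hsnd, jumps, List.map_map, List.map_map]
      rfl
    simp only [Timed.checkLoop, Timed.bind_val, Timed.ite_val, Timed.pure_val, Timed.amp_val,
      Timed.ratBits, Timed.sub, Timed.add, Timed.neg, Timed.abs, Timed.eq, Timed.sum_val,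
      Timed.anyNeg_val, Timed.divAll_val, hham, hnb, ← hcol, hg, hsum, hdist, Timed.pick_val, ih,
      checkLoop]
    by_cases h1 : (t : ℝ) ≤ τ
    · rw [if_pos h1, if_pos h1]
    rw [if_neg h1, if_neg h1]
    by_cases h2 : RatBits p (w.circuit.amp x.1)
    · rw [if_neg (by simpa using h2), if_neg (not_not.2 h2)]
      by_cases h3 : ∑ z, genS I w z x ≠ 0 ∨ ∃ y, y ≠ x ∧ genS I w y x < 0
      · rw [if_pos h3, if_pos]
        rw [← hneg] at h3
        simpa using h3
      · rw [if_neg h3, if_neg]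
        · simp
        · rw [← hneg] at h3
          simpa using h3
    · rw [if_pos (by simpa using h2), if_pos h2]

theorem protocol_val (B : Bounds) (T : ℕ[X]) (I : LHInstance n B.k) (w : Witness n)
    (hI : I.ham.IsSymm) (ω : Fin (maxJumps B T I + 1) → Sample) :
    (Timed.protocol B T I w ω).val = protocol B T I w ω := by
  simp only [Timed.protocol, Timed.bind_val, Timed.ite_val, Timed.pure_val, Timed.lt, Timed.eq,
    Timed.amp_val, protocol]
  by_cases h1 : I.a < w.lam
  · simp [h1]
  · by_cases h2 : w.circuit.amp w.xin = 0
    · simp [h2]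
    · simp [h1, h2, ← checkLoop_val I w hI]

end Correctness

/-! ### Running time -/

/-- Functions `ℕ → ℕ` given by polynomials with natural coefficients. -/
def IsNatPoly (f : ℕ → ℕ) : Prop := ∃ P : ℕ[X], ∀ x, f x = P.eval x

namespace IsNatPoly

theorem eval (P : ℕ[X]) : IsNatPoly fun x => P.eval x := ⟨P, fun _ => rfl⟩

theorem const (c : ℕ) : IsNatPoly fun _ => c := ⟨C c, fun x => by simp⟩

theorem id : IsNatPoly fun x => x := ⟨X, fun x => by simp⟩

theorem add {f g : ℕ → ℕ} (hf : IsNatPoly f) (hg : IsNatPoly g) : IsNatPoly fun x => f x + g x := by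
  obtain ⟨P, hP⟩ := hf
  obtain ⟨Q, hQ⟩ := hg
  exact ⟨P + Q, fun x => by simp [hP, hQ]⟩

theorem mul {f g : ℕ → ℕ} (hf : IsNatPoly f) (hg : IsNatPoly g) : IsNatPoly fun x => f x * g x := by
  obtain ⟨P, hP⟩ := hf
  obtain ⟨Q, hQ⟩ := hg
  exact ⟨P * Q, fun x => by simp [hP, hQ]⟩

theorem pow {f : ℕ → ℕ} (hf : IsNatPoly f) (d : ℕ) : IsNatPoly fun x => f x ^ d := by
  obtain ⟨P, hP⟩ := hf
  exact ⟨P ^ d, fun x => by simp [hP]⟩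

theorem comp {f g : ℕ → ℕ} (hf : IsNatPoly f) (hg : IsNatPoly g) : IsNatPoly fun x => f (g x) := by
  obtain ⟨P, hP⟩ := hf
  obtain ⟨Q, hQ⟩ := hg
  exact ⟨P.comp Q, fun x => by simp [hP, hQ]⟩

end IsNatPoly

/-- Polynomials with natural coefficients are monotone. -/
theorem eval_mono_nat (P : ℕ[X]) {x y : ℕ} (h : x ≤ y) : P.eval x ≤ P.eval y := by
  rw [eval_eq_sum_range, eval_eq_sum_range]
  exact Finset.sum_le_sum fun i _ => Nat.mul_le_mul_left _ (Nat.pow_le_pow_left h i)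

namespace Timed

variable {n k : ℕ}

/-- Steps for one operation on fractions of height at most `W`. -/
def arithBound (W : ℕ) : ℕ := (4 * W + 1) ^ 2

theorem opCost_le {a b : ℚ} {W : ℕ} (ha : height a ≤ W) (hb : height b ≤ W) :
    opCost a b ≤ arithBound W := by
  have h1 := ratSize_le_two_mul_height a
  have h2 := ratSize_le_two_mul_height b
  exact Nat.pow_le_pow_left (by omega) 2

theorem isNatPoly_arithBound : IsNatPoly arithBound :=
  (((IsNatPoly.const 4).mul .id).add (.const 1)).pow 2

theorem wires_cost_le (x : Cube n) (gs : List (Gate n)) (w : List Bool) :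
    (wires x gs w).cost ≤ (gs.map Gate.size).sum +
      gs.length * (2 * (w.length + gs.length) + n + 1) := by
  induction gs generalizing w with
  | nil => simp [wires, pure_cost]
  | cons g gs ih =>
    have h := ih (w ++ [g.eval x w])
    have h2 : (w ++ [g.eval x w]).length = w.length + 1 := by simp
    rw [h2] at h
    simp only [wires, bind_cost, tick, List.map_cons, List.sum_cons, List.length_cons]
    have h3 : w.length + 1 + gs.length = w.length + (gs.length + 1) := by omega
    rw [h3] at h
    rw [add_one_mul gs.length]
    omega

theorem number_cost_le (w : List Bool) (l : List ℕ) :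
    (number w l).cost ≤ (l.map fun i => Nat.size i + 1).sum + l.length * (w.length + l.length) := by
  induction l with
  | nil => simp [number, pure_cost]
  | cons i l ih =>
    simp only [number, bind_cost, pure_cost, wire, tick, List.map_cons, List.sum_cons,
      List.length_cons]
    have h : l.length * (w.length + l.length) ≤ l.length * (w.length + (l.length + 1)) :=
      Nat.mul_le_mul_left _ (by omega)
    rw [add_one_mul l.length]
    omega

/-- Steps for the evaluation of a circuit of size at most `q`. -/
def ampBound (q : ℕ) : ℕ :=
  q + q * (3 * q + 1) + 2 * (q + q * (2 * q)) + (2 * q + 1) + 2 * arithBound q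

theorem isNatPoly_ampBound : IsNatPoly ampBound :=
  (((IsNatPoly.id.add (.mul .id (((IsNatPoly.const 3).mul .id).add (.const 1)))).add
    ((IsNatPoly.const 2).mul (IsNatPoly.id.add (.mul .id ((IsNatPoly.const 2).mul .id))))).add
    (((IsNatPoly.const 2).mul .id).add (.const 1))).add
    ((IsNatPoly.const 2).mul isNatPoly_arithBound)

theorem amp_cost_le (C : AmpCircuit n) (x : Cube n) {q : ℕ} (hC : C.size ≤ q) (hn : n ≤ q) :
    (amp C x).cost ≤ ampBound q := by
  have hq : 1 ≤ q := C.one_le_size.trans hC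
  have hsz : (C.gates.map Gate.size).sum + (Nat.size C.sign + 1) +
    (C.num.map fun i => Nat.size i + 1).sum + (C.den.map fun i => Nat.size i + 1).sum ≤ q := hC
  have hg := C.length_gates_le.trans hC
  have hnum := C.length_num_le.trans hC
  have hden := C.length_den_le.trans hC
  set wv := (wires x C.gates []).val with hwv
  have hlen : wv.length ≤ q := by
    have h : ∀ (gs : List (Gate n)) (w : List Bool),
        (gs.foldl (fun w g => w ++ [g.eval x w]) w).length = w.length + gs.length := by
      intro gs
      induction gs with
      | nil => simp
      | cons g gs ih => intro w; rw [List.foldl_cons, ih]; simp; omega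
    rw [hwv, wires_val, h]
    simpa using hg
  have h1 : (wires x C.gates []).cost ≤ q + q * (3 * q + 1) := by
    refine (wires_cost_le x C.gates []).trans (add_le_add (by omega) ?_)
    refine Nat.mul_le_mul hg ?_
    simp only [List.length_nil]
    omega
  have h2 : (number wv C.num).cost ≤ q + q * (2 * q) :=
    (number_cost_le wv C.num).trans (add_le_add (by omega) (Nat.mul_le_mul hnum (by omega)))
  have h3 : (number wv C.den).cost ≤ q + q * (2 * q) :=
    (number_cost_le wv C.den).trans (add_le_add (by omega) (Nat.mul_le_mul hden (by omega)))
  have hnat : ∀ l : List ℕ, l.length ≤ q → height (((number wv l).val : ℕ) : ℚ) ≤ q := by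
    intro l hl
    refine height_natCast_le ?_ hq
    rw [number_val]
    refine (natOfBits_lt _).trans_le (Nat.pow_le_pow_right two_pos ?_)
    simpa using hl
  have h4 : opCost (((number wv C.num).val : ℕ) : ℚ) (((number wv C.den).val : ℕ) : ℚ) ≤
      arithBound q := opCost_le (hnat _ hnum) (hnat _ hden)
  have hval : height ((((number wv C.num).val : ℕ) : ℚ) / (((number wv C.den).val : ℕ) : ℚ)) ≤
      q := by
    have h5 := C.height_amp_le x
    rw [← amp_val] at h5
    simp only [amp, bind_val, ite_val, pure_val, div, neg] at h5
    split_ifs at h5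
    · rw [height_neg] at h5; exact h5.trans hC
    · exact h5.trans hC
  have h6 := opCost_le hval (height_zero.le.trans hq)
  simp only [amp, bind_cost, ite_cost, pure_cost, div, neg, wire, ← hwv]
  have h7 : ∀ b : Bool, (if b = true then
      opCost ((((number wv C.num).val : ℕ) : ℚ) / (((number wv C.den).val : ℕ) : ℚ)) 0 else 0) ≤
      arithBound q := by
    intro b
    cases b
    · simp
    · simpa using h6
  have h8 := h7 (wv.getD C.sign false)
  unfold ampBound
  omega

/-- The data of an instance and of a witness, except for the final time, are bounded by `q`. -/
structure Fits (q p : ℕ) (I : LHInstance n k) (w : Witness n) : Prop where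
  qubits_le : n ≤ q
  pow_le : 2 ^ k ≤ q
  circuit_le : w.circuit.size ≤ q
  terms_le : I.terms.length ≤ q
  bits_le : p ≤ q
  lam_le : height w.lam ≤ q
  bits_mat : ∀ h ∈ I.terms, ∀ r s, RatBits p (h.mat r s)

/-- Height of the matrix entries of the Hamiltonian. -/
def hamHeight (q : ℕ) : ℕ := q * (q + 2) + 1

theorem isNatPoly_hamHeight : IsNatPoly hamHeight :=
  (IsNatPoly.id.mul (IsNatPoly.id.add (.const 2))).add (.const 1)

/-- Steps for the computation of a matrix entry of the Hamiltonian. -/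
def hamBound (q : ℕ) : ℕ :=
  q * ((q + 1) * (q + 1) + q ^ 2 + 2 * (q + 1) + arithBound (hamHeight q))

theorem isNatPoly_hamBound : IsNatPoly hamBound :=
  IsNatPoly.id.mul ((((((IsNatPoly.id.add (.const 1)).mul (IsNatPoly.id.add (.const 1))).add
    (IsNatPoly.id.pow 2)).add ((IsNatPoly.const 2).mul (IsNatPoly.id.add (.const 1)))).add
      (isNatPoly_arithBound.comp isNatPoly_hamHeight)))

theorem ham_cost_le {q p : ℕ} (hn : n ≤ q) (hk : 2 ^ k ≤ q) (hp : p ≤ q) (x y : Cube n)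
    (l : List (LocalTerm n k)) (hl : l.length ≤ q) (hb : ∀ h ∈ l, ∀ r s, RatBits p (h.mat r s)) :
    (ham x y l).cost ≤ l.length * ((q + 1) * (q + 1) + q ^ 2 + 2 * (q + 1) +
      arithBound (hamHeight q)) := by
  induction l with
  | nil => simp [ham, pure_cost]
  | cons h l ih =>
    have hkq : k < q := (Nat.lt_two_pow_self).trans_le hk
    rw [List.length_cons] at hl
    have hb' : ∀ h ∈ l, ∀ r s, RatBits p (h.mat r s) := fun h' hh' => hb h' (.tail _ hh')
    have hent := LocalTerm.height_entry_le (hb h (.head _)) x y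
    have h1 := ratSize_le_two_mul_height (h.entry x y)
    have h2 : (n + 1) * (k + 1) ≤ (q + 1) * (q + 1) := Nat.mul_le_mul (by omega) (by omega)
    have h3 : 4 ^ k ≤ q ^ 2 := by
      have : 4 ^ k = (2 ^ k) ^ 2 := by rw [← pow_mul, mul_comm, pow_mul]; norm_num
      rw [this]
      exact Nat.pow_le_pow_left hk 2
    have hsum : height (ham x y l).val ≤ hamHeight q := by
      rw [ham_val]
      refine (height_sum_entry_le l hb' x y).trans ?_
      exact add_le_add_left (Nat.mul_le_mul (by omega) (by omega)) 1
    have hent' : height (h.entry x y) ≤ hamHeight q := by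
      refine hent.trans ?_
      have : 1 * (q + 2) ≤ q * (q + 2) := Nat.mul_le_mul_right _ (by omega)
      unfold hamHeight
      omega
    have h4 : opCost (h.entry x y) (ham x y l).val ≤ arithBound (hamHeight q) :=
      opCost_le hent' hsum
    have h5 := ih (by omega) hb'
    simp only [ham, bind_cost, entry, add, List.length_cons]
    rw [add_one_mul l.length]
    omega

theorem overwrites_cost (h : LocalTerm n k) (x : Cube n) (cs : List ℕ) :
    (overwrites h x cs).cost = cs.length * ((k + 1) * (n + 1)) := by
  induction cs with
  | nil => simp [overwrites, pure_cost]
  | cons c cs ih =>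
    simp only [overwrites, bind_cost, pure_cost, tick, ih, List.length_cons]
    rw [add_one_mul cs.length]
    omega

/-- Steps for the generation of the candidates. -/
def candBound (q : ℕ) : ℕ := q * (q * ((q + 1) * (q + 1)) + q * (q + 1))

theorem isNatPoly_candBound : IsNatPoly candBound := by
  have hq1 := IsNatPoly.id.add (.const 1)
  exact IsNatPoly.id.mul ((IsNatPoly.id.mul (hq1.mul hq1)).add (IsNatPoly.id.mul hq1))

theorem candidates_cost_le {q : ℕ} (hn : n ≤ q) (hk : 2 ^ k ≤ q) (x : Cube n)
    (l : List (LocalTerm n k)) :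
    (candidates x l).cost ≤ l.length * (q * ((q + 1) * (q + 1)) + q * (q + 1)) := by
  have hkq : k < q := (Nat.lt_two_pow_self).trans_le hk
  induction l with
  | nil => simp [candidates, pure_cost]
  | cons h l ih =>
    simp only [candidates, bind_cost, pure_cost, tick, overwrites_cost, overwrites_val,
      List.length_map, List.length_range, List.length_cons]
    rw [add_one_mul l.length]
    have h1 : 2 ^ k * ((k + 1) * (n + 1)) ≤ q * ((q + 1) * (q + 1)) :=
      Nat.mul_le_mul hk (Nat.mul_le_mul (by omega) (by omega))
    have h2 : 2 ^ k * (n + 1) ≤ q * (q + 1) := Nat.mul_le_mul hk (by omega)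
    omega

theorem clean_cost_le (x : Cube n) (l : List (Cube n)) :
    (clean x l).cost ≤ l.length * ((n + 1) * (l.length + 2)) := by
  induction l with
  | nil => simp [clean, pure_cost]
  | cons y l ih =>
    have hlen : (clean x l).val.length ≤ l.length := by
      rw [clean_val]
      exact ((List.dedup_sublist _).trans List.filter_sublist).length_le
    simp only [clean, bind_cost, ite_cost, pure_cost, tick, List.length_cons, ite_self]
    rw [add_one_mul l.length]
    have h1 : l.length * ((n + 1) * (l.length + 2)) ≤ l.length * ((n + 1) * (l.length + 1 + 2)) :=
      Nat.mul_le_mul_left _ (Nat.mul_le_mul_left _ (by omega))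
    have h2 : (n + 1) * ((clean x l).val.length + 2) ≤ (n + 1) * (l.length + 1 + 2) :=
      Nat.mul_le_mul_left _ (by omega)
    omega

/-- Height of the entries of a column of the generator off the diagonal. -/
def entryHeight (q : ℕ) : ℕ := hamHeight q + 2 * q

theorem isNatPoly_entryHeight : IsNatPoly entryHeight :=
  isNatPoly_hamHeight.add ((IsNatPoly.const 2).mul .id)

/-- Height of the sums over a column of the generator. -/
def sumHeight (q : ℕ) : ℕ := q * q * (entryHeight q + 1) + 1

theorem isNatPoly_sumHeight : IsNatPoly sumHeight :=
  ((IsNatPoly.id.mul .id).mul (isNatPoly_entryHeight.add (.const 1))).add (.const 1)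

/-- Height of all fractions that occur in one step of the loop. -/
def maxHeight (q : ℕ) : ℕ := hamHeight q + q + 3 + 2 * sumHeight q + entryHeight q

theorem isNatPoly_maxHeight : IsNatPoly maxHeight :=
  (((isNatPoly_hamHeight.add .id).add (.const 3)).add
    ((IsNatPoly.const 2).mul isNatPoly_sumHeight)).add isNatPoly_entryHeight

/-- Steps for the treatment of one neighbour in the computation of a column. -/
def colBound (q : ℕ) : ℕ := ampBound q + hamBound q + 8 * arithBound (maxHeight q) + (q + 1)

theorem isNatPoly_colBound : IsNatPoly colBound :=
  ((isNatPoly_ampBound.add isNatPoly_hamBound).add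
    ((IsNatPoly.const 8).mul (isNatPoly_arithBound.comp isNatPoly_maxHeight))).add
    (IsNatPoly.id.add (.const 1))

section Step

variable {I : LHInstance n k} {w : Witness n} {p q : ℕ}

theorem Fits.height_amp (hf : Fits q p I w) (x : Cube n) : height (w.circuit.amp x) ≤ q :=
  (w.circuit.height_amp_le x).trans hf.circuit_le

theorem Fits.height_ham (hf : Fits q p I w) (x y : Cube n) : height (I.ham x y) ≤ hamHeight q :=
  (height_sum_entry_le I.terms hf.bits_mat x y).trans
    (add_le_add_left (Nat.mul_le_mul hf.terms_le (add_le_add_left hf.bits_le 2)) 1)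

theorem Fits.height_ratio (hf : Fits q p I w) (x y : Cube n) :
    height (I.ham x y * (w.circuit.amp y / w.circuit.amp x)) ≤ entryHeight q := by
  have h1 := hf.height_ham x y
  have h2 := hf.height_amp x
  have h3 := hf.height_amp y
  have h4 := height_div_le (w.circuit.amp y) (w.circuit.amp x)
  have h5 := height_mul_le (I.ham x y) (w.circuit.amp y / w.circuit.amp x)
  unfold entryHeight
  omega

theorem one_le_entryHeight (q : ℕ) : 1 ≤ entryHeight q := by
  unfold entryHeight hamHeight; omega

theorem Fits.height_column_fst (hf : Fits q p I w) (x : Cube n) (l : List (Cube n))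
    (hl : l.length ≤ q * q) :
    height (column I w.circuit x (w.circuit.amp x) l).val.1 ≤ sumHeight q := by
  rw [column_val]
  refine (height_sum_le (e := entryHeight q) _ fun a ha => ?_).trans ?_
  · obtain ⟨y, -, rfl⟩ := List.mem_map.1 ha
    split_ifs
    · exact hf.height_ratio x y
    · exact height_zero.le.trans (one_le_entryHeight q)
  · rw [List.length_map]
    exact add_le_add_left (Nat.mul_le_mul_right _ ((List.length_filter_le _ _).trans hl)) 1

theorem Fits.height_column_snd (hf : Fits q p I w) (x : Cube n) (l : List (Cube n)) :
    ∀ e ∈ (column I w.circuit x (w.circuit.amp x) l).val.2, height e.2 ≤ entryHeight q := by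
  rw [column_val]
  intro e he
  obtain ⟨y, -, rfl⟩ := List.mem_map.1 he
  dsimp only
  split_ifs
  · exact height_zero.le.trans (one_le_entryHeight q)
  · rw [height_neg]; exact hf.height_ratio x y

theorem length_column_snd (x : Cube n) (l : List (Cube n)) :
    (column I w.circuit x (w.circuit.amp x) l).val.2.length ≤ l.length := by
  rw [column_val, List.length_map]
  exact List.length_filter_le _ _

theorem Fits.column_cost_le (hf : Fits q p I w) (x : Cube n) (l : List (Cube n))
    (hl : l.length ≤ q * q) :
    (column I w.circuit x (w.circuit.amp x) l).cost ≤ l.length * colBound q := by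
  induction l with
  | nil => simp [column, pure_cost]
  | cons y l ih =>
    rw [List.length_cons] at hl
    have h0 := ih (by omega)
    have hsum := hf.height_column_fst x l (by omega)
    have hcx := hf.height_amp x
    have hcy := hf.height_amp y
    have hH := hf.height_ham x y
    have hW1 : entryHeight q ≤ maxHeight q := by unfold maxHeight; omega
    have hW2 : sumHeight q ≤ maxHeight q := by unfold maxHeight; omega
    have hW3 : hamHeight q + 2 * q ≤ maxHeight q := hW1
    have hz : height 0 ≤ maxHeight q :=
      height_zero.le.trans ((one_le_entryHeight q).trans hW1)
    have m1 := height_mul_le (w.circuit.amp x) (I.ham x y)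
    have m2 := height_mul_le (w.circuit.amp x * I.ham x y) (w.circuit.amp y)
    have m3 := height_div_le (w.circuit.amp y) (w.circuit.amp x)
    have m4 := (hf.height_ratio x y).trans hW1
    have hA := amp_cost_le w.circuit y hf.circuit_le hf.qubits_le
    have hham : (ham x y I.terms).val = I.ham x y := ham_val x y I.terms
    have hHc : (ham x y I.terms).cost ≤ hamBound q :=
      (ham_cost_le hf.qubits_le hf.pow_le hf.bits_le x y I.terms hf.terms_le hf.bits_mat).trans
        (Nat.mul_le_mul_right _ hf.terms_le)
    have c1 : opCost (w.circuit.amp y) 0 ≤ arithBound (maxHeight q) :=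
      opCost_le (by omega) hz
    have c2 : opCost (w.circuit.amp x) (I.ham x y) ≤ arithBound (maxHeight q) :=
      opCost_le (by omega) (by omega)
    have c3 : opCost (w.circuit.amp x * I.ham x y) (w.circuit.amp y) ≤
        arithBound (maxHeight q) := opCost_le (by omega) (by omega)
    have c4 : opCost 0 (w.circuit.amp x * I.ham x y * w.circuit.amp y) ≤
        arithBound (maxHeight q) := opCost_le hz (by omega)
    have c5 : opCost (w.circuit.amp y) (w.circuit.amp x) ≤ arithBound (maxHeight q) :=
      opCost_le (by omega) (by omega)
    have c6 : opCost (I.ham x y) (w.circuit.amp y / w.circuit.amp x) ≤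
        arithBound (maxHeight q) := opCost_le (by omega) (by omega)
    have c7 : opCost (column I w.circuit x (w.circuit.amp x) l).val.1
        (I.ham x y * (w.circuit.amp y / w.circuit.amp x)) ≤ arithBound (maxHeight q) :=
      opCost_le (by omega) m4
    have c8 : opCost (I.ham x y * (w.circuit.amp y / w.circuit.amp x)) 0 ≤
        arithBound (maxHeight q) := opCost_le m4 hz
    have hn := hf.qubits_le
    simp only [column, bind_cost, ite_cost, pure_cost, amp_val, eq, mul, lt, div, add, neg, tick,
      hham, List.length_cons]
    rw [add_one_mul l.length]
    have hcol : colBound q = ampBound q + hamBound q + 8 * arithBound (maxHeight q) + (q + 1) :=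
      rfl
    split_ifs <;> omega

theorem sum_cost_le {W e : ℕ} (l : List (Cube n × ℚ)) (hl : ∀ a ∈ l, height a.2 ≤ e)
    (he : e ≤ W) (hW : l.length * (e + 1) + 1 ≤ W) :
    (sum l).cost ≤ l.length * arithBound W := by
  induction l with
  | nil => simp [sum, pure_cost]
  | cons a l ih =>
    rw [List.length_cons, add_one_mul l.length] at hW
    have hl' : ∀ a ∈ l, height a.2 ≤ e := fun a ha => hl a (.tail _ ha)
    have h1 := ih hl' (by omega)
    have h2 : height (sum l).val ≤ W := by
      rw [sum_val]
      have := height_sum_le (e := e) (l.map Prod.snd) fun b hb => by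
        obtain ⟨a, ha, rfl⟩ := List.mem_map.1 hb
        exact hl' a ha
      rw [List.length_map] at this
      omega
    have h3 : opCost a.2 (sum l).val ≤ arithBound W := opCost_le ((hl a (.head _)).trans he) h2
    simp only [sum, bind_cost, add, List.length_cons]
    rw [add_one_mul l.length]
    omega

theorem anyNeg_cost_le {W : ℕ} (l : List (Cube n × ℚ)) (hl : ∀ a ∈ l, height a.2 ≤ W)
    (hW : 1 ≤ W) : (anyNeg l).cost ≤ l.length * (arithBound W + 1) := by
  induction l with
  | nil => simp [anyNeg, pure_cost]
  | cons a l ih =>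
    have h1 := ih fun a ha => hl a (.tail _ ha)
    have h2 : opCost a.2 0 ≤ arithBound W := opCost_le (hl a (.head _)) (height_zero.le.trans hW)
    simp only [anyNeg, bind_cost, pure_cost, lt, tick, List.length_cons]
    rw [add_one_mul l.length]
    omega

theorem divAll_cost_le {W : ℕ} (d : ℚ) (l : List (Cube n × ℚ)) (hl : ∀ a ∈ l, height a.2 ≤ W)
    (hd : height d ≤ W) : (divAll d l).cost ≤ l.length * (arithBound W + n + 1) := by
  induction l with
  | nil => simp [divAll, pure_cost]
  | cons a l ih =>
    have h1 := ih fun a ha => hl a (.tail _ ha)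
    have h2 : opCost a.2 d ≤ arithBound W := opCost_le (hl a (.head _)) hd
    simp only [divAll, bind_cost, pure_cost, div, tick, List.length_cons]
    rw [add_one_mul l.length]
    omega

theorem pick_cost_le {W : ℕ} (d : Cube n) (l : List (Cube n × ℚ))
    (hl : ∀ a ∈ l, height a.2 ≤ W) (v : ℝ) :
    (pick d l v).cost ≤ l.length * (2 * W + n + 3) + (n + 1) := by
  induction l generalizing v with
  | nil => simp [pick, bind_cost, pure_cost, tick]
  | cons a l ih =>
    have h1 := ih (fun a ha => hl a (.tail _ ha)) (v - a.2)
    have h2 := ratSize_le_two_mul_height a.2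
    have h3 := hl a (.head _)
    simp only [pick, bind_cost, ite_cost, pure_cost, tick, List.length_cons]
    rw [add_one_mul l.length]
    split_ifs <;> omega

/-- Steps for one pass of the loop. -/
def stepBound (q : ℕ) : ℕ :=
  2 + ampBound q + (3 * q + 1) + candBound q + q * q * ((q + 1) * (q * q + 2)) +
    q * q * colBound q + hamBound q + 7 * arithBound (maxHeight q) +
    q * q * (3 * arithBound (maxHeight q) + 4 * maxHeight q + 2 * q + 5) +
    (q + 1) + (2 * maxHeight q + 6)

theorem isNatPoly_stepBound : IsNatPoly stepBound := by
  have hq := IsNatPoly.id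
  have hqq := hq.mul hq
  have hW := isNatPoly_maxHeight
  have hA := isNatPoly_arithBound.comp isNatPoly_maxHeight
  have hc := IsNatPoly.const
  exact ((((((((((hc 2).add isNatPoly_ampBound).add (((hc 3).mul hq).add (hc 1))).add
    isNatPoly_candBound).add (hqq.mul ((hq.add (hc 1)).mul (hqq.add (hc 2))))).add
    (hqq.mul isNatPoly_colBound)).add isNatPoly_hamBound).add ((hc 7).mul hA)).add
    (hqq.mul (((((hc 3).mul hA).add ((hc 4).mul hW)).add ((hc 2).mul hq)).add (hc 5)))).add
    (hq.add (hc 1))).add (((hc 2).mul hW).add (hc 6))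

theorem Fits.checkLoop_cost_le (hf : Fits q p I w) (t r : ℕ) (ω : Fin r → Sample) (x : Cube n)
    (τ : ℝ) : (checkLoop I w p t r ω x τ).cost ≤ r * stepBound q + 2 := by
  induction r generalizing x τ with
  | zero => simp [checkLoop, bind_cost, pure_cost, tick]
  | succ r ih =>
    have hn := hf.qubits_le
    have hA := amp_cost_le w.circuit x hf.circuit_le hf.qubits_le
    have hcx := hf.height_amp x
    have hbits : ratSize (w.circuit.amp x) + p + 1 ≤ 3 * q + 1 := by
      have h1 := ratSize_le_two_mul_height (w.circuit.amp x)
      have h2 := hf.bits_le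
      omega
    have hcand : (candidates x I.terms).cost ≤ candBound q :=
      (candidates_cost_le hf.qubits_le hf.pow_le x I.terms).trans
        (Nat.mul_le_mul_right _ hf.terms_le)
    have hcl : (candidates x I.terms).val.length ≤ q * q := by
      have h1 : (candidates x I.terms).val = I.candidates x := candidates_val x I.terms
      rw [h1, I.length_candidates x]
      exact Nat.mul_le_mul hf.terms_le hf.pow_le
    have hclean : (clean x (candidates x I.terms).val).cost ≤ q * q * ((q + 1) * (q * q + 2)) :=
      (clean_cost_le x _).trans (Nat.mul_le_mul hcl (Nat.mul_le_mul (by omega) (by omega)))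
    set nb := (clean x (candidates x I.terms).val).val with hnb
    have hnbl : nb.length ≤ q * q := by
      rw [hnb, clean_val]
      exact (((List.dedup_sublist _).trans List.filter_sublist).length_le).trans hcl
    have hcolc : (column I w.circuit x (w.circuit.amp x) nb).cost ≤ q * q * colBound q :=
      (hf.column_cost_le x nb hnbl).trans (Nat.mul_le_mul_right _ hnbl)
    have hc1 := hf.height_column_fst x nb hnbl
    have hc2 := hf.height_column_snd x nb
    have hc3 := (length_column_snd (I := I) (w := w) x nb).trans hnbl
    set col := (column I w.circuit x (w.circuit.amp x) nb).val with hcol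
    have hham : (ham x x I.terms).val = I.ham x x := ham_val x x I.terms
    have hHc : (ham x x I.terms).cost ≤ hamBound q :=
      (ham_cost_le hf.qubits_le hf.pow_le hf.bits_le x x I.terms hf.terms_le hf.bits_mat).trans
        (Nat.mul_le_mul_right _ hf.terms_le)
    have hH := hf.height_ham x x
    have hlam := hf.lam_le
    have hW : maxHeight q = hamHeight q + q + 3 + 2 * sumHeight q + entryHeight q := rfl
    have he1 := one_le_entryHeight q
    have hz : height 0 ≤ maxHeight q := height_zero.le.trans (by omega)
    have g1 := height_sub_le (I.ham x x) w.lam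
    have g2 := height_add_le (I.ham x x - w.lam) col.1
    have g3 := height_neg (I.ham x x - w.lam + col.1)
    set g : ℚ := -(I.ham x x - w.lam + col.1) with hg
    have hoff : height (sum col.2).val ≤ sumHeight q := by
      rw [sum_val]
      refine (height_sum_le (e := entryHeight q) _ fun a ha => ?_).trans ?_
      · obtain ⟨e, he, rfl⟩ := List.mem_map.1 ha
        exact hc2 e he
      · rw [List.length_map]
        exact add_le_add_left (Nat.mul_le_mul_right _ hc3) 1
    have g4 := height_add_le g (sum col.2).val
    have c1 : opCost (I.ham x x) w.lam ≤ arithBound (maxHeight q) :=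
      opCost_le (by omega) (by omega)
    have c2 : opCost (I.ham x x - w.lam) col.1 ≤ arithBound (maxHeight q) :=
      opCost_le (by omega) (by omega)
    have c3 : opCost (I.ham x x - w.lam + col.1) 0 ≤ arithBound (maxHeight q) :=
      opCost_le (by omega) hz
    have c4 : opCost g (sum col.2).val ≤ arithBound (maxHeight q) :=
      opCost_le (by omega) (by omega)
    have c5 : opCost (g + (sum col.2).val) 0 ≤ arithBound (maxHeight q) :=
      opCost_le (by omega) hz
    have c6 : opCost g 0 ≤ arithBound (maxHeight q) := opCost_le (by omega) hz
    have hsumc : (sum col.2).cost ≤ q * q * arithBound (maxHeight q) := by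
      refine (sum_cost_le (W := maxHeight q) col.2 hc2 (by omega) ?_).trans
        (Nat.mul_le_mul_right _ hc3)
      have h1 : col.2.length * (entryHeight q + 1) + 1 ≤ sumHeight q :=
        add_le_add_left (Nat.mul_le_mul_right _ hc3) 1
      omega
    have hnegc : (anyNeg col.2).cost ≤ q * q * (arithBound (maxHeight q) + 1) :=
      (anyNeg_cost_le (W := maxHeight q) col.2 (fun a ha => (hc2 a ha).trans (by omega))
        (by omega)).trans (Nat.mul_le_mul_right _ hc3)
    have hgabs := height_abs g
    have hdivc : (divAll |g| col.2).cost ≤ q * q * (arithBound (maxHeight q) + q + 1) :=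
      (divAll_cost_le (W := maxHeight q) |g| col.2 (fun a ha => (hc2 a ha).trans (by omega))
        (by omega)).trans (Nat.mul_le_mul hc3 (by omega))
    have hpick : ∀ v, (pick x (divAll |g| col.2).val v).cost ≤
        q * q * (4 * maxHeight q + q + 3) + (q + 1) := by
      intro v
      refine (pick_cost_le (W := 2 * maxHeight q) x (divAll |g| col.2).val (fun a ha => ?_)
        v).trans (add_le_add (Nat.mul_le_mul ?_ (by omega)) (by omega))
      · rw [divAll_val] at ha
        obtain ⟨e, he, rfl⟩ := List.mem_map.1 ha
        have h1 := hc2 e he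
        have h2 := height_div_le e.2 |g|
        dsimp only
        omega
      · rw [divAll_val, List.length_map]
        exact hc3
    have hpick' := hpick ((ω 0).2 : ℝ)
    have hd : ratSize |g| ≤ 2 * maxHeight q := by
      have := ratSize_le_two_mul_height |g|
      omega
    have hstep : stepBound q = 2 + ampBound q + (3 * q + 1) + candBound q +
        q * q * ((q + 1) * (q * q + 2)) + q * q * colBound q + hamBound q +
        7 * arithBound (maxHeight q) +
        (q * q * arithBound (maxHeight q) + q * q * (arithBound (maxHeight q) + 1) +
          q * q * (arithBound (maxHeight q) + q + 1) + q * q * (4 * maxHeight q + q + 3)) +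
        (q + 1) + (2 * maxHeight q + 6) := by
      unfold stepBound; ring
    have hrec := fun y s => ih (Fin.tail ω) y s
    simp only [checkLoop, bind_cost, ite_cost, pure_cost, tick, amp_val, ratBits, sub, add, neg,
      abs, eq, hham, ← hnb, ← hcol, ← hg]
    have hloop := hrec (pick x (divAll |g| col.2).val ((ω 0).2 : ℝ)).val
      (τ + Real.log (1 / ((ω 0).1 : ℝ)) / ((|g| : ℚ) : ℝ))
    have hite : ∀ (P : Prop) [Decidable P] {a b : ℕ}, a ≤ b → (if P then 0 else a) ≤ b := by
      intro P _ a b hab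
      split_ifs
      · exact Nat.zero_le b
      · exact hab
    refine (add_le_add le_rfl <| hite _ <| add_le_add hA <| add_le_add hbits <| hite _ <|
      add_le_add hcand <| add_le_add hclean <| add_le_add hcolc <| add_le_add hHc <|
      add_le_add c1 <| add_le_add c2 <| add_le_add c3 <| add_le_add hsumc <| add_le_add c4 <|
      add_le_add c5 <| add_le_add hnegc <| hite _ <| add_le_add c6 <| hite _ <| add_le_add c6 <|
      add_le_add hdivc <| add_le_add hpick' <| add_le_add (add_le_add_left hd 6) hloop).trans_eq ?_
    rw [add_one_mul r, hstep]
    ring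

end Step

/-- Steps for the protocol, on an instance and a witness that fit into `q`, with final time `t`
and `M` transitions. -/
def protocolBound (q t M : ℕ) : ℕ :=
  q + t + M + 1 + ampBound q + 2 * arithBound (q + 1) + ((M + 1) * stepBound q + 2)

theorem protocol_cost_le (B : Bounds) (T : ℕ[X]) {n : ℕ} (I : LHInstance n B.k)
    (w : Witness n) (ω : Fin (maxJumps B T I + 1) → Sample) {q t M : ℕ}
    (hf : Fits q (B.bits.eval n) I w) (hw : w.size ≤ q) (ha : height I.a ≤ q + 1)
    (ht : T.eval n ≤ t) (hM : maxJumps B T I ≤ M) :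
    (protocol B T I w ω).cost ≤ protocolBound q t M := by
  have hA := amp_cost_le w.circuit w.xin hf.circuit_le hf.qubits_le
  have hlam := hf.lam_le
  have hx := hf.height_amp w.xin
  have c1 : opCost I.a w.lam ≤ arithBound (q + 1) := opCost_le ha (by omega)
  have c2 : opCost (w.circuit.amp w.xin) 0 ≤ arithBound (q + 1) :=
    opCost_le (by omega) (height_zero.le.trans (by omega))
  have hl := hf.checkLoop_cost_le (T.eval n) (maxJumps B T I + 1) ω w.xin 0
  have hM' : (maxJumps B T I + 1) * stepBound q ≤ (M + 1) * stepBound q :=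
    Nat.mul_le_mul_right _ (by omega)
  simp only [protocol, bind_cost, ite_cost, pure_cost, tick, lt, eq, amp_val]
  unfold protocolBound
  split_ifs <;> omega

/-- The number of steps is polynomial in the number of qubits and the length of the witness. -/
theorem exists_protocol_cost_le (B : Bounds) (T : ℕ[X]) :
    ∃ R : ℕ[X], ∀ (n : ℕ) (I : LHInstance n B.k), I.WellFormed B → ∀ w : Witness n,
      ∀ ω, (protocol B T I w ω).cost ≤ R.eval (n + w.size) := by
  let q : ℕ → ℕ := fun N => N + 2 ^ B.k + B.terms.eval N + B.bits.eval N
  let M : ℕ → ℕ := fun N =>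
    2 ^ B.k * B.terms.eval N * N ^ 3 * T.eval N * (2 * B.norm.eval N)
  have hq : IsNatPoly q := ((IsNatPoly.id.add (.const _)).add (.eval _)).add (.eval _)
  have hM : IsNatPoly M := ((((IsNatPoly.const _).mul (.eval _)).mul (IsNatPoly.id.pow 3)).mul
    (.eval _)).mul ((IsNatPoly.const 2).mul (.eval _))
  have hR : IsNatPoly fun N => protocolBound (q N) (T.eval N) (M N) := by
    have hc := IsNatPoly.const
    exact (((((hq.add (.eval T)).add hM).add (hc 1)).add (isNatPoly_ampBound.comp hq)).add
      ((hc 2).mul (isNatPoly_arithBound.comp (hq.add (hc 1))))).add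
        (((hM.add (hc 1)).mul (isNatPoly_stepBound.comp hq)).add (hc 2))
  obtain ⟨R, hR⟩ := hR
  refine ⟨R, fun n I hI w ω => ?_⟩
  rw [← hR]
  have hn : n ≤ n + w.size := Nat.le_add_right _ _
  have hterms := hI.terms_le.trans (eval_mono_nat B.terms hn)
  have hbits := eval_mono_nat B.bits hn
  have hwsize : w.size = ratSize w.lam + w.circuit.size + n := rfl
  have hlam := height_le_ratSize w.lam
  have hqdef : q (n + w.size) = n + w.size + 2 ^ B.k + B.terms.eval (n + w.size) +
    B.bits.eval (n + w.size) := rfl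
  have hpos : 0 < 2 ^ B.k := by positivity
  refine protocol_cost_le B T I w ω ⟨by omega, by omega, by omega, by omega, by omega, by omega,
    hI.bits_mat⟩ (by omega) ?_ (eval_mono_nat T hn) ?_
  · have := hI.bits_a.height_le
    omega
  · refine Nat.mul_le_mul (Nat.mul_le_mul (Nat.mul_le_mul (Nat.mul_le_mul_left _ hterms) ?_) ?_) ?_
    · exact Nat.pow_le_pow_left hn 3
    · exact eval_mono_nat T hn
    · exact Nat.mul_le_mul_left _ (eval_mono_nat B.norm hn)

end Timed

/-! ### The restriction to the support -/

section Restriction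

variable {n k : ℕ}

theorem sum_supp {R : Type*} [AddCommMonoid R] (C : AmpCircuit n) (f : Cube n → R)
    (hf : ∀ x, C.amp x = 0 → f x = 0) : ∑ x : Supp C, f x.1 = ∑ x, f x := by
  rw [← Finset.sum_subtype (Finset.univ.filter fun x => C.amp x ≠ 0) (by simp) f]
  exact Finset.sum_filter_of_ne fun x _ hx hx' => hx (hf x hx')

/-- The restriction of `H - λ̂ I` to the support of the circuit. -/
abbrev hamS (I : LHInstance n k) (w : Witness n) :
    Matrix (Supp w.circuit) (Supp w.circuit) ℚ :=
  (shiftedHam I w.lam).submatrix Subtype.val Subtype.val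

theorem hamS_isSymm {I : LHInstance n k} (hI : I.ham.IsSymm) (w : Witness n) :
    (hamS I w).IsSymm := by
  refine Matrix.IsSymm.ext fun x y => ?_
  by_cases h : x = y
  · rw [h]
  · have h' : x.1 ≠ y.1 := fun h' => h (Subtype.ext h')
    simp only [Matrix.submatrix_apply, shiftedHam_apply_ne I w.lam h',
      shiftedHam_apply_ne I w.lam h'.symm]
    exact hI.apply _ _

theorem sum_hamS_mul_amp (I : LHInstance n k) (w : Witness n) (x : Supp w.circuit) :
    ∑ y, hamS I w x y * w.circuit.amp y.1 =
      ∑ y, I.ham x.1 y * w.circuit.amp y - w.lam * w.circuit.amp x.1 := by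
  have h1 := sum_supp w.circuit (fun y => shiftedHam I w.lam x.1 y * w.circuit.amp y)
    fun y hy => by rw [hy, mul_zero]
  simp only [Matrix.submatrix_apply]
  rw [h1]
  simp [shiftedHam, sub_mul, Matrix.one_apply, mul_ite, ite_mul]

end Restriction

/-! ### Soundness -/

section Soundness

variable {n k : ℕ}

theorem hamReal_isSymm {I : LHInstance n k} (hI : I.ham.IsSymm) : I.hamReal.IsSymm :=
  Matrix.IsSymm.ext fun x y => by
    simp only [LHInstance.hamReal, Matrix.map_apply]
    rw [hI.apply]

/-- For a No instance the restriction of `H - λ̂ I` is bounded from below by `b - λ̂`. -/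
theorem quadForm_hamS {I : LHInstance n k} (hI : I.ham.IsSymm) (hno : I.IsNo) (w : Witness n)
    (v : Supp w.circuit → ℝ) :
    ((I.b : ℝ) - w.lam) * ∑ x, v x ^ 2 ≤ ∑ x, v x * ∑ y, (hamS I w x y : ℝ) * v y := by
  let u : Cube n → ℝ := fun x => if h : w.circuit.amp x ≠ 0 then v ⟨x, h⟩ else 0
  have hu0 : ∀ x, w.circuit.amp x = 0 → u x = 0 := fun x hx => by simp [u, hx]
  have huv : ∀ x : Supp w.circuit, v x = u x.1 := fun x => by simp [u, x.2]
  have h1 : ∑ x, v x ^ 2 = ∑ x, u x ^ 2 := by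
    simp only [huv]
    exact sum_supp w.circuit (fun x => u x ^ 2) fun x hx => by simp [hu0 x hx]
  have h2 : ∑ x, v x * ∑ y, (hamS I w x y : ℝ) * v y =
      ∑ x, u x * ∑ y, (shiftedHam I w.lam x y : ℝ) * u y := by
    simp only [huv, Matrix.submatrix_apply]
    rw [← sum_supp w.circuit (fun x => u x * ∑ y, (shiftedHam I w.lam x y : ℝ) * u y)
      fun x hx => by simp [hu0 x hx]]
    refine Finset.sum_congr rfl fun x _ => ?_
    rw [sum_supp w.circuit (fun y => (shiftedHam I w.lam x.1 y : ℝ) * u y)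
      fun y hy => by simp [hu0 y hy]]
  have h3 : ∑ x, u x * ∑ y, (shiftedHam I w.lam x y : ℝ) * u y =
      ∑ x, u x * ∑ y, I.hamReal x y * u y - w.lam * ∑ x, u x ^ 2 := by
    rw [Finset.mul_sum, ← Finset.sum_sub_distrib]
    refine Finset.sum_congr rfl fun x _ => ?_
    have h4 : ∑ y, (shiftedHam I w.lam x y : ℝ) * u y =
        ∑ y, I.hamReal x y * u y - w.lam * u x := by
      simp [shiftedHam, LHInstance.hamReal, sub_mul, Matrix.one_apply, mul_ite, ite_mul,
        apply_ite (Rat.cast (K := ℝ))]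
    rw [h4]
    ring
  have h5 := groundEnergy_mul_le (hamReal_isSymm hI) u
  have h6 : (I.b : ℝ) * ∑ x, u x ^ 2 ≤ groundEnergy I.hamReal * ∑ x, u x ^ 2 :=
    mul_le_mul_of_nonneg_right hno (Finset.sum_nonneg fun x _ => sq_nonneg _)
  rw [h1, h2, h3, sub_mul]
  linarith

theorem survival_le_of_isNo {I : LHInstance n k} (hI : I.ham.IsSymm) (hno : I.IsNo)
    (w : Witness n) (hw : w.lam ≤ I.a) {ε : ℝ} (hε : ε ≤ (I.b : ℝ) - I.a) (p r : ℕ)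
    (x : Supp w.circuit) {s : ℝ} (hs : 0 ≤ s) :
    survival (genReal I w) (goodSet I w p) r x s ≤
      2 ^ n * 2 ^ (3 * p) * Real.exp (-(ε * s)) := by
  have hG := isGeneratorOn_goodSet I w p
  by_cases hx : x ∈ goodSet I w p
  · have hsymm := hamS_isSymm hI w
    have hφ : ∀ x : Supp w.circuit, w.circuit.amp x.1 ≠ 0 := fun x => x.2
    let φ : Supp w.circuit → ℝ := fun x => (w.circuit.amp x.1 : ℝ)
    have hlam : (w.lam : ℝ) ≤ I.a := by exact_mod_cast hw
    have hdecay := survival_decay hG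
      ((fixedNode (hamS I w) fun x => w.circuit.amp x.1).map fun q => (q : ℝ)) φ ε
      (fun x => Rat.cast_ne_zero.2 (hφ x))
      (fun x y => by
        simp only [genReal_apply, genS, generator_apply, Matrix.map_apply, φ]
        push_cast
        rfl)
      ((fixedNode_isSymm hsymm).map _)
      (fun v => by
        refine le_trans ?_ (quadForm_le_fixedNode hsymm hφ v)
        refine le_trans ?_ (quadForm_hamS hI hno w v)
        exact mul_le_mul_of_nonneg_right (by linarith)
          (Finset.sum_nonneg fun x _ => sq_nonneg _)) r x hs
    have hcard : ∑ y, (goodSet I w p).indicator (fun y => φ y ^ 2) y ≤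
        (2 : ℝ) ^ n * (2 ^ p) ^ 2 := by
      have h1 : ∀ y ∈ Finset.univ, (goodSet I w p).indicator (fun y => φ y ^ 2) y ≤
          ((2 : ℝ) ^ p) ^ 2 := by
        intro y _
        by_cases hy : y ∈ goodSet I w p
        · rw [Set.indicator_of_mem hy, ← sq_abs]
          refine pow_le_pow_left₀ (abs_nonneg _) ?_ 2
          simp only [φ]
          exact_mod_cast hy.1.abs_le
        · rw [Set.indicator_of_notMem hy]; positivity
      refine (Finset.sum_le_card_nsmul _ _ _ h1).trans ?_
      rw [nsmul_eq_mul]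
      refine mul_le_mul_of_nonneg_right ?_ (by positivity)
      have h2 : Fintype.card (Supp w.circuit) ≤ 2 ^ n := by
        refine (Fintype.card_subtype_le _).trans ?_
        simp
      rw [Finset.card_univ]
      exact_mod_cast h2
    have hφx : 1 ≤ 2 ^ p * |φ x| := by
      have := hx.1.one_le_mul_abs x.2
      simp only [φ]
      exact_mod_cast this
    set S := survival (genReal I w) (goodSet I w p) r x s with hS
    have hS0 : 0 ≤ S := survival_nonneg hG r x hs
    have hexp : Real.exp (-(2 * ε * s)) = Real.exp (-(ε * s)) ^ 2 := by
      rw [← Real.exp_nat_mul]; congr 1; push_cast; ring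
    have h1 : (|φ x| * S) ^ 2 ≤ (2 ^ n * 2 ^ p * Real.exp (-(ε * s))) ^ 2 := by
      have h2 : (|φ x| * S) ^ 2 = (φ x * S) ^ 2 := by rw [mul_pow, mul_pow, sq_abs]
      rw [h2]
      refine hdecay.trans ?_
      rw [hexp]
      refine (mul_le_mul_of_nonneg_left hcard (sq_nonneg _)).trans ?_
      have h3 : (1 : ℝ) ≤ 2 ^ n := one_le_pow₀ one_le_two
      have h4 : (2 ^ n * 2 ^ p * Real.exp (-(ε * s))) ^ 2 =
          2 ^ n * (Real.exp (-(ε * s)) ^ 2 * (2 ^ n * (2 ^ p) ^ 2)) := by ring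
      rw [h4]
      exact le_mul_of_one_le_left (by positivity) h3
    have h5 : |φ x| * S ≤ 2 ^ n * 2 ^ p * Real.exp (-(ε * s)) :=
      (pow_le_pow_iff_left₀ (by positivity) (by positivity) two_ne_zero).1 h1
    calc S ≤ 2 ^ p * |φ x| * S := le_mul_of_one_le_left hS0 hφx
      _ = 2 ^ p * (|φ x| * S) := by ring
      _ ≤ 2 ^ p * (2 ^ n * 2 ^ p * Real.exp (-(ε * s))) :=
          mul_le_mul_of_nonneg_left h5 (by positivity)
      _ = 2 ^ n * (2 ^ p * 2 ^ p * 1) * Real.exp (-(ε * s)) := by ring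
      _ ≤ 2 ^ n * (2 ^ p * 2 ^ p * 2 ^ p) * Real.exp (-(ε * s)) := by
          gcongr
          exact one_le_pow₀ one_le_two
      _ = _ := by ring
  · rw [survival_of_notMem _ _ hx]
    positivity

variable (B : Bounds) (T : ℕ[X]) (I : LHInstance n B.k) (w : Witness n)

theorem acceptProb_eq_loopProb (hw : w.lam ≤ I.a) (hx : w.circuit.amp w.xin ≠ 0) :
    acceptProb B T I w = loopProb I w (B.bits.eval n) (T.eval n) (maxJumps B T I + 1)
      ⟨w.xin, hx⟩ 0 := by
  simp [acceptProb, loopProb, protocol, hw.not_gt, hx]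

theorem acceptProb_eq_zero (h : ¬ (w.lam ≤ I.a ∧ w.circuit.amp w.xin ≠ 0)) :
    acceptProb B T I w = 0 := by
  have : ∀ ω, protocol B T I w ω = false := by
    intro ω
    unfold protocol
    by_cases h1 : I.a < w.lam
    · rw [if_pos h1]
    · rw [if_neg h1, dif_neg fun h2 => h ⟨not_lt.1 h1, h2⟩]
  simp [acceptProb, this]

theorem measurableSet_protocol : MeasurableSet {ω | protocol B T I w ω = true} := by
  have h : Measurable (protocol B T I w) := by
    unfold protocol
    by_cases h1 : I.a < w.lam
    · simp only [if_pos h1]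
      exact measurable_const
    · simp only [if_neg h1]
      by_cases h2 : w.circuit.amp w.xin ≠ 0
      · simp only [dif_pos h2]
        exact (measurable_checkLoop I w _ _ _ _).comp (measurable_id.prodMk measurable_const)
      · simp only [dif_neg h2]
        exact measurable_const
  exact h (measurableSet_singleton true)

theorem rejectProb_eq : rejectProb B T I w = 1 - acceptProb B T I w := by
  rw [acceptProb, ← probReal_compl_eq_one_sub (measurableSet_protocol B T I w), rejectProb]
  congr 1
  ext ω
  simp

theorem acceptProb_le_of_isNo (hI : I.WellFormed B) (hno : I.IsNo) {ε : ℝ} (h0 : 0 ≤ ε)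
    (h1 : ε ≤ 1 / 2) (hε : ε ≤ (I.b : ℝ) - I.a) :
    acceptProb B T I w ≤ 2 ^ n * 2 ^ (3 * B.bits.eval n) * (1 - ε / 2) ^ T.eval n := by
  have hpos : (0 : ℝ) ≤ 1 - ε / 2 := by linarith
  by_cases h : w.lam ≤ I.a ∧ w.circuit.amp w.xin ≠ 0
  · rw [acceptProb_eq_loopProb B T I w h.1 h.2]
    by_cases ht : T.eval n = 0
    · rw [loopProb_of_le I w _ _ _ (by rw [ht, Nat.cast_zero]), ht, pow_zero, mul_one]
      exact one_le_mul_of_one_le_of_one_le (one_le_pow₀ one_le_two) (one_le_pow₀ one_le_two)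
    · have ht' : (0 : ℝ) < T.eval n := by exact_mod_cast Nat.pos_of_ne_zero ht
      rw [loopProb_eq_survival I w _ _ _ ht']
      refine (survival_le_of_isNo hI.symm hno w h.1 hε _ _ _ (by linarith)).trans ?_
      refine mul_le_mul_of_nonneg_left ?_ (by positivity)
      have h2 : Real.exp (-ε) ≤ 1 - ε / 2 := by
        have h3 := Real.add_one_le_exp ε
        rw [Real.exp_neg, inv_le_iff_one_le_mul₀ (Real.exp_pos ε)]
        calc (1 : ℝ) ≤ (1 - ε / 2) * (ε + 1) := by nlinarith
          _ ≤ _ := mul_le_mul_of_nonneg_left h3 hpos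
      have h4 : Real.exp (-(ε * (T.eval n - 0))) = Real.exp (-ε) ^ T.eval n := by
        rw [← Real.exp_nat_mul]; congr 1; ring
      rw [h4]
      exact pow_le_pow_left₀ (Real.exp_pos _).le h2 _
  · rw [acceptProb_eq_zero B T I w h]
    positivity

theorem le_rejectProb_of_isNo (hI : I.WellFormed B) (hno : I.IsNo)
    (hT : 4 * B.gap.eval n * (2 * n + 3 * B.bits.eval n) ≤ T.eval n) :
    1 - (1 / 2) ^ n ≤ rejectProb B T I w := by
  have hgap : (1 : ℝ) ≤ ((I.b : ℝ) - I.a) * B.gap.eval n := by exact_mod_cast hI.gap_ge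
  have hg : 1 ≤ B.gap.eval n := by
    by_contra h
    have : B.gap.eval n = 0 := by omega
    rw [this] at hgap
    norm_num at hgap
  set g : ℝ := ((B.gap.eval n : ℕ) : ℝ) with hgdef
  have hg1 : (1 : ℝ) ≤ g := Nat.one_le_cast.2 hg
  have hg0 : (0 : ℝ) < g := by linarith
  have hε0 : 0 ≤ 1 / (2 * g) := by positivity
  have hε1 : 1 / (2 * g) ≤ 1 / 2 := by
    rw [div_le_div_iff₀ (by positivity) (by positivity)]; linarith
  have hε2 : 1 / (2 * g) ≤ (I.b : ℝ) - I.a := by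
    rw [div_le_iff₀ (by positivity)]; linarith
  have h1 := acceptProb_le_of_isNo B T I w hI hno hε0 hε1 hε2
  set K := 2 * n + 3 * B.bits.eval n with hK
  have h2 : (1 - 1 / (2 * g) / 2) ^ T.eval n ≤ (1 / 2 : ℝ) ^ K := by
    have h3 : 1 - 1 / (2 * g) / 2 ≤ Real.exp (-(1 / (4 * g))) := by
      have := Real.add_one_le_exp (-(1 / (4 * g)))
      have h4 : 1 / (2 * g) / 2 = 1 / (4 * g) := by field_simp; norm_num
      rw [h4]; linarith
    have hT' : 4 * g * K ≤ ((T.eval n : ℕ) : ℝ) := by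
      rw [hgdef]; exact_mod_cast hT
    calc (1 - 1 / (2 * g) / 2) ^ T.eval n ≤ Real.exp (-(1 / (4 * g))) ^ T.eval n :=
          pow_le_pow_left₀ (by linarith) h3 _
      _ = Real.exp (-(((T.eval n : ℕ) : ℝ) / (4 * g))) := by
          rw [← Real.exp_nat_mul]; congr 1; ring
      _ ≤ Real.exp (-K) := by
          apply Real.exp_le_exp.2
          rw [neg_le_neg_iff, le_div_iff₀ (by positivity)]
          linarith
      _ = Real.exp (-1) ^ K := by rw [← Real.exp_nat_mul]; congr 1; ring
      _ ≤ (1 / 2) ^ K := by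
          refine pow_le_pow_left₀ (Real.exp_pos _).le ?_ K
          have := Real.add_one_le_exp (1 : ℝ)
          rw [Real.exp_neg, one_div]
          exact inv_anti₀ two_pos (by linarith)
  have h5 : (2 : ℝ) ^ n * 2 ^ (3 * B.bits.eval n) * (1 / 2) ^ K = (1 / 2) ^ n := by
    have h6 : (2 : ℝ) ^ (n + 3 * B.bits.eval n) * (1 / 2) ^ (n + 3 * B.bits.eval n) = 1 := by
      rw [← mul_pow]; norm_num
    have h7 : K = (n + 3 * B.bits.eval n) + n := by omega
    rw [h7, pow_add (1 / 2 : ℝ), ← mul_assoc, ← pow_add, h6, one_mul]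
  have h8 := mul_le_mul_of_nonneg_left h2
    (by positivity : (0 : ℝ) ≤ 2 ^ n * 2 ^ (3 * B.bits.eval n))
  rw [rejectProb_eq]
  linarith

end Soundness

/-! ### Completeness -/

section Completeness

variable {n k : ℕ}

/-- The state that the circuit describes is an eigenvector with the alleged eigenvalue. -/
def IsEigenWitness (I : LHInstance n k) (w : Witness n) : Prop :=
  ∀ x, ∑ y, I.ham x y * w.circuit.amp y = w.lam * w.circuit.amp x

theorem goodSet_eq_univ {I : LHInstance n k} (hI : I.ham.IsSymm) {w : Witness n}
    (hw : IsEigenWitness I w) {p : ℕ} (hp : ∀ x, RatBits p (w.circuit.amp x)) :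
    goodSet I w p = Set.univ := by
  refine Set.eq_univ_of_forall fun x => ⟨hp x.1, ?_, fun y hy => ?_⟩
  · have h : ∑ y, generator (hamS I w) (fun x => w.circuit.amp x.1) y x =
        -(∑ y, hamS I w x y * w.circuit.amp y.1) / w.circuit.amp x.1 :=
      sum_generator (hamS_isSymm hI w) (fun x => x.2) x
    rw [sum_hamS_mul_amp, hw, sub_self, neg_zero, zero_div] at h
    exact h
  · have h : 0 ≤ generator (hamS I w) (fun x => w.circuit.amp x.1) y x :=
      generator_nonneg (fun x => x.2) hy
    exact h

/-- The mean jump rate under `φ²` is at most the number of neighbours times the largest matrix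
entry. -/
theorem sum_sq_mul_rate_le {I : LHInstance n k} (hI : I.ham.IsSymm) {w : Witness n} {p : ℕ}
    (hgood : goodSet I w p = Set.univ) {ν : ℝ} (hν : ∀ x y, |(I.ham x y : ℝ)| ≤ ν) :
    ∑ x : Supp w.circuit, (w.circuit.amp x.1 : ℝ) ^ 2 * (-genReal I w x x) ≤
      ν * (I.terms.length * 2 ^ k) * ∑ x : Supp w.circuit, (w.circuit.amp x.1 : ℝ) ^ 2 := by
  let φ : Supp w.circuit → ℝ := fun x => (w.circuit.amp x.1 : ℝ)
  -- the adjacency relation of the interaction graph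
  let e : Supp w.circuit → Supp w.circuit → ℝ := fun x y =>
    if y ≠ x ∧ I.ham y.1 x.1 ≠ 0 then 1 else 0
  have he0 : ∀ x y, 0 ≤ e x y := fun x y => by
    simp only [e]; split_ifs <;> norm_num
  have hes : ∀ x y, e x y = e y x := fun x y => by
    simp only [e, ne_comm (a := y) (b := x), hI.apply x.1 y.1]
  have hν0 : 0 ≤ ν := (abs_nonneg _).trans (hν (fun _ => false) (fun _ => false))
  have hG := isGeneratorOn_goodSet I w p
  rw [hgood] at hG
  have hx : ∀ x, φ x ^ 2 * (-genReal I w x x) ≤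
      ν * ∑ y, e x y * ((φ x ^ 2 + φ y ^ 2) / 2) := by
    intro x
    rw [← hG.sum_erase (Set.mem_univ x), Finset.mul_sum, Finset.mul_sum]
    have hself : ν * (e x x * ((φ x ^ 2 + φ x ^ 2) / 2)) = 0 := by simp [e]
    rw [← Finset.add_sum_erase Finset.univ (fun y => ν * (e x y * ((φ x ^ 2 + φ y ^ 2) / 2)))
      (Finset.mem_univ x), hself, zero_add]
    refine Finset.sum_le_sum fun y hy => ?_
    have hyx := Finset.ne_of_mem_erase hy
    have hyx' : y.1 ≠ x.1 := fun h => hyx (Subtype.ext h)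
    have h1 : φ x ^ 2 * genReal I w y x ≤
        |(I.ham y.1 x.1 : ℝ)| * ((φ x ^ 2 + φ y ^ 2) / 2) := by
      have h2 := sq_mul_generator_le (H := hamS I w) (φ := fun x => w.circuit.amp x.1)
        (fun x => x.2) hyx
      have hH : hamS I w y x = I.ham y.1 x.1 := shiftedHam_apply_ne I w.lam hyx'
      rw [hH] at h2
      have h3 : (((w.circuit.amp x.1) ^ 2 * genS I w y x : ℚ) : ℝ) ≤
        ((|I.ham y.1 x.1| * (((w.circuit.amp x.1) ^ 2 + (w.circuit.amp y.1) ^ 2) / 2) : ℚ) : ℝ) :=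
        Rat.cast_le.2 h2
      push_cast at h3
      exact h3
    refine h1.trans ?_
    by_cases h0 : I.ham y.1 x.1 = 0
    · rw [h0, Rat.cast_zero, abs_zero, zero_mul]
      have := he0 x y
      positivity
    · have h2 : e x y = 1 := by simp [e, hyx, h0]
      rw [h2, one_mul]
      exact mul_le_mul_of_nonneg_right (hν _ _) (by positivity)
  have hdeg : ∀ x, ∑ y, e x y ≤ (I.terms.length * 2 ^ k : ℝ) := by
    intro x
    have hself : e x x = 0 := by simp [e]
    rw [← Finset.add_sum_erase Finset.univ (fun y => e x y) (Finset.mem_univ x), hself, zero_add,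
      ← sum_suppNeighbours I w.circuit x (fun y => e x y) fun y hyx hy => ?_]
    · have h1 : ((suppNeighbours I w.circuit x.1).map fun y => e x y).sum ≤
          (suppNeighbours I w.circuit x.1).length := by
        have h2 := List.sum_le_card_nsmul ((suppNeighbours I w.circuit x.1).map fun y => e x y)
          1 fun a ha => by
            obtain ⟨y, -, rfl⟩ := List.mem_map.1 ha
            simp only [e]; split_ifs <;> norm_num
        simpa using h2
      refine h1.trans ?_
      have h3 : (suppNeighbours I w.circuit x.1).length ≤ I.terms.length * 2 ^ k :=
        (List.length_filterMap_le _ _).trans (I.length_neighbours_le x.1)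
      exact_mod_cast h3
    · have h0 : I.ham y.1 x.1 = 0 := by
        by_contra h
        exact hy (I.mem_neighbours (fun h' => hyx (Subtype.ext h')) h)
      simp [e, h0]
  have hsym : ∑ x, ∑ y, e x y * ((φ x ^ 2 + φ y ^ 2) / 2) = ∑ x, φ x ^ 2 * ∑ y, e x y := by
    have h1 : ∑ x, ∑ y, e x y * φ y ^ 2 = ∑ x, ∑ y, e x y * φ x ^ 2 := by
      rw [Finset.sum_comm]
      refine Finset.sum_congr rfl fun x _ => Finset.sum_congr rfl fun y _ => ?_
      rw [hes]
    have h2 : ∑ x, ∑ y, e x y * ((φ x ^ 2 + φ y ^ 2) / 2) =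
        1 / 2 * ∑ x, ∑ y, e x y * φ x ^ 2 + 1 / 2 * ∑ x, ∑ y, e x y * φ y ^ 2 := by
      simp only [Finset.mul_sum, ← Finset.sum_add_distrib]
      exact Finset.sum_congr rfl fun x _ => Finset.sum_congr rfl fun y _ => by ring
    rw [h2, h1, ← add_mul, add_halves, one_mul]
    refine Finset.sum_congr rfl fun x _ => ?_
    rw [Finset.mul_sum]
    exact Finset.sum_congr rfl fun y _ => mul_comm _ _
  calc ∑ x, φ x ^ 2 * (-genReal I w x x)
      ≤ ∑ x, ν * ∑ y, e x y * ((φ x ^ 2 + φ y ^ 2) / 2) := Finset.sum_le_sum fun x _ => hx x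
    _ = ν * ∑ x, φ x ^ 2 * ∑ y, e x y := by rw [← Finset.mul_sum, hsym]
    _ ≤ ν * ∑ x, φ x ^ 2 * (I.terms.length * 2 ^ k) := by
        refine mul_le_mul_of_nonneg_left (Finset.sum_le_sum fun x _ => ?_) hν0
        exact mul_le_mul_of_nonneg_left (hdeg x) (sq_nonneg _)
    _ = _ := by rw [← Finset.sum_mul]; ring

/-- If the bound `M` for the number of jumps is at least twice the bound for their mean number,
then some starting point survives with probability at least `1 / 2`. -/
theorem exists_start {I : LHInstance n k} (hI : I.ham.IsSymm) {w : Witness n}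
    (hw : IsEigenWitness I w) {p : ℕ} (hp : ∀ x, RatBits p (w.circuit.amp x))
    [Nonempty (Supp w.circuit)] {ν : ℝ} (hν : ∀ x y, |(I.ham x y : ℝ)| ≤ ν) {t M : ℕ}
    (hM : 0 < n → 2 * (t * (ν * (I.terms.length * 2 ^ k))) ≤ M) :
    ∃ x : Supp w.circuit, 1 / 2 ≤ loopProb I w p t (M + 1) x 0 := by
  rcases Nat.eq_zero_or_pos t with rfl | ht
  · obtain ⟨x⟩ := ‹Nonempty (Supp w.circuit)›
    refine ⟨x, ?_⟩
    rw [loopProb_of_le I w p _ x (by simp)]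
    norm_num
  have ht' : (0 : ℝ) < t := by exact_mod_cast ht
  have hgood := goodSet_eq_univ hI hw hp
  have hG := isGeneratorOn_goodSet I w p
  rw [hgood] at hG
  let π : Supp w.circuit → ℝ := fun x => (w.circuit.amp x.1 : ℝ) ^ 2
  have hπ : ∀ x, 0 ≤ π x := fun x => sq_nonneg _
  have hbal : ∀ x y, π x * genReal I w y x = π y * genReal I w x y := by
    intro x y
    have h : w.circuit.amp x.1 ^ 2 * genS I w y x = w.circuit.amp y.1 ^ 2 * genS I w x y := by
      unfold genS
      rw [sq_mul_generator (φ := fun x => w.circuit.amp x.1) (fun x => x.2) x y,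
        sq_mul_generator (φ := fun x => w.circuit.amp x.1) (fun x => x.2) y x,
        (fixedNode_isSymm (hamS_isSymm hI w)).apply x y]
      ring
    simp only [π, genReal_apply]
    exact_mod_cast h
  have hmarkov := survival_markov hG π hπ hbal (M + 1) ht'.le
  set U : Supp w.circuit → ℝ := fun x => survival (genReal I w) Set.univ (M + 1) x t with hU
  have hU1 : 0 ≤ ∑ x, π x * (1 - U x) := Finset.sum_nonneg fun x _ =>
    mul_nonneg (hπ x) (sub_nonneg.2 (survival_le_one hG _ x ht'.le))
  have hhalf : ∑ x, π x * (1 - U x) ≤ ∑ x, π x * (1 / 2) := by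
    rcases Nat.eq_zero_or_pos n with rfl | hn
    · -- without qubits there is a single state, which has no jumps
      have h0 : ∀ x, genReal I w x x = 0 := by
        intro x
        have h1 := hG.sum_erase (Set.mem_univ x)
        rw [Finset.sum_eq_zero fun y hy => absurd (Subsingleton.elim y x)
          (Finset.ne_of_mem_erase hy)] at h1
        linarith
      simp only [h0, neg_zero, mul_zero, Finset.sum_const_zero] at hmarkov
      have h2 : (0 : ℝ) < ((M + 1 : ℕ) : ℝ) := by positivity
      have h3 : ∑ x, π x * (1 - U x) ≤ 0 := by
        by_contra h
        exact absurd hmarkov (not_le.2 (mul_pos h2 (not_le.1 h)))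
      exact h3.trans (Finset.sum_nonneg fun x _ => mul_nonneg (hπ x) (by norm_num))
    · have h1 := sum_sq_mul_rate_le hI hgood hν
      have h2 := mul_le_mul_of_nonneg_left h1 ht'.le
      have h3 := hmarkov.trans h2
      rw [← Finset.sum_mul]
      have hπ0 : 0 ≤ ∑ x, π x := Finset.sum_nonneg fun x _ => hπ x
      have h4 := mul_le_mul_of_nonneg_right (hM hn) hπ0
      have h5 : (0 : ℝ) < ((M + 1 : ℕ) : ℝ) := by positivity
      have h6 : (M : ℝ) ≤ ((M + 1 : ℕ) : ℝ) := by push_cast; linarith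
      have h7 := mul_le_mul_of_nonneg_right h6 hπ0
      have h8 : ((M + 1 : ℕ) : ℝ) * ∑ x, π x * (1 - U x) ≤
          ((M + 1 : ℕ) : ℝ) * ((∑ x, π x) * (1 / 2)) := by
        have h9 : (t : ℝ) * (ν * (I.terms.length * 2 ^ k) * ∑ x, π x) =
            t * (ν * (I.terms.length * 2 ^ k)) * ∑ x, π x := by ring
        change _ ≤ (t : ℝ) * (ν * (I.terms.length * 2 ^ k) * ∑ x, π x) at h3
        rw [h9] at h3
        linarith
      exact le_of_mul_le_mul_left h8 h5
  obtain ⟨x, -, hx⟩ := Finset.exists_le_of_sum_le Finset.univ_nonempty hhalf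
  refine ⟨x, ?_⟩
  have hπx : 0 < π x := by
    have : (w.circuit.amp x.1 : ℝ) ≠ 0 := Rat.cast_ne_zero.2 x.2
    positivity
  have h1 := le_of_mul_le_mul_left hx hπx
  rw [loopProb_eq_survival I w p _ x ht', hgood, sub_zero]
  change _ ≤ U x
  linarith

/-- The loop does not refer to the starting point that the witness proposes. -/
theorem checkLoop_start (I : LHInstance n k) (lam : ℚ) (C : AmpCircuit n) (x₁ x₂ : Cube n)
    (p t r : ℕ) (ω : Fin r → Sample) (x : Supp C) (τ : ℝ) :
    checkLoop I ⟨lam, C, x₁⟩ p t r ω x τ = checkLoop I ⟨lam, C, x₂⟩ p t r ω x τ := by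
  induction r generalizing x τ with
  | zero => rfl
  | succ r ih =>
    simp only [checkLoop, ih]
    rfl

/-- The eigenvalue is a short sum of products of entries of `H` with ratios of amplitudes. -/
theorem height_lam_le {I : LHInstance n k} (hI : I.ham.IsSymm) {w : Witness n}
    (hw : IsEigenWitness I w) (x : Supp w.circuit) {p q m : ℕ}
    (hbits : ∀ h ∈ I.terms, ∀ r s, RatBits p (h.mat r s)) (hC : w.circuit.size ≤ q)
    (hm : I.terms.length ≤ m) :
    height w.lam ≤ (m * 2 ^ k + 1) * (m * (p + 2) + 1 + q + 1) + 1 + q := by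
  have h1 : w.lam = (∑ y, I.ham x.1 y * w.circuit.amp y) / w.circuit.amp x.1 := by
    rw [hw, mul_div_assoc, div_self x.2, mul_one]
  let f : Supp w.circuit → ℚ := fun y => I.ham x.1 y.1 * w.circuit.amp y.1
  have h2 : ∑ y, I.ham x.1 y * w.circuit.amp y =
      ((x :: suppNeighbours I w.circuit x.1).map f).sum := by
    rw [← sum_supp w.circuit (fun y => I.ham x.1 y * w.circuit.amp y) fun y hy => by
        rw [hy, mul_zero],
      ← Finset.add_sum_erase Finset.univ f (Finset.mem_univ x),
      ← sum_suppNeighbours I w.circuit x f fun y hyx hy => ?_]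
    · rfl
    · have h0 : I.ham x.1 y.1 = 0 := by
        by_contra h
        rw [hI.apply] at h
        exact hy (I.mem_neighbours (fun h' => hyx (Subtype.ext h')) h)
      simp [f, h0]
  have hf : ∀ y, height (f y) ≤ m * (p + 2) + 1 + q := by
    intro y
    have h3 := height_mul_le (I.ham x.1 y.1) (w.circuit.amp y.1)
    have h4 : height (I.ham x.1 y.1) ≤ m * (p + 2) + 1 :=
      (height_sum_entry_le I.terms hbits x.1 y.1).trans
        (add_le_add_left (Nat.mul_le_mul_right _ hm) 1)
    have h5 := w.circuit.height_amp_le y.1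
    simp only [f]
    omega
  have h6 := height_sum_le ((x :: suppNeighbours I w.circuit x.1).map f) fun a ha => by
    obtain ⟨y, -, rfl⟩ := List.mem_map.1 ha
    exact hf y
  have h7 : ((x :: suppNeighbours I w.circuit x.1).map f).length ≤ m * 2 ^ k + 1 := by
    rw [List.length_map, List.length_cons]
    exact add_le_add_left ((List.length_filterMap_le _ _).trans
      ((I.length_neighbours_le x.1).trans (Nat.mul_le_mul_right _ hm))) 1
  have h8 := Nat.mul_le_mul_right (m * (p + 2) + 1 + q + 1) h7
  have h9 := height_div_le ((x :: suppNeighbours I w.circuit x.1).map f).sum (w.circuit.amp x.1)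
  have h10 := w.circuit.height_amp_le x.1
  rw [h1, h2]
  omega

/-- A bound for the length of an honest witness. -/
noncomputable def witnessBound (B : Bounds) : ℕ[X] :=
  2 * ((B.terms * 2 ^ B.k + 1) * (B.terms * (B.bits + 2) + 1 + B.circ + 1) + 1 + B.circ) +
    B.circ + X

theorem exists_witness (B : Bounds) (T : ℕ[X]) (I : LHInstance n B.k) (hI : I.WellFormed B)
    (hyes : I.IsYes B) :
    ∃ w : Witness n, w.size ≤ (witnessBound B).eval n ∧ 1 / 2 ≤ acceptProb B T I w := by
  obtain ⟨hE, ψ, hψ1, hψ2, C, hC, hbits, c, hc, -, hamp⟩ := hyes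
  obtain ⟨x₀, hx₀⟩ : ∃ x, C.amp x ≠ 0 := by
    by_contra! h
    have h1 : ∀ x, ψ x = 0 := fun x => by
      have h2 := hamp x
      rw [h x, Rat.cast_zero] at h2
      exact (mul_eq_zero.1 h2.symm).resolve_left hc.ne'
    simp [h1] at hψ1
  have heig : ∀ x, ∑ y, (I.ham x y : ℝ) * C.amp y = groundEnergy I.hamReal * C.amp x := by
    intro x
    have h1 := congrFun hψ2 x
    simp only [Matrix.mulVec, dotProduct, Pi.smul_apply, smul_eq_mul] at h1
    rw [hamp x, ← mul_left_comm, ← h1, Finset.mul_sum]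
    refine Finset.sum_congr rfl fun y _ => ?_
    rw [hamp y, mul_left_comm]
    rfl
  -- the ground energy is rational, as the amplitudes are
  let lam : ℚ := (∑ y, I.ham x₀ y * C.amp y) / C.amp x₀
  have hlam : (lam : ℝ) = groundEnergy I.hamReal := by
    have h1 : (C.amp x₀ : ℝ) ≠ 0 := Rat.cast_ne_zero.2 hx₀
    simp only [lam, Rat.cast_div, Rat.cast_sum, Rat.cast_mul]
    rw [heig, mul_div_assoc, div_self h1, mul_one]
  have heigw : ∀ xin, IsEigenWitness I ⟨lam, C, xin⟩ := by
    intro xin x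
    have h1 := heig x
    rw [← hlam] at h1
    exact_mod_cast h1
  have hν : ∀ x y, |(I.ham x y : ℝ)| ≤ ((B.norm.eval n : ℕ) : ℝ) := fun x y =>
    (abs_apply_le_norm I.hamReal x y).trans hI.norm_le
  have : Nonempty (Supp C) := ⟨⟨x₀, hx₀⟩⟩
  have : Nonempty (Supp (⟨lam, C, x₀⟩ : Witness n).circuit) := ⟨⟨x₀, hx₀⟩⟩
  obtain ⟨x, hx⟩ := exists_start hI.symm (heigw x₀) (p := B.bits.eval n) hbits hν
    (t := T.eval n) (M := maxJumps B T I) fun hn => by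
      have h1 : 2 * (T.eval n * (B.norm.eval n * (I.terms.length * 2 ^ B.k))) ≤
          maxJumps B T I := by
        have h2 : 1 ≤ n ^ 3 := Nat.one_le_pow _ _ hn
        calc 2 * (T.eval n * (B.norm.eval n * (I.terms.length * 2 ^ B.k)))
            = 2 ^ B.k * I.terms.length * 1 * T.eval n * (2 * B.norm.eval n) := by ring
          _ ≤ _ := by unfold maxJumps; gcongr
      exact_mod_cast h1
  refine ⟨⟨lam, C, x.1⟩, ?_, ?_⟩
  · have h1 := height_lam_le hI.symm (heigw x.1) x hI.bits_mat hC hI.terms_le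
    have h2 := ratSize_le_two_mul_height lam
    have h3 : (witnessBound B).eval n = 2 * ((B.terms.eval n * 2 ^ B.k + 1) *
        (B.terms.eval n * (B.bits.eval n + 2) + 1 + B.circ.eval n + 1) + 1 + B.circ.eval n) +
        B.circ.eval n + n := by
      simp [witnessBound]
    rw [h3]
    change height lam ≤ _ at h1
    change ratSize lam + C.size + n ≤ _
    omega
  · rw [acceptProb_eq_loopProb B T I ⟨lam, C, x.1⟩ (by
      have : (lam : ℝ) ≤ I.a := hlam.trans_le hE
      exact_mod_cast this) x.2]
    refine hx.trans_eq ?_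
    unfold loopProb
    simp only [checkLoop_start I lam C x₀ x.1]

end Completeness

/-! ### The protocol decides the promise problem -/

theorem theorem3 (B : Bounds) :
    ∃ L T₀ : ℕ[X], ∀ T : ℕ[X],
      -- polynomial running time, for all inputs and all outcomes of the sampling
      (∃ R : ℕ[X], ∀ (n : ℕ) (I : LHInstance n B.k), I.WellFormed B → ∀ w : Witness n,
        ∀ ω : Fin (maxJumps B T I + 1) → Sample,
          (Timed.protocol B T I w ω).val = protocol B T I w ω ∧
          (Timed.protocol B T I w ω).cost ≤ R.eval (n + w.size)) ∧
      -- acceptance is an event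
      (∀ (n : ℕ) (I : LHInstance n B.k), I.WellFormed B → ∀ w : Witness n,
        MeasurableSet {ω | protocol B T I w ω = true}) ∧
      -- completeness
      (∀ (n : ℕ) (I : LHInstance n B.k), I.WellFormed B → I.IsYes B →
        ∃ w : Witness n, w.size ≤ L.eval n ∧ 1 / 2 ≤ acceptProb B T I w) ∧
      -- decay of the acceptance probability
      (∀ (n : ℕ) (I : LHInstance n B.k), I.WellFormed B → I.IsNo →
        ∀ ε : ℝ, 0 ≤ ε → ε ≤ 1 / 2 → ε ≤ (I.b : ℝ) - (I.a : ℝ) → ∀ w : Witness n,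
          acceptProb B T I w ≤
            2 ^ n * 2 ^ (3 * B.bits.eval n) * (1 - ε / 2) ^ T.eval n) ∧
      -- soundness for all sufficiently large times
      ((∀ n : ℕ, T₀.eval n ≤ T.eval n) →
        ∀ (n : ℕ) (I : LHInstance n B.k), I.WellFormed B → I.IsNo →
          ∀ w : Witness n, 1 - (1 / 2) ^ n ≤ rejectProb B T I w) := by
  refine ⟨witnessBound B, 4 * B.gap * (2 * X + 3 * B.bits), fun T => ⟨?_, ?_, ?_, ?_, ?_⟩⟩
  · obtain ⟨R, hR⟩ := Timed.exists_protocol_cost_le B T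
    exact ⟨R, fun n I hI w ω => ⟨protocol_val B T I w hI.symm ω, hR n I hI w ω⟩⟩
  · exact fun n I _ w => measurableSet_protocol B T I w
  · exact fun n I hI hyes => exists_witness B T I hI hyes
  · exact fun n I hI hno ε h0 h1 hε w => acceptProb_le_of_isNo B T I w hI hno h0 h1 hε
  · intro hT n I hI hno w
    refine le_rejectProb_of_isNo B T I w hI hno ?_
    simpa using hT n
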